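/- Let $q$ be a power of $2$, let $G=Sp_6(q)$ with standard symplectic basis $e_1,e_2,e_3,f_1,f_2,f_3$ of its natural module, and let $H=Sp_4(q)$, viewed as the pointwise stabilizer of $e_3,f_3$ in $G$. Let $\ell$ be an odd prime. A subgroup $Q$ of a finite group $X$ is called $\ell$-radical if it is an $\ell$-subgroup and $Q=\mathbf O_\ell(N_X(Q))$. Notation. Write $GL_r^{+}(q)=GL_r(q)$ and $GL_r^{-}(q)=GU_r(q)$, embedded into $Sp_{2r}(q)$ in the standard way: $A\mapsto\mathrm{diag}(A,{}^{T}\!A^{-1})$ for $+$, and for $-$ by regarding $\mathbb F_{q^2}^r$ with the form $\mathrm{Tr}_{\mathbb F_{q^2}/\mathbb F_q}(\sum_i x_iy_i^q)$ as the natural symplectic space over $\mathbb F_q$. For integers $r_1\ge r_2\ge r_3\ge 0$ with $r_1+r_2+r_3\le 3$, let $\prod_i GL_{r_i}^\epsilon(q)\le\prod_i Sp_{2r_i}(q)\le G$ act on consecutive blocks $\{e_j,f_j\}$ of the basis, trivially on the remaining basis vectors. - If $\ell\mid q^2-1$, let $\epsilon\in\{\pm1\}$ with $\ell\mid q-\epsilon$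 and put $Q_{r_1,r_2,r_3}=\mathbf O_\ell\bigl(Z(\prod_i GL_{r_i}^\epsilon(q))\bigr)$; zero indices are omitted. - If $\ell=3$ (so that $3\mid q-\epsilon$), let $P$ be a Sylow $3$-subgroup of $G$, and let $R=Z\,E\le GL_3^\epsilon(q)\le G$ be the central product of $Z=Q_3$ and an extraspecial group $E\le GL_3^\epsilon(q)$ of order $27$ and exponent $3$. - If $\ell\mid q^4+q^2+1$, let $\epsilon\in\{\pm1\}$ with $\ell\mid q^2+\epsilon q+1$ and put $Q^{(3)}=\mathbf O_\ell(Z(GL_1^\epsilon(q^3)))$, where $GL_1^\epsilon(q^3)\le GL_3^\epsilon(q)\le G$. (For $\ell=3$ this is the same $\epsilon$ as above.) - If $\ell\mid q^2+1$, put $Q^{(2)}=\mathbf O_\ell(Z(GU_1(q^2)))$, where $GU_1(q^2)\le Sp_4(q)=H$. Here $GL_1^+(q^k)=\mathbb F_{q^k}^\times$, and $GL_1^-(q^k)=GU_1(q^k)$ is the group of all $u\in\mathbb F_{q^{2k}}$ with $u^{q^k+1}=1$, acting by multiplication on $\mathbb F_{q^{2k}}$ with the form $\mathrm{Tr}_{\mathbb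 F_{q^{2k}}/\mathbb F_q}(xy^{q^k})$. All these subgroups are determined up to conjugacy. **Proposition 3.1.** (1) Let $Q$ be a nontrivial $\ell$-radical subgroup of $G$. - If $3\ne\ell\mid q^2-1$, then $Q$ is $G$-conjugate to one of $Q_1,Q_2,Q_3,Q_{1,1},Q_{2,1},Q_{1,1,1}$. - If $\ell=3$ (which divides $q^2-1$), then $Q$ is $G$-conjugate to one of $Q_1,Q_2,Q_3,Q_{1,1},Q_{2,1},Q_{1,1,1},Q^{(3)},P,R$. - If $3\ne\ell\mid q^4+q^2+1$, then $Q$ is $G$-conjugate to $Q^{(3)}$. - If $\ell\mid q^2+1$, then $Q$ is $G$-conjugate to $Q^{(2)}$. (2) Let $Q$ be a nontrivial $\ell$-radical subgroup of $H$. - If $\ell\mid q^2-1$, then $Q$ is $H$-conjugate to one of $Q_1,Q_2,Q_{1,1}$. - If $\ell\mid q^2+1$, then $Q$ is $H$-conjugate to $Q^{(2)}$. Moreover, no two of the subgroups in any one of these lists are $G$-conjugate. -/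

import Mathlib

open Matrix

noncomputable section

namespace RadSub

/-! ### Group theory: `O_ℓ`, radical subgroups, conjugacy -/

/-- `O_ℓ(N)`, the largest normal `ℓ`-subgroup of a (finite) group `N`: the subgroup generated by
all normal `ℓ`-subgroups. -/
def OCore (ℓ : ℕ) (N : Type*) [Group N] : Subgroup N :=
  sSup {P : Subgroup N | P.Normal ∧ IsPGroup ℓ P}

/-- `Q` is an `ℓ`-radical subgroup of `G`: an `ℓ`-subgroup with `Q = O_ℓ(N_G(Q))`. -/
def IsRadical (ℓ : ℕ) {G : Type*} [Group G] (Q : Subgroup G) : Prop :=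
  IsPGroup ℓ Q ∧
    Q = (OCore ℓ (Subgroup.normalizer (Q : Set G))).map (Subgroup.normalizer (Q : Set G)).subtype

/-- `O_ℓ(Z(X))` for a subgroup `X` of `G`, as a subgroup of `G`. -/
def OCenter (ℓ : ℕ) {G : Type*} [Group G] (X : Subgroup G) : Subgroup G :=
  ((OCore ℓ (Subgroup.center X)).map (Subgroup.center X).subtype).map X.subtype

/-- The subgroups `A` and `B` of `G` are conjugate by an element of the subgroup `K`. -/
def ConjIn {G : Type*} [Group G] (K A B : Subgroup G) : Prop :=
  ∃ k ∈ K, A.map (MulAut.conj k).toMonoidHom = B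

/-! ### Symplectic frames of finite fields -/

/-- For an alternating nondegenerate form on a space of dimension at least `2n` there are `2n`
vectors with the standard symplectic Gram matrix. -/
theorem exists_symplectic_family {F V : Type*} [Field F] [AddCommGroup V] [Module F V]
    [FiniteDimensional F V] (B : LinearMap.BilinForm F V) (hB : B.IsAlt) (hn : B.Nondegenerate)
    (n : ℕ) (hV : 2 * n ≤ Module.finrank F V) :
    ∃ v : Fin n ⊕ Fin n → V, ∀ i j, B (v i) (v j) = J (Fin n) F i j := by
  induction n with
  | zero => exact ⟨fun i => i.elim Fin.elim0 Fin.elim0, fun i => i.elim Fin.elim0 Fin.elim0⟩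
  | succ n ih =>
    obtain ⟨v, hv⟩ := ih (by omega)
    have h₁ : ∀ i j : Fin n, B (v (Sum.inl i)) (v (Sum.inl j)) = 0 := fun i j => by
      rw [hv]; simp [J]
    have h₂ : ∀ i j : Fin n, B (v (Sum.inr i)) (v (Sum.inr j)) = 0 := fun i j => by
      rw [hv]; simp [J]
    have h₃ : ∀ i j : Fin n, B (v (Sum.inl i)) (v (Sum.inr j)) = if i = j then -1 else 0 :=
      fun i j => by rw [hv]; simp [J, Matrix.one_apply, apply_ite]
    have h₄ : ∀ i j : Fin n, B (v (Sum.inr i)) (v (Sum.inl j)) = if i = j then 1 else 0 :=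
      fun i j => by rw [hv]; simp [J, Matrix.one_apply]
    have hproj : ∀ x : V, ∃ y : V, (∀ j, B y (v j) = 0) ∧
        y - x ∈ Submodule.span F (Set.range v) := by
      intro x
      refine ⟨x + ∑ i, B x (v (Sum.inr i)) • v (Sum.inl i)
        - ∑ i, B x (v (Sum.inl i)) • v (Sum.inr i), ?_, ?_⟩
      · rintro (j | j)
        · simp [h₁, h₄]
        · simp [h₂, h₃]
      · have : ∀ a b : V, x + a - b - x = a - b := fun a b => by abel
        rw [this]
        refine Submodule.sub_mem _ ?_ ?_ <;>
        exact Submodule.sum_mem _ fun i _ => Submodule.smul_mem _ _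
          (Submodule.subset_span ⟨_, rfl⟩)
    have hne : Submodule.span F (Set.range v) ≠ ⊤ := by
      intro h
      have h1 := finrank_range_le_card (R := F) v
      rw [Set.finrank, h, finrank_top] at h1
      simp at h1
      omega
    obtain ⟨x, -, hx⟩ := SetLike.exists_of_lt (lt_top_iff_ne_top.mpr hne)
    obtain ⟨y, hy, hyx⟩ := hproj x
    have hy0 : y ≠ 0 := by
      rintro rfl
      apply hx
      simpa using hyx
    have hz : ∃ z, B y z ≠ 0 := by
      by_contra! h
      exact hy0 (hn.1 y h)
    obtain ⟨z, hz⟩ := hz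
    obtain ⟨w, hw, hwz⟩ := hproj z
    have hspan : ∀ u ∈ Submodule.span F (Set.range v), B y u = 0 := by
      intro u hu
      induction hu using Submodule.span_induction with
      | mem u hu => obtain ⟨j, rfl⟩ := hu; exact hy j
      | zero => simp
      | add a b _ _ ha hb => simp [ha, hb]
      | smul c a _ ha => simp [ha]
    have hyw : B y w = B y z := by
      have := hspan _ hwz
      rwa [map_sub, sub_eq_zero] at this
    have hyw0 : B y w ≠ 0 := hyw ▸ hz
    have hneg := hB.neg_eq
    have hy' : ∀ j, B (v j) y = 0 := fun j => by rw [← hneg, hy, neg_zero]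
    have hw' : ∀ j, B (v j) w = 0 := fun j => by rw [← hneg, hw, neg_zero]
    refine ⟨Sum.elim (Fin.cons y fun i => v (Sum.inl i))
      (Fin.cons (-(B y w)⁻¹ • w) fun i => v (Sum.inr i)), ?_⟩
    have hwy : B w y = - B y w := (hneg y w).symm
    have hyy : B y y = 0 := hB y
    have hww : B w w = 0 := hB w
    rintro (i | i) (j | j) <;> refine Fin.cases ?_ (fun i => ?_) i <;>
      refine Fin.cases ?_ (fun j => ?_) j <;>
      simp [J, Matrix.one_apply, h₁, h₂, h₃, h₄, hy, hw, hy', hw', hwy, hyy, hww, hyw0,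
        (Fin.succ_ne_zero _).symm, apply_ite]

/-- `F_{q^d}`, where `F = F_q` has characteristic two. -/
abbrev Ext (F : Type*) [Field F] [Finite F] [CharP F 2] (d : ℕ) [NeZero d] : Type :=
  FiniteField.Extension F 2 d

/-- `β` is a symplectic basis of the `F_q`-space `F_{q^{2k}}` for the form
`(x, y) ↦ Tr(x * y^(q^k))`, the trace being that of `F_{q^{2k}}` over `F_q`. -/
def IsFrame {F : Type*} [Field F] [Finite F] [CharP F 2] (k : ℕ) [NeZero (2 * k)]
    (β : Module.Basis (Fin k ⊕ Fin k) F (Ext F (2 * k))) : Prop :=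
  ∀ i j, Algebra.trace F (Ext F (2 * k)) (β i * β j ^ (Nat.card F ^ k)) = J (Fin k) F i j

theorem exists_frame (F : Type*) [Field F] [Finite F] [CharP F 2] (k : ℕ) [NeZero (2 * k)] :
    ∃ β : Module.Basis (Fin k ⊕ Fin k) F (Ext F (2 * k)), IsFrame k β := by
  have : Fintype F := Fintype.ofFinite F
  have hfr : Module.finrank F (Ext F (2 * k)) = 2 * k := FiniteField.finrank_extension F 2 (2 * k)
  have hchar : CharP (Ext F (2 * k)) 2 := charP_of_injective_algebraMap
    (algebraMap F (Ext F (2 * k))).injective 2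
  let φ : Ext F (2 * k) ≃ₐ[F] Ext F (2 * k) :=
    (FiniteField.frobeniusAlgEquivOfAlgebraic F (Ext F (2 * k))) ^ k
  have hφ : ∀ x, φ x = x ^ (Nat.card F ^ k) := by
    intro x
    simp only [φ]
    rw [AlgEquiv.coe_pow, FiniteField.coe_frobeniusAlgEquivOfAlgebraic_iterate,
      Nat.card_eq_fintype_card]
  let B : LinearMap.BilinForm F (Ext F (2 * k)) :=
    (Algebra.traceForm F (Ext F (2 * k))).compl₂ φ.toLinearMap
  have hBa : ∀ x y, B x y = Algebra.trace F (Ext F (2 * k)) (x * y ^ (Nat.card F ^ k)) := by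
    intro x y
    simp [B, Algebra.traceForm_apply, hφ]
  have hcard : ∀ x : Ext F (2 * k), x ^ (Nat.card F ^ k * Nat.card F ^ k) = x := by
    intro x
    have : Fintype (Ext F (2 * k)) := Fintype.ofFinite _
    have h := FiniteField.pow_card x
    rw [← Nat.card_eq_fintype_card, FiniteField.natCard_extension] at h
    rwa [← pow_add, ← two_mul]
  have hB : B.IsAlt := by
    intro x
    rw [hBa]
    apply (algebraMap F (Ext F (2 * k))).injective
    have hr : Finset.range (2 * k) = Finset.range (k + k) := by rw [two_mul]
    rw [FiniteField.algebraMap_trace_eq_sum_pow, map_zero, hfr, hr, Finset.sum_range_add,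
      ← Finset.sum_add_distrib]
    refine Finset.sum_eq_zero fun i _ => ?_
    have : (x * x ^ Nat.card F ^ k) ^ Nat.card F ^ (k + i) =
        (x * x ^ Nat.card F ^ k) ^ Nat.card F ^ i := by
      rw [pow_add (Nat.card F), pow_mul, mul_pow x, ← pow_mul, hcard, mul_comm x]
    rw [this, CharTwo.add_self_eq_zero]
  have hnd : B.Nondegenerate := by
    have h := traceForm_nondegenerate F (Ext F (2 * k))
    constructor
    · intro x hx
      apply h.1 x
      intro y
      have := hx (φ.symm y)
      simpa [B] using this
    · intro x hx
      have := h.2 (φ x) (fun y => by simpa [B] using hx y)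
      simpa using this
  obtain ⟨v, hv⟩ := exists_symplectic_family B hB hnd k hfr.ge
  have hli : LinearIndependent F v := by
    rw [Fintype.linearIndependent_iff]
    intro g hg
    have key : ∀ j, ∑ i, g i * J (Fin k) F i j = 0 := by
      intro j
      have := congrArg (fun x => B x (v j)) hg
      simpa only [map_sum, map_smul, LinearMap.sum_apply, LinearMap.smul_apply, smul_eq_mul, hv,
        map_zero, LinearMap.zero_apply] using this
    rintro (i | i)
    · simpa [J, Matrix.one_apply] using key (Sum.inr i)
    · simpa [J, Matrix.one_apply] using key (Sum.inl i)
  refine ⟨basisOfLinearIndependentOfCardEqFinrank' v hli (by simp [hfr, two_mul]), fun i j => ?_⟩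
  rw [coe_basisOfLinearIndependentOfCardEqFinrank', ← hBa, hv]

/-- A chosen symplectic basis; any two differ by an element of `Sp_{2k}(q)`. -/
def frame (F : Type*) [Field F] [Finite F] [CharP F 2] (k : ℕ) [NeZero (2 * k)] :
    Module.Basis (Fin k ⊕ Fin k) F (Ext F (2 * k)) :=
  (exists_frame F k).choose

/-! ### The groups `GL_r^ε(q)` and their embeddings -/

/-- `Sp_{2n}(q)`, acting on column vectors; the standard symplectic basis `e_i`, `f_i` consists of
the unit vectors with indices `Sum.inl i`, `Sum.inr i`. -/
abbrev Sp (n : ℕ) (F : Type*) [Field F] : Type _ := symplecticGroup (Fin n) F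

/-- The inclusion of `Sp_{2n}(q)` into `GL_{2n}(q)`. -/
def spToGL (n : ℕ) (F : Type*) [Field F] : Sp n F →* GL (Fin n ⊕ Fin n) F :=
  (symplecticGroup (Fin n) F).subtype.toHomUnits

/-- The embedding `A ↦ diag(A, ᵗA⁻¹)` of `GL_n(q)` into `Sp_{2n}(q)`. -/
def hyp (n : ℕ) (F : Type*) [Field F] : GL (Fin n) F →* Sp n F where
  toFun A := ⟨fromBlocks (A : Matrix (Fin n) (Fin n) F) 0 0
      ((A⁻¹ : GL (Fin n) F) : Matrix (Fin n) (Fin n) F)ᵀ, by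
    rw [SymplecticGroup.mem_iff]
    simp [J, fromBlocks_multiply, fromBlocks_transpose, ← Matrix.transpose_mul]⟩
  map_one' := by
    ext1
    simp
  map_mul' A B := by
    ext1
    simp [fromBlocks_multiply]

/-- `GU_n(q)`: the matrices `U` over `F_{q²}` with `U * ᵗU^(q) = 1`. -/
def GU (n : ℕ) (F : Type*) [Field F] [Finite F] [CharP F 2] :
    Subgroup (GL (Fin n) (Ext F (2 * 1))) where
  carrier := {U | (U : Matrix (Fin n) (Fin n) (Ext F (2 * 1))) *
    ((U : Matrix (Fin n) (Fin n) (Ext F (2 * 1))).map (fun x => x ^ Nat.card F))ᵀ = 1}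
  one_mem' := by
    have : Nat.card F ≠ 0 := Nat.card_pos.ne'
    rw [Set.mem_ofPred_eq, Units.val_one, Matrix.map_one (fun x => x ^ Nat.card F) (zero_pow this) (one_pow _)]
    simp
  mul_mem' := by
    intro A B hA hB
    have := Fintype.ofFinite F
    have hm : ∀ M N : Matrix (Fin n) (Fin n) (Ext F (2 * 1)),
        (M * N).map (fun x => x ^ Nat.card F) =
          M.map (fun x => x ^ Nat.card F) * N.map (fun x => x ^ Nat.card F) := by
      intro M N
      have := Matrix.map_mul (L := M) (M := N)
        (f := FiniteField.frobeniusAlgHom F (Ext F (2 * 1)))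
      rw [Nat.card_eq_fintype_card]
      exact this
    rw [Set.mem_ofPred_eq] at *
    rw [Units.val_mul, hm, Matrix.transpose_mul, Matrix.mul_assoc, ← Matrix.mul_assoc B.1, hB,
      Matrix.one_mul, hA]
  inv_mem' := by
    intro A hA
    have := Fintype.ofFinite F
    have hm : ∀ M N : Matrix (Fin n) (Fin n) (Ext F (2 * 1)),
        (M * N).map (fun x => x ^ Nat.card F) =
          M.map (fun x => x ^ Nat.card F) * N.map (fun x => x ^ Nat.card F) := by
      intro M N
      have := Matrix.map_mul (L := M) (M := N)
        (f := FiniteField.frobeniusAlgHom F (Ext F (2 * 1)))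
      rw [Nat.card_eq_fintype_card]
      exact this
    have h0 : Nat.card F ≠ 0 := Nat.card_pos.ne'
    rw [Set.mem_ofPred_eq] at *
    have h1 : (A⁻¹).1.map (fun x => x ^ Nat.card F) * A.1.map (fun x => x ^ Nat.card F) = 1 := by
      rw [← hm, Units.inv_mul, Matrix.map_one (fun x => x ^ Nat.card F) (zero_pow h0) (one_pow _)]
    have h2 : A.1ᵀ.map (fun x => x ^ Nat.card F) * (A⁻¹).1ᵀ.map (fun x => x ^ Nat.card F) = 1 := by
      rw [Matrix.transpose_map, Matrix.transpose_map, ← Matrix.transpose_mul, h1,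
        Matrix.transpose_one]
    rw [← Matrix.transpose_map] at *
    calc (A⁻¹).1 * (A⁻¹).1ᵀ.map (fun x => x ^ Nat.card F)
        = (A⁻¹).1 * (A.1 * A.1ᵀ.map (fun x => x ^ Nat.card F)) *
            (A⁻¹).1ᵀ.map (fun x => x ^ Nat.card F) := by rw [hA, Matrix.mul_one]
      _ = ((A⁻¹).1 * A.1) * (A.1ᵀ.map (fun x => x ^ Nat.card F) *
            (A⁻¹).1ᵀ.map (fun x => x ^ Nat.card F)) := by simp only [Matrix.mul_assoc]
      _ = 1 := by rw [h2, Units.inv_mul, Matrix.one_mul]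

/-- Restriction of scalars: the embedding of `GL_n(q²)` into `GL_{2n}(q)` coming from the
identification of `(F_{q²})^n` with `(F_q)^{2n}` that uses the symplectic basis
`b, c` of `F_{q²}` in each coordinate (so that `b ε_i` becomes `e_i`, and `c ε_i` becomes
`f_i`). The form `Tr(∑ x_i * y_i^q)` becomes the standard symplectic form, so that `GU_n(q)` is
mapped into `Sp_{2n}(q)`. -/
def resGL (n : ℕ) (F : Type*) [Field F] [Finite F] [CharP F 2] :
    GL (Fin n) (Ext F (2 * 1)) →* GL (Fin n ⊕ Fin n) F :=
  Units.map
    (((reindexRingEquiv F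
          ((Equiv.prodSumDistrib (Fin n) (Fin 1) (Fin 1)).trans
            (Equiv.sumCongr (Equiv.prodUnique (Fin n) (Fin 1))
              (Equiv.prodUnique (Fin n) (Fin 1))))).toRingHom.comp
        (compRingEquiv (Fin n) (Fin 1 ⊕ Fin 1) F).toRingHom).comp
      (Algebra.leftMulMatrix (frame F 1)).toRingHom.mapMatrix).toMonoidHom

/-- For a group `X ≤ GL_n(q)`: its image in `Sp_{2n}(q)`. -/
def embPlus {n : ℕ} {F : Type*} [Field F] (X : Subgroup (GL (Fin n) F)) : Subgroup (Sp n F) :=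
  X.map (hyp n F)

/-- For a group `X` of matrices over `F_{q²}`: the image of `X ∩ GU_n(q)` in `Sp_{2n}(q)`. -/
def embMinus {n : ℕ} {F : Type*} [Field F] [Finite F] [CharP F 2]
    (X : Subgroup (GL (Fin n) (Ext F (2 * 1)))) : Subgroup (Sp n F) :=
  ((X ⊓ GU n F).map (resGL n F)).comap (spToGL n F)

/-- The block containing the `i`-th basis vector: blocks `1`, `2`, `3` are consecutive intervals
of lengths `r₁`, `r₂`, `r₃`, and `0` stands for the remaining basis vectors. -/
def blk (r₁ r₂ r₃ i : ℕ) : ℕ :=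
  if i < r₁ then 1 else if i < r₁ + r₂ then 2 else if i < r₁ + r₂ + r₃ then 3 else 0

/-- `GL_{r₁}(K) × GL_{r₂}(K) × GL_{r₃}(K)` as a subgroup of `GL_3(K)`: the block diagonal matrices
with consecutive blocks of sizes `r₁, r₂, r₃`, followed by an identity block. -/
def levi (K : Type*) [Field K] (r₁ r₂ r₃ : ℕ) : Subgroup (GL (Fin 3) K) where
  carrier := {A | ∀ i j : Fin 3, (blk r₁ r₂ r₃ i ≠ blk r₁ r₂ r₃ j ∨ blk r₁ r₂ r₃ i = 0) →
    (A : Matrix (Fin 3) (Fin 3) K) i j = (1 : Matrix (Fin 3) (Fin 3) K) i j}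
  one_mem' := by
    intro i j _
    rfl
  mul_mem' := by
    intro A B hA hB i j hij
    rw [Units.val_mul, Matrix.mul_apply, ← hB i j hij]
    by_cases hi : blk r₁ r₂ r₃ i = 0
    · simp [fun k => hA i k (Or.inr hi), Matrix.one_apply]
    · rw [hB i j hij]
      have hij' : blk r₁ r₂ r₃ i ≠ blk r₁ r₂ r₃ j := hij.resolve_right hi
      have hne : i ≠ j := fun h => hij' (by rw [h])
      rw [Matrix.one_apply_ne hne]
      refine Finset.sum_eq_zero fun k _ => ?_
      by_cases hk : blk r₁ r₂ r₃ i = blk r₁ r₂ r₃ k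
      · rw [hB k j (Or.inl (hk ▸ hij')), Matrix.one_apply_ne (fun h => hij' (by rw [hk, h])),
          mul_zero]
      · rw [hA i k (Or.inl hk), Matrix.one_apply_ne (fun h => hk (by rw [h])), zero_mul]
  inv_mem' := by
    intro A hA i j hij
    by_cases hi : blk r₁ r₂ r₃ i = 0
    · have h : (A.1 * (A⁻¹).1) i j = (1 : Matrix (Fin 3) (Fin 3) K) i j := by
        rw [Units.mul_inv]
      rw [Matrix.mul_apply] at h
      simpa [fun k => hA i k (Or.inr hi), Matrix.one_apply] using h
    · have hij' : blk r₁ r₂ r₃ i ≠ blk r₁ r₂ r₃ j := hij.resolve_right hi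
      let D : Matrix (Fin 3) (Fin 3) K :=
        Matrix.diagonal fun k => if blk r₁ r₂ r₃ k = blk r₁ r₂ r₃ i then 1 else 0
      have h1 : A.1 * D = D * A.1 := by
        ext a b
        rw [Matrix.mul_diagonal, Matrix.diagonal_mul]
        by_cases hab : blk r₁ r₂ r₃ a = blk r₁ r₂ r₃ b
        · rw [hab, mul_comm]
        · rw [hA a b (Or.inl hab), Matrix.one_apply_ne (fun h => hab (by rw [h]))]
          simp
      have h2 : (A⁻¹).1 * D = D * (A⁻¹).1 := by
        calc (A⁻¹).1 * D = (A⁻¹).1 * (D * A.1) * (A⁻¹).1 := by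
              rw [Matrix.mul_assoc, Matrix.mul_assoc, Units.mul_inv, Matrix.mul_one]
          _ = D * (A⁻¹).1 := by
              rw [← h1, ← Matrix.mul_assoc, Units.inv_mul, Matrix.one_mul]
      have h3 := congrFun (congrFun h2 i) j
      rw [Matrix.mul_diagonal, Matrix.diagonal_mul, if_neg (Ne.symm hij'), if_pos rfl, mul_zero,
        one_mul] at h3
      rw [← h3, Matrix.one_apply_ne (fun h => hij' (by rw [h]))]

/-- The extraspecial group of order `27` and exponent `3` in `GL_3(K)`: it is generated by the
matrices `diag(1, ω, ω²)`, `ω` a primitive cube root of unity, and the permutation matrix of a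
3-cycle. -/
def extraspecial (K : Type*) [Field K] : Subgroup (GL (Fin 3) K) :=
  Subgroup.closure {A | (∃ ω : K, ω ^ 2 + ω + 1 = 0 ∧
      (A : Matrix (Fin 3) (Fin 3) K) = Matrix.diagonal ![1, ω, ω ^ 2]) ∨
    (A : Matrix (Fin 3) (Fin 3) K) = !![0, 0, 1; 1, 0, 0; 0, 1, 0]}

/-- `GL_1(q³) ≤ GL_3(q)`: multiplications by elements of `F_{q³}`. -/
def gl1 (F : Type*) [Field F] [Finite F] [CharP F 2] : Subgroup (GL (Fin 3) F) :=
  (Units.map (Algebra.leftMulMatrix (Module.finBasisOfFinrankEq F (Ext F 3)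
    (FiniteField.finrank_extension F 2 3))).toRingHom.toMonoidHom).range

/-- `GU_1(q^k) ≤ Sp_{2k}(q)`: the multiplications by elements `u` of `F_{q^{2k}}` with
`u^(q^k + 1) = 1`. They preserve the symplectic form `Tr(x * y^(q^k))`. -/
def gu1 (k : ℕ) [NeZero (2 * k)] (F : Type*) [Field F] [Finite F] [CharP F 2] :
    Subgroup (GL (Fin k ⊕ Fin k) F) :=
  (powMonoidHom (Nat.card F ^ k + 1) : (Ext F (2 * k))ˣ →* (Ext F (2 * k))ˣ).ker.map
    (Units.map (Algebra.leftMulMatrix (frame F k)).toRingHom.toMonoidHom)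

/-- The embedding of `Sp_4(q)` into `Sp_6(q)` with image the pointwise stabilizer of `e_3, f_3`, on
the level of matrices. -/
def extGL (F : Type*) [Field F] : GL (Fin 2 ⊕ Fin 2) F →* GL (Fin 3 ⊕ Fin 3) F :=
  (Units.map (reindexRingEquiv F
      ((Equiv.sumSumSumComm (Fin 2) (Fin 2) (Fin 1) (Fin 1)).trans
        (Equiv.sumCongr finSumFinEquiv finSumFinEquiv))).toRingHom.toMonoidHom).comp
    { toFun := fun A => ⟨fromBlocks A.1 0 0 1, fromBlocks A.2 0 0 1,
        by simp [fromBlocks_multiply], by simp [fromBlocks_multiply]⟩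
      map_one' := by ext1; simp
      map_mul' := fun A B => by ext1; simp [fromBlocks_multiply] }

/-! ### The subgroups of `Sp_6(q)` -/

/-- `H = Sp_4(q)`, viewed as the pointwise stabilizer of `e_3` and `f_3` in `Sp_6(q)`. -/
def H (F : Type*) [Field F] : Subgroup (Sp 3 F) where
  carrier := {g | g.1 *ᵥ Pi.single (Sum.inl 2) 1 = Pi.single (Sum.inl 2) 1 ∧
    g.1 *ᵥ Pi.single (Sum.inr 2) 1 = Pi.single (Sum.inr 2) 1}
  one_mem' := by constructor <;> exact Matrix.one_mulVec _
  mul_mem' := by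
    rintro a b ⟨ha, ha'⟩ ⟨hb, hb'⟩
    constructor
    · change (a.1 * b.1) *ᵥ _ = _
      rw [← Matrix.mulVec_mulVec, hb, ha]
    · change (a.1 * b.1) *ᵥ _ = _
      rw [← Matrix.mulVec_mulVec, hb', ha']
  inv_mem' := by
    rintro a ⟨ha, ha'⟩
    have h : (a⁻¹).1 * a.1 = 1 := congrArg Subtype.val (inv_mul_cancel a)
    constructor
    · nth_rw 1 [← ha]
      rw [Matrix.mulVec_mulVec, h, Matrix.one_mulVec]
    · nth_rw 1 [← ha']
      rw [Matrix.mulVec_mulVec, h, Matrix.one_mulVec]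

/-- `∏ GL_{r_i}^ε(q)` as a subgroup of `Sp_6(q)`, where `ε = 1` or `ε = -1`. -/
def prodGL (F : Type*) [Field F] [Finite F] [CharP F 2] (ε : ℤˣ) (r₁ r₂ r₃ : ℕ) :
    Subgroup (Sp 3 F) :=
  if ε = 1 then embPlus (levi F r₁ r₂ r₃) else embMinus (levi (Ext F (2 * 1)) r₁ r₂ r₃)

/-- `Q_{r₁,r₂,r₃} = O_ℓ(Z(∏ GL_{r_i}^ε(q)))`. -/
def Qr (F : Type*) [Field F] [Finite F] [CharP F 2] (ℓ : ℕ) (ε : ℤˣ) (r₁ r₂ r₃ : ℕ) :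
    Subgroup (Sp 3 F) :=
  OCenter ℓ (prodGL F ε r₁ r₂ r₃)

/-- `Q^{(3)} = O_ℓ(Z(GL_1^ε(q³)))`. -/
def Q3 (F : Type*) [Field F] [Finite F] [CharP F 2] (ℓ : ℕ) (ε : ℤˣ) : Subgroup (Sp 3 F) :=
  OCenter ℓ (if ε = 1 then embPlus (gl1 F) else (gu1 3 F).comap (spToGL 3 F))

/-- `Q^{(2)} = O_ℓ(Z(GU_1(q²)))`. -/
def Q2 (F : Type*) [Field F] [Finite F] [CharP F 2] (ℓ : ℕ) : Subgroup (Sp 3 F) :=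
  OCenter ℓ (((gu1 2 F).map (extGL F)).comap (spToGL 3 F))

/-- `R = Z E`, where `Z = Q_3` for the prime `ℓ = 3`, and `E ≤ GL_3^ε(q)` is extraspecial of
order `27` and exponent `3`. -/
def R (F : Type*) [Field F] [Finite F] [CharP F 2] (ε : ℤˣ) : Subgroup (Sp 3 F) :=
  Qr F 3 ε 3 0 0 ⊔
    (if ε = 1 then embPlus (extraspecial F) else embMinus (extraspecial (Ext F (2 * 1))))

/-- The subgroups `Q_1, Q_2, Q_3, Q_{1,1}, Q_{2,1}, Q_{1,1,1}` of `Sp_6(q)`. -/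
def listG (F : Type*) [Field F] [Finite F] [CharP F 2] (ℓ : ℕ) (ε : ℤˣ) :
    List (Subgroup (Sp 3 F)) :=
  [Qr F ℓ ε 1 0 0, Qr F ℓ ε 2 0 0, Qr F ℓ ε 3 0 0, Qr F ℓ ε 1 1 0, Qr F ℓ ε 2 1 0, Qr F ℓ ε 1 1 1]

/-- The subgroups `Q_1, Q_2, Q_{1,1}` of `H = Sp_4(q)`. -/
def listH (F : Type*) [Field F] [Finite F] [CharP F 2] (ℓ : ℕ) (ε : ℤˣ) :
    List (Subgroup (Sp 3 F)) :=
  [Qr F ℓ ε 1 0 0, Qr F ℓ ε 2 0 0, Qr F ℓ ε 1 1 0]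

end RadSub

end

/-! The engine is `RadicalIn.mem_of_commute`: a radical subgroup Q contains every ℓ-element of the
centre of C(Q). Once Q has been moved into a known Sylow ℓ-subgroup, it is therefore enough to
control C(Q). Sylow subgroups are recognized from the order formula `card_sp`, which gives |Sp_6(q)|
= q^9 (q^2-1)(q^4-1)(q^6-1).

If ℓ divides q^2+1, or if ℓ ≠ 3 divides q^4+q^2+1, a Sylow ℓ-subgroup is the ℓ-part of a torus of
field multiplications in which every nontrivial ℓ-element generates the field (F_{q^4}, F_{q^3} or
F_{q^6}). Whatever centralizes one such element centralizes the whole torus, so a nontrivial radical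
Q inside the Sylow subgroup is all of it (`conjIn_map_ellPart`).

If ℓ divides q^2-1, the point is that in characteristic two the symplectic condition on 6×6 matrices
is the unitary condition on 3×3 matrices over the split quaternion algebra B = M_2(F_q) with its
canonical involution. A group U of norm one quaternions (F_q^× for ε = 1, the norm one group of
F_{q^2} for ε = -1) yields a diagonal torus U^3, on which permutation matrices and coordinatewise
inversions act. `TorusModel` axiomatizes this, so that both signs are treated at once. Its key
property: j(u) b = b j(v) forces b = 0 unless v = u^{±1}. Hence an element centralizing a subgroup Q
of the torus has nonzero entries only between coordinates that agree on Q up to inversion. After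
inverting and permuting coordinates, a radical Q becomes the group of all ℓ-elements of the torus
that are constant on blocks and trivial where Q is (`exists_conj_blockTorus`); this is some
Q_{r_1,r_2,r_3} by `OCenter_eq_blkTorus`. For ℓ ≠ 3 the torus contains a Sylow ℓ-subgroup of G. The
same argument relative to H needs only two coordinates and allows ℓ = 3.

For ℓ = 3 a Sylow subgroup of G is monomial: the 3-part of U^3 extended by a 3-cycle s. Let Q be a
radical subgroup of it with a non-diagonal element g. If all diagonal elements of Q are scalar, then
g^3 is a scalar c. Either c is a cube and a Fourier matrix diagonalizes Q, or c generates the 3-part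
of U and Q = ⟨g⟩ is conjugate to Q^{(3)}. Otherwise Q contains all scalars of 3-power order and d =
diag(1, ω, ω²). If N(Q) moves d off the torus, Q is conjugate to R. If not, the diagonal 3-elements
of N(Q) are normalized by N(Q) and so lie in Q, and nilpotence of s - 1 makes Q the full Sylow
subgroup (`radical_monomial_cases`).

For non-conjugacy, orders and numbers of fixed vectors separate the tori; exponent, commutativity
and order separate the remaining groups. -/

noncomputable section

namespace RadSub

/-! ### Radical subgroups relative to an ambient subgroup -/

section Radical

variable {G : Type*} [Group G] {ℓ : ℕ}

/-- `Q ≤ K` is an `ℓ`-subgroup containing every `ℓ`-subgroup of `N_K(Q)` that is normalized by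
`N_K(Q)`. -/
structure RadicalIn (ℓ : ℕ) (K Q : Subgroup G) : Prop where
  le : Q ≤ K
  isPGroup : IsPGroup ℓ Q
  le_of_normalized : ∀ A : Subgroup G, A ≤ K → IsPGroup ℓ A →
    A ≤ Subgroup.normalizer (Q : Set G) →
    (∀ n ∈ K, n ∈ Subgroup.normalizer (Q : Set G) → ∀ a ∈ A, n * a * n⁻¹ ∈ A) → A ≤ Q

theorem IsRadical.radicalIn_top {Q : Subgroup G} (h : IsRadical ℓ Q) : RadicalIn ℓ ⊤ Q := by
  refine ⟨le_top, h.1, fun A _ hA hAN hn => ?_⟩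
  rw [h.2]
  intro a ha
  refine ⟨⟨a, hAN ha⟩, ?_, rfl⟩
  have hle : A.subgroupOf (Subgroup.normalizer (Q : Set G)) ≤
      OCore ℓ (Subgroup.normalizer (Q : Set G)) := by
    refine le_sSup ⟨⟨?_⟩, ?_⟩
    · rintro ⟨x, hx⟩ hxA ⟨n, hnN⟩
      exact hn n trivial hnN x hxA
    · exact hA.comap_of_injective _ Subtype.coe_injective
  exact hle ha

/-- Normalizers are cut down to K on both sides, so nothing changes on passing from the group K to
the ambient group. This lets H be treated with the same lemmas as G. -/
theorem RadicalIn.map_subtype {K : Subgroup G} {Q : Subgroup K} (h : RadicalIn ℓ ⊤ Q) :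
    RadicalIn ℓ K (Q.map K.subtype) := by
  have hnorm : ∀ k : K, (k : G) ∈ Subgroup.normalizer (Q.map K.subtype : Set G) ↔
      k ∈ Subgroup.normalizer (Q : Set K) := by
    intro k
    rw [Subgroup.mem_normalizer_iff, Subgroup.mem_normalizer_iff]
    constructor
    · intro hk x
      have := hk (K.subtype x)
      rw [show (k : G) * K.subtype x * (k : G)⁻¹ = K.subtype (k * x * k⁻¹) from rfl,
        Subgroup.mem_map_iff_mem K.subtype_injective,
        Subgroup.mem_map_iff_mem K.subtype_injective] at this
      exact this
    · intro hk x
      constructor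
      · rintro ⟨y, hy, rfl⟩
        exact ⟨k * y * k⁻¹, (hk y).1 hy, by simp⟩
      · rintro ⟨y, hy, hyx⟩
        refine ⟨k⁻¹ * y * k, (hk _).2 (by simpa [mul_assoc] using hy), ?_⟩
        have : (y : G) = k * x * (k : G)⁻¹ := hyx
        simp [this, mul_assoc]
  refine ⟨?_, h.isPGroup.map _, fun A hAK hA hAN hn => ?_⟩
  · rintro _ ⟨x, -, rfl⟩
    exact x.2
  · have := h.le_of_normalized (A.subgroupOf K) le_top
      (hA.comap_of_injective _ Subtype.coe_injective)
      (fun a ha => (hnorm a).1 (hAN ha))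
      (fun n _ hnN a ha => hn n n.2 ((hnorm n).2 hnN) a ha)
    intro a ha
    exact ⟨⟨a, hAK ha⟩, this ha, rfl⟩

theorem mem_conj_iff {Q : Subgroup G} {k x : G} :
    x ∈ Q.map (MulAut.conj k).toMonoidHom ↔ k⁻¹ * x * k ∈ Q := by
  constructor
  · rintro ⟨y, hy, rfl⟩
    simpa [mul_assoc] using hy
  · intro h
    exact ⟨_, h, by simp [mul_assoc]⟩

theorem mem_normalizer_conj_iff {Q : Subgroup G} {k n : G} :
    n ∈ Subgroup.normalizer (Q.map (MulAut.conj k).toMonoidHom : Set G) ↔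
      k⁻¹ * n * k ∈ Subgroup.normalizer (Q : Set G) := by
  simp only [Subgroup.mem_normalizer_iff, mem_conj_iff]
  constructor
  · intro h x
    have := h (k * x * k⁻¹)
    simpa [mul_assoc] using this
  · intro h x
    have := h (k⁻¹ * x * k)
    simpa [mul_assoc] using this

theorem RadicalIn.conj {K Q : Subgroup G} (h : RadicalIn ℓ K Q) {k : G} (hk : k ∈ K) :
    RadicalIn ℓ K (Q.map (MulAut.conj k).toMonoidHom) := by
  refine ⟨?_, h.isPGroup.map _, fun A hAK hA hAN hn => ?_⟩
  · rintro _ ⟨x, hx, rfl⟩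
    exact K.mul_mem (K.mul_mem hk (h.le hx)) (K.inv_mem hk)
  · have key := h.le_of_normalized (A.map (MulAut.conj k⁻¹).toMonoidHom) ?_ (hA.map _) ?_ ?_
    · intro a ha
      rw [mem_conj_iff]
      apply key
      rw [mem_conj_iff]
      simpa [mul_assoc] using ha
    · rintro _ ⟨x, hx, rfl⟩
      exact K.mul_mem (K.mul_mem (K.inv_mem hk) (hAK hx)) (K.inv_mem (K.inv_mem hk))
    · rintro _ ⟨x, hx, rfl⟩
      have := mem_normalizer_conj_iff.1 (hAN hx)
      simpa using this
    · intro n hnK hnN a ha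
      rw [mem_conj_iff] at ha ⊢
      have := hn (k * n * k⁻¹) (K.mul_mem (K.mul_mem hk hnK) (K.inv_mem hk))
        (mem_normalizer_conj_iff.2 (by simpa [mul_assoc] using hnN)) _ ha
      simpa [mul_assoc] using this

theorem conjIn_trans {K A B C : Subgroup G} (h₁ : ConjIn K A B) (h₂ : ConjIn K B C) :
    ConjIn K A C := by
  obtain ⟨k, hk, rfl⟩ := h₁
  obtain ⟨m, hm, rfl⟩ := h₂
  refine ⟨m * k, K.mul_mem hm hk, ?_⟩
  rw [Subgroup.map_map]
  congr 1
  ext x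
  simp [mul_assoc]

theorem conjIn_symm {K A B : Subgroup G} (h : ConjIn K A B) : ConjIn K B A := by
  obtain ⟨k, hk, rfl⟩ := h
  refine ⟨k⁻¹, K.inv_mem hk, ?_⟩
  ext x
  rw [mem_conj_iff, mem_conj_iff]
  simp [mul_assoc]

theorem conjIn_refl (K A : Subgroup G) : ConjIn K A A :=
  ⟨1, K.one_mem, by ext x; simp⟩

theorem ConjIn.card_eq {K A B : Subgroup G} (h : ConjIn K A B) : Nat.card A = Nat.card B := by
  obtain ⟨k, -, rfl⟩ := h
  exact Nat.card_congr
    (A.equivMapOfInjective _ (MulAut.conj k).injective).toEquiv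

/-- An `ℓ`-element of `K` centralizing `Q` and `C_K(Q)` lies in the radical subgroup `Q`. -/
theorem RadicalIn.mem_of_commute {K Q : Subgroup G} (h : RadicalIn ℓ K Q) {x : G} (hx : x ∈ K)
    (hxl : ∃ k, x ^ ℓ ^ k = 1) (hxQ : ∀ y ∈ Q, Commute x y)
    (hxC : ∀ c ∈ K, (∀ y ∈ Q, Commute c y) → Commute x c) : x ∈ Q := by
  -- A is the ℓ-part of the centre of C_K(Q): its elements lie in C_K(Q) and commute with it, hence
  -- with each other. N_K(Q) normalizes C_K(Q) and therefore A, so radicality puts A inside Q.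
  let A : Subgroup G :=
    { carrier := {a | a ∈ K ∧ (∃ k, a ^ ℓ ^ k = 1) ∧ (∀ y ∈ Q, Commute a y) ∧
        ∀ c ∈ K, (∀ y ∈ Q, Commute c y) → Commute a c}
      one_mem' := ⟨K.one_mem, ⟨0, one_pow _⟩, fun y _ => Commute.one_left y,
        fun c _ _ => Commute.one_left c⟩
      mul_mem' := by
        rintro a b ⟨haK, ⟨k, hk⟩, haQ, haC⟩ ⟨hbK, ⟨m, hm⟩, hbQ, hbC⟩
        refine ⟨K.mul_mem haK hbK, ⟨k + m, ?_⟩, fun y hy => (haQ y hy).mul_left (hbQ y hy),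
          fun c hc hcQ => (haC c hc hcQ).mul_left (hbC c hc hcQ)⟩
        rw [(haC b hbK hbQ).mul_pow, pow_add, pow_mul, hk, one_pow, mul_comm, pow_mul, hm, one_pow,
          one_mul]
      inv_mem' := by
        rintro a ⟨haK, ⟨k, hk⟩, haQ, haC⟩
        exact ⟨K.inv_mem haK, ⟨k, by rw [inv_pow, hk, inv_one]⟩, fun y hy => (haQ y hy).inv_left,
          fun c hc hcQ => (haC c hc hcQ).inv_left⟩ }
  refine h.le_of_normalized A (fun a ha => ha.1) ?_ ?_ ?_ ⟨hx, hxl, hxQ, hxC⟩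
  · rintro ⟨a, ha⟩
    obtain ⟨k, hk⟩ := ha.2.1
    exact ⟨k, Subtype.ext hk⟩
  · intro a ha
    rw [Subgroup.mem_normalizer_iff]
    intro y
    constructor
    · intro hy
      rwa [(ha.2.2.1 y hy).eq, mul_inv_cancel_right]
    · intro hy
      have := (ha.2.2.1 _ hy).eq
      have h2 : a * y * a⁻¹ = y := by
        have h3 : a⁻¹ * (a * (a * y * a⁻¹)) * a = a⁻¹ * (a * y * a⁻¹ * a) * a := by rw [this]
        have h4 : a * y = y * a := by simpa [mul_assoc] using h3
        rw [h4, mul_inv_cancel_right]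
      rwa [h2] at hy
  · rintro n hnK hnN a ⟨haK, ⟨k, hk⟩, haQ, haC⟩
    have hconj : ∀ c, (∀ y ∈ Q, Commute c y) → ∀ y ∈ Q, Commute (n⁻¹ * c * n) y := by
      intro c hc y hy
      have := (hc _ ((Subgroup.mem_normalizer_iff.1 hnN y).1 hy)).eq
      have h2 : n⁻¹ * (c * (n * y * n⁻¹)) * n = n⁻¹ * (n * y * n⁻¹ * c) * n := by rw [this]
      change (n⁻¹ * c * n) * y = y * (n⁻¹ * c * n)
      simpa [mul_assoc] using h2
    have hconj' : ∀ c, Commute a (n⁻¹ * c * n) → Commute (n * a * n⁻¹) c := by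
      intro c hc
      have h2 : n * (a * (n⁻¹ * c * n)) * n⁻¹ = n * (n⁻¹ * c * n * a) * n⁻¹ := by rw [hc.eq]
      change (n * a * n⁻¹) * c = c * (n * a * n⁻¹)
      simpa [mul_assoc] using h2
    refine ⟨K.mul_mem (K.mul_mem hnK haK) (K.inv_mem hnK),
      ⟨k, by rw [conj_pow, hk, mul_one, mul_inv_cancel]⟩, fun y hy => hconj' _ (haQ _ ?_),
      fun c hc hcQ => hconj' _ (haC _ ?_ (hconj c hcQ))⟩
    · rw [Subgroup.mem_normalizer_iff.1 hnN]
      simpa [mul_assoc] using hy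
    · exact K.mul_mem (K.mul_mem (K.inv_mem hnK) hc) hnK

end Radical

/-! ### `O_ℓ` of a center -/

section OCenter

variable {G : Type*} [Group G] {ℓ : ℕ}

theorem mem_OCore_comm {Z : Type*} [Group Z] (hZ : ∀ a b : Z, a * b = b * a) {x : Z} :
    x ∈ OCore ℓ Z ↔ ∃ k, x ^ ℓ ^ k = 1 := by
  let T : Subgroup Z :=
    { carrier := {a | ∃ k, a ^ ℓ ^ k = 1}
      one_mem' := ⟨0, one_pow _⟩
      mul_mem' := by
        rintro a b ⟨k, hk⟩ ⟨m, hm⟩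
        refine ⟨k + m, ?_⟩
        rw [Commute.mul_pow (hZ a b), pow_add, pow_mul, hk, one_pow, mul_comm, pow_mul, hm, one_pow,
          one_mul]
      inv_mem' := by
        rintro a ⟨k, hk⟩
        exact ⟨k, by rw [inv_pow, hk, inv_one]⟩ }
  have hT : OCore ℓ Z = T := by
    apply le_antisymm
    · refine sSup_le ?_
      rintro P ⟨-, hP⟩ a ha
      obtain ⟨k, hk⟩ := hP ⟨a, ha⟩
      exact ⟨k, congrArg Subtype.val hk⟩
    · refine le_sSup ⟨⟨fun n hn g => ?_⟩, ?_⟩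
      · rwa [hZ g n, mul_inv_cancel_right]
      · rintro ⟨a, k, hk⟩
        exact ⟨k, Subtype.ext hk⟩
  rw [hT]
  rfl

theorem center_comm {X : Type*} [Group X] (a b : Subgroup.center X) : a * b = b * a :=
  Subtype.ext (Subgroup.mem_center_iff.1 b.2 a)

theorem mem_OCenter {X : Subgroup G} {x : G} :
    x ∈ OCenter ℓ X ↔ x ∈ X ∧ (∀ y ∈ X, y * x = x * y) ∧ ∃ k, x ^ ℓ ^ k = 1 := by
  constructor
  · rintro ⟨_, ⟨y, hy, rfl⟩, rfl⟩
    obtain ⟨k, hk⟩ := (mem_OCore_comm center_comm).1 hy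
    refine ⟨y.1.2, fun z hz => ?_, k, ?_⟩
    · exact congrArg Subtype.val (Subgroup.mem_center_iff.1 y.2 ⟨z, hz⟩)
    · exact congrArg (fun t : Subgroup.center X => ((t : X) : G)) hk
  · rintro ⟨hx, hc, k, hk⟩
    have hxc : (⟨x, hx⟩ : X) ∈ Subgroup.center X :=
      Subgroup.mem_center_iff.2 fun z => Subtype.ext (hc z z.2)
    refine ⟨⟨x, hx⟩, ⟨⟨⟨x, hx⟩, hxc⟩, ?_, rfl⟩, rfl⟩
    exact (mem_OCore_comm center_comm).2 ⟨k, Subtype.ext (Subtype.ext hk)⟩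

theorem mem_OCenter_of_comm {X : Subgroup G} (hX : ∀ x ∈ X, ∀ y ∈ X, x * y = y * x) {x : G} :
    x ∈ OCenter ℓ X ↔ x ∈ X ∧ ∃ k, x ^ ℓ ^ k = 1 := by
  rw [mem_OCenter]
  exact ⟨fun h => ⟨h.1, h.2.2⟩, fun h => ⟨h.1, fun y hy => hX y hy x h.1, h.2⟩⟩

end OCenter

/-! ### Unitary groups over an algebra with involution, and a torus of norm one elements -/

/-- A group `G` of all unitary `3 × 3` matrices over a ring `B` with involution of characteristic
two, together with a group `U` of norm one elements of `B` that behaves like the norm one group of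
a quadratic étale subalgebra of a quaternion algebra. -/
structure TorusModel (G B U : Type*) [Group G] [Ring B] [StarRing B] [CommGroup U] where
  ι : G →* Matrix (Fin 3) (Fin 3) B
  ι_injective : Function.Injective ι
  ι_mul_star : ∀ g, ι g * star (ι g) = 1
  exists_of_mul_star : ∀ M, M * star M = 1 → ∃ g, ι g = M
  j : U →* B
  j_injective : Function.Injective j
  star_j : ∀ u, star (j u) = j u⁻¹
  -- In the models `j u` and `j v` have the same trace exactly when v = u^{±1}, and elements of
  -- different trace have no nonzero intertwiner.
  eq_zero_of_intertwine : ∀ u v b, j u * b = b * j v → u ≠ v → u ≠ v⁻¹ → b = 0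
  -- In the models the centralizer of a nontrivial `j u` is a commutative quadratic algebra.
  commute_of_commute : ∀ u v b, u ≠ 1 → j u * b = b * j u → j v * b = b * j v
  eq_one_of_eq_inv : ∀ u : U, u = u⁻¹ → u = 1
  -- The Weyl group element of the torus; it supplies the sign changes of coordinates.
  w : B
  w_mul_star : w * star w = 1
  w_mul_j : ∀ u, w * j u = j u⁻¹ * w
  exists_of_norm_one : ∀ b, (∀ u, j u * b = b * j u) → b * star b = 1 → ∃ u, j u = b
  two_eq_zero : (2 : B) = 0
  one_add_add : ∀ ζ : U, ζ ^ 3 = 1 → ζ ≠ 1 → 1 + j ζ + j (ζ ^ 2) = 0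

/-- The subgroup of elements of `ℓ`-power order of a commutative group. -/
def ellPart (ℓ : ℕ) (U : Type*) [CommGroup U] : Subgroup U where
  carrier := {u | ∃ k, u ^ ℓ ^ k = 1}
  one_mem' := ⟨0, one_pow _⟩
  mul_mem' := by
    rintro a b ⟨k, hk⟩ ⟨m, hm⟩
    refine ⟨k + m, ?_⟩
    rw [mul_pow, pow_add, pow_mul, hk, one_pow, one_mul, mul_comm, pow_mul, hm, one_pow]
  inv_mem' := by
    rintro a ⟨k, hk⟩
    exact ⟨k, by rw [inv_pow, hk, inv_one]⟩

theorem mem_ellPart {ℓ : ℕ} {U : Type*} [CommGroup U] {u : U} :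
    u ∈ ellPart ℓ U ↔ ∃ k, u ^ ℓ ^ k = 1 := Iff.rfl

/-- The tuples of elements of `ℓ`-power order that are constant on the fibres of `b` and trivial
where `b` vanishes. -/
def blockSub (ℓ : ℕ) (U : Type*) [CommGroup U] (b : Fin 3 → ℕ) : Subgroup (Fin 3 → U) where
  carrier := {u | (∀ i, u i ∈ ellPart ℓ U) ∧ (∀ i, b i = 0 → u i = 1) ∧
    ∀ i k, b i = b k → u i = u k}
  one_mem' := ⟨fun _ => one_mem _, fun _ _ => rfl, fun _ _ _ => rfl⟩
  mul_mem' := by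
    rintro u v ⟨hu, hu0, hub⟩ ⟨hv, hv0, hvb⟩
    refine ⟨fun i => mul_mem (hu i) (hv i), fun i hi => ?_, fun i k hik => ?_⟩
    · rw [Pi.mul_apply, hu0 i hi, hv0 i hi, one_mul]
    · rw [Pi.mul_apply, Pi.mul_apply, hub i k hik, hvb i k hik]
  inv_mem' := by
    rintro u ⟨hu, hu0, hub⟩
    refine ⟨fun i => inv_mem (hu i), fun i hi => ?_, fun i k hik => ?_⟩
    · rw [Pi.inv_apply, hu0 i hi, inv_one]
    · rw [Pi.inv_apply, Pi.inv_apply, hub i k hik]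

theorem mem_blockSub {ℓ : ℕ} {U : Type*} [CommGroup U] {b : Fin 3 → ℕ} {u : Fin 3 → U} :
    u ∈ blockSub ℓ U b ↔ (∀ i, u i ∈ ellPart ℓ U) ∧ (∀ i, b i = 0 → u i = 1) ∧
      ∀ i k, b i = b k → u i = u k := Iff.rfl

theorem blockSub_congr {ℓ : ℕ} {U : Type*} [CommGroup U] {b b' : Fin 3 → ℕ}
    (h0 : ∀ i, b i = 0 ↔ b' i = 0) (h : ∀ i k, b i = b k ↔ b' i = b' k) :
    blockSub ℓ U b = blockSub ℓ U b' := by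
  ext u
  simp only [mem_blockSub, h0, h]

namespace TorusModel

set_option linter.unusedSectionVars false

variable {G B U : Type*} [Group G] [Ring B] [StarRing B] [CommGroup U] (m : TorusModel G B U)

/-- The element of `G` with given unitary matrix. -/
def lift (M : Matrix (Fin 3) (Fin 3) B) (h : M * star M = 1) : G :=
  (m.exists_of_mul_star M h).choose

@[simp]
theorem ι_lift (M : Matrix (Fin 3) (Fin 3) B) (h : M * star M = 1) : m.ι (m.lift M h) = M :=
  (m.exists_of_mul_star M h).choose_spec

theorem diagonal_mul_star {d : Fin 3 → B} (hd : ∀ i, d i * star (d i) = 1) :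
    diagonal d * star (diagonal d) = 1 := by
  rw [star_eq_conjTranspose, diagonal_conjTranspose, diagonal_mul_diagonal, ← diagonal_one]
  congr 1
  funext i
  exact hd i

theorem j_mul_star (u : U) : m.j u * star (m.j u) = 1 := by
  rw [m.star_j, ← map_mul, mul_inv_cancel, map_one]

/-- The diagonal torus. -/
def δ : (Fin 3 → U) →* G where
  toFun u := m.lift (diagonal fun i => m.j (u i)) (diagonal_mul_star fun i => m.j_mul_star (u i))
  map_one' := m.ι_injective (by simp)
  map_mul' u v := m.ι_injective (by simp [diagonal_mul_diagonal])

@[simp]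
theorem ι_δ (u : Fin 3 → U) : m.ι (m.δ u) = diagonal fun i => m.j (u i) :=
  m.ι_lift _ (diagonal_mul_star fun i => m.j_mul_star (u i))

theorem δ_injective : Function.Injective m.δ := by
  intro u v h
  funext i
  have h1 := congrArg m.ι h
  rw [ι_δ, ι_δ] at h1
  exact m.j_injective (congrFun (diagonal_injective h1) i)

/-- The matrix of a permutation of the standard basis. -/
def permMat (B : Type*) [Ring B] (σ : Equiv.Perm (Fin 3)) : Matrix (Fin 3) (Fin 3) B :=
  Matrix.of fun i k => if i = σ k then 1 else 0

theorem permMat_mul (σ : Equiv.Perm (Fin 3)) (M : Matrix (Fin 3) (Fin 3) B) (i k : Fin 3) :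
    (permMat B σ * M) i k = M (σ⁻¹ i) k := by
  rw [Matrix.mul_apply, Finset.sum_eq_single (σ⁻¹ i)]
  · simp [permMat]
  · intro l _ hl
    have : i ≠ σ l := fun h => hl (by simp [h])
    simp [permMat, this]
  · simp

theorem mul_permMat (σ : Equiv.Perm (Fin 3)) (M : Matrix (Fin 3) (Fin 3) B) (i k : Fin 3) :
    (M * permMat B σ) i k = M i (σ k) := by
  rw [Matrix.mul_apply, Finset.sum_eq_single (σ k)]
  · simp [permMat]
  · intro l _ hl
    simp [permMat, hl]
  · simp

theorem permMat_mul_star (σ : Equiv.Perm (Fin 3)) : permMat B σ * star (permMat B σ) = 1 := by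
  ext i k
  rw [permMat_mul, star_eq_conjTranspose, conjTranspose_apply]
  have h : σ (σ⁻¹ i) = i := σ.apply_symm_apply i
  by_cases hik : i = k
  · simp [permMat, hik, one_apply]
  · have : k ≠ σ (σ⁻¹ i) := by rw [h]; exact Ne.symm hik
    rw [permMat, of_apply, if_neg this, star_zero, one_apply_ne hik]

/-- The permutation matrices. -/
def π : Equiv.Perm (Fin 3) →* G where
  toFun σ := m.lift (permMat B σ) (permMat_mul_star σ)
  map_one' := m.ι_injective (by
    ext i k
    by_cases h : i = k <;> simp [permMat, h])
  map_mul' σ τ := m.ι_injective (by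
    ext i k
    rw [map_mul, ι_lift, ι_lift, ι_lift, permMat_mul]
    simp only [permMat, of_apply, Equiv.Perm.mul_apply, Equiv.Perm.inv_eq_iff_eq]
    congr)

@[simp]
theorem ι_π (σ : Equiv.Perm (Fin 3)) : m.ι (m.π σ) = permMat B σ :=
  m.ι_lift _ (permMat_mul_star σ)

theorem π_mul_δ (σ : Equiv.Perm (Fin 3)) (u : Fin 3 → U) :
    m.π σ * m.δ u = m.δ (fun i => u (σ⁻¹ i)) * m.π σ := by
  apply m.ι_injective
  ext i k
  rw [map_mul, map_mul, ι_π, permMat_mul, mul_permMat, ι_δ, ι_δ, diagonal_apply, diagonal_apply]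
  simp only [Equiv.Perm.inv_eq_iff_eq]

theorem π_conj_δ (σ : Equiv.Perm (Fin 3)) (u : Fin 3 → U) :
    m.π σ * m.δ u * (m.π σ)⁻¹ = m.δ (fun i => u (σ⁻¹ i)) := by
  rw [π_mul_δ, mul_inv_cancel_right]

open Classical in
theorem flip_mul_star (e : Fin 3 → Prop) (i : Fin 3) :
    (if e i then m.w else 1) * star (if e i then m.w else 1) = 1 := by
  split_ifs
  · exact m.w_mul_star
  · simp

open Classical in
/-- The product of the reflections in the coordinates satisfying `e`. -/
def flip (e : Fin 3 → Prop) : G :=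
  m.lift (diagonal fun i => if e i then m.w else 1) (diagonal_mul_star (m.flip_mul_star e))

open Classical in
theorem ι_flip (e : Fin 3 → Prop) :
    m.ι (m.flip e) = diagonal fun i => if e i then m.w else 1 :=
  m.ι_lift _ _

open Classical in
theorem flip_conj_δ (e : Fin 3 → Prop) (u : Fin 3 → U) :
    m.flip e * m.δ u * (m.flip e)⁻¹ = m.δ (fun i => if e i then (u i)⁻¹ else u i) := by
  rw [mul_inv_eq_iff_eq_mul]
  apply m.ι_injective
  rw [map_mul, map_mul, ι_flip, ι_δ, ι_δ, diagonal_mul_diagonal, diagonal_mul_diagonal]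
  congr 1
  funext i
  split_ifs
  · exact m.w_mul_j _
  · simp

/-- Turns every centralizer question about torus elements into intertwining relations between
quaternions, one for each matrix entry. -/
theorem mul_δ_eq_iff (c : G) (u v : Fin 3 → U) : m.δ u * c = c * m.δ v ↔
    ∀ i k, m.j (u i) * m.ι c i k = m.ι c i k * m.j (v k) := by
  rw [← m.ι_injective.eq_iff, map_mul, map_mul, ι_δ, ι_δ]
  constructor
  · intro h i k
    have := congrFun (congrFun h i) k
    rwa [diagonal_mul, mul_diagonal] at this
  · intro h
    ext i k
    rw [diagonal_mul, mul_diagonal, h]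

/-- The image of `blockSub` in the diagonal torus. -/
def blockTorus (ℓ : ℕ) (b : Fin 3 → ℕ) : Subgroup G := (blockSub ℓ U b).map m.δ

theorem δ_mem_blockTorus {ℓ : ℕ} {b : Fin 3 → ℕ} {u : Fin 3 → U} :
    m.δ u ∈ m.blockTorus ℓ b ↔ u ∈ blockSub ℓ U b :=
  Subgroup.mem_map_iff_mem m.δ_injective

theorem ellPart_of_mem {ℓ : ℕ} {Q : Subgroup G} (hQ : IsPGroup ℓ Q) {u : Fin 3 → U}
    (hu : m.δ u ∈ Q) (i : Fin 3) : u i ∈ ellPart ℓ U := by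
  obtain ⟨k, hk⟩ := hQ ⟨_, hu⟩
  have h1 : m.δ u ^ ℓ ^ k = 1 := congrArg Subtype.val hk
  rw [← map_pow, ← map_one m.δ] at h1
  exact ⟨k, congrFun (m.δ_injective h1) i⟩

theorem exists_pow_eq_one {ℓ : ℕ} {u : Fin 3 → U} (hu : ∀ i, u i ∈ ellPart ℓ U) :
    ∃ k, m.δ u ^ ℓ ^ k = 1 := by
  choose k hk using fun i => mem_ellPart.1 (hu i)
  refine ⟨k 0 + k 1 + k 2, ?_⟩
  rw [← map_pow, ← map_one m.δ]
  congr 1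
  funext i
  have : k i ≤ k 0 + k 1 + k 2 := by fin_cases i <;> simp <;> omega
  obtain ⟨t, ht⟩ := Nat.exists_eq_add_of_le this
  rw [Pi.pow_apply, ht, pow_add, pow_mul, hk, one_pow, Pi.one_apply]

/-- A radical subgroup of the diagonal torus is determined by the coincidences between its
coordinate characters. -/
theorem eq_blockTorus {ℓ : ℕ} {K Q : Subgroup G} (hQ : RadicalIn ℓ K Q) (b : Fin 3 → ℕ)
    (hδ : ∀ x ∈ Q, ∃ u, m.δ u = x) (hb0 : ∀ i, b i = 0 ↔ ∀ u, m.δ u ∈ Q → u i = 1)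
    (hb : ∀ i k, b i = b k → ∀ u, m.δ u ∈ Q → u i = u k)
    (hb' : ∀ i k, b i ≠ b k → ∃ u, m.δ u ∈ Q ∧ u i ≠ u k)
    (hb'' : ∀ i k, b i ≠ b k → ∃ u, m.δ u ∈ Q ∧ u i ≠ (u k)⁻¹)
    (hK : m.blockTorus ℓ b ≤ K) : Q = m.blockTorus ℓ b := by
  apply le_antisymm
  · intro x hx
    obtain ⟨u, rfl⟩ := hδ x hx
    exact m.δ_mem_blockTorus.2 ⟨m.ellPart_of_mem hQ.isPGroup hx,
      fun i hi => (hb0 i).1 hi u hx, fun i k hik => hb i k hik u hx⟩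
  · rintro _ ⟨u, hu, rfl⟩
    -- The remaining point is that an element c centralizing Q commutes with `m.δ u`. This is
    -- checked entry by entry, according to whether the two coordinates lie in one block.
    refine hQ.mem_of_commute (hK ⟨u, hu, rfl⟩) (m.exists_pow_eq_one hu.1) ?_ ?_
    · intro y hy
      obtain ⟨v, rfl⟩ := hδ y hy
      exact (Commute.all u v).map m.δ
    · intro c _ hcQ
      have hc : ∀ v, m.δ v ∈ Q → ∀ i k, m.j (v i) * m.ι c i k = m.ι c i k * m.j (v k) :=
        fun v hv => (m.mul_δ_eq_iff c v v).1 (hcQ _ hv).eq.symm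
      refine (m.mul_δ_eq_iff c u u).2 fun i k => ?_
      by_cases hik : b i = b k
      · rw [hu.2.2 i k hik]
        by_cases h0 : b i = 0
        · rw [hu.2.1 k (hik ▸ h0)]
          simp
        · have := (hb0 i).not.1 h0
          push Not at this
          obtain ⟨v, hv, hv1⟩ := this
          -- Inside a nontrivial block the entry commutes with one nontrivial element of the torus,
          -- hence with all of U.
          refine m.commute_of_commute (v i) _ _ hv1 ?_
          have := hc v hv i k
          rwa [← hb i k hik v hv] at this
      · have : m.ι c i k = 0 := by
          obtain ⟨x, hx, hx1⟩ := hb' i k hik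
          obtain ⟨y, hy, hy1⟩ := hb'' i k hik
          -- Between different blocks the entry must vanish. If x only fails to separate i and k up
          -- to inversion and y only fails to separate them up to equality, then x * y separates
          -- them in both senses.
          by_cases hx2 : x i = (x k)⁻¹
          · by_cases hy2 : y i = y k
            · refine m.eq_zero_of_intertwine (x i * y i) (x k * y k) _
                (hc (x * y) (by rw [map_mul]; exact Q.mul_mem hx hy) i k) ?_ ?_
              · rw [hy2]
                exact fun h => hx1 (mul_right_cancel h)
              · rw [hx2, mul_inv]
                exact fun h => hy1 (mul_left_cancel h)
            · exact m.eq_zero_of_intertwine _ _ _ (hc y hy i k) hy2 hy1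
          · exact m.eq_zero_of_intertwine _ _ _ (hc x hx i k) hx1 hx2
        rw [this, mul_zero, zero_mul]

open Classical in
/-- Up to conjugacy under reflections and permutations, a radical subgroup of the diagonal torus
is a `blockTorus`. -/
theorem exists_conj_blockTorus {ℓ : ℕ} {K Q : Subgroup G} (hQ : RadicalIn ℓ K Q)
    (I : Finset (Fin 3)) (hflip : ∀ e : Fin 3 → Prop, (∀ i ∉ I, ¬ e i) → m.flip e ∈ K)
    (hperm : ∀ σ : Equiv.Perm (Fin 3), (∀ i ∉ I, σ i = i) → m.π σ ∈ K)
    (htorus : ∀ b : Fin 3 → ℕ, (∀ i ∉ I, b i = 0) → m.blockTorus ℓ b ≤ K)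
    (hδ : ∀ x ∈ Q, ∃ u, (∀ i ∉ I, u i = 1) ∧ m.δ u = x) (hne : Q ≠ ⊥) :
    ∃ c : Fin 3 → Fin 4, (∀ i ∉ I, c i = 0) ∧ c ≠ 0 ∧ ∀ σ : Equiv.Perm (Fin 3),
      (∀ i ∉ I, σ i = i) → ConjIn K Q (m.blockTorus ℓ fun i => (c (σ i) : ℕ)) := by
  let E : Fin 3 → Fin 3 → Prop := fun i k => ∀ u, m.δ u ∈ Q → u i = u k
  let N : Fin 3 → Fin 3 → Prop := fun i k => ∀ u, m.δ u ∈ Q → u i = (u k)⁻¹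
  -- Coordinates are regarded as characters of Q, identified when they are equal or mutually
  -- inverse; `f` picks a representative in each class.
  let s : Setoid (Fin 3) :=
    { r := fun i k => E i k ∨ N i k
      iseqv := by
        refine ⟨fun i => Or.inl fun u _ => rfl, ?_, ?_⟩
        · rintro i k (h | h)
          · exact Or.inl fun u hu => (h u hu).symm
          · exact Or.inr fun u hu => by rw [h u hu, inv_inv]
        · rintro i k l (h | h) (h' | h')
          · exact Or.inl fun u hu => (h u hu).trans (h' u hu)
          · exact Or.inr fun u hu => (h u hu).trans (h' u hu)
          · exact Or.inr fun u hu => by rw [h u hu, h' u hu]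
          · exact Or.inl fun u hu => by rw [h u hu, h' u hu, inv_inv] }
  let f : Fin 3 → Fin 3 := fun i => (Quotient.mk s i).out
  have hf : ∀ i, E i (f i) ∨ N i (f i) := fun i => s.symm (Quotient.mk_out i)
  have hff : ∀ i k, (E (f i) (f k) ∨ N (f i) (f k)) → f i = f k := by
    intro i k h
    have h1 : (Quotient.mk s i) = Quotient.mk s k :=
      Quotient.sound (s.trans (s.trans (hf i) h) (s.symm (hf k)))
    simp only [f, h1]
  have huI : ∀ u, m.δ u ∈ Q → ∀ i ∉ I, u i = 1 := by
    intro u hu i hi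
    obtain ⟨v, hv, hvu⟩ := hδ _ hu
    rw [← m.δ_injective hvu, hv i hi]
  -- Coordinates outside I are trivial on Q, so no inversion is needed there and the conjugating
  -- element stays in K.
  have heI : ∀ i ∉ I, E i (f i) := by
    intro i hi
    rcases hf i with h | h
    · exact h
    · intro u hu
      have := h u hu
      rw [huI u hu i hi] at this ⊢
      exact (inv_eq_one.1 this.symm).symm
  -- Inverts exactly those coordinates that are inverse, and not equal, to their representative.
  let k₁ : G := m.flip fun i => ¬ E i (f i)
  have hk₁ : k₁ ∈ K := hflip _ fun i hi h => h (heI i hi)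
  have hconj : ∀ u, m.δ u ∈ Q → k₁ * m.δ u * k₁⁻¹ = m.δ (u ∘ f) := by
    intro u hu
    rw [flip_conj_δ]
    congr 1
    funext i
    by_cases hi : E i (f i)
    · rw [if_neg (not_not.2 hi), Function.comp, hi u hu]
    · rw [if_pos hi, Function.comp, (hf i).resolve_left hi u hu, inv_inv]
  -- The label 0 is kept for coordinates trivial on Q; another class is labelled by its
  -- representative plus one, to avoid 0.
  let c : Fin 3 → Fin 4 := fun i => if ∀ u, m.δ u ∈ Q → u (f i) = 1 then 0 else (f i).succ
  have hcf : ∀ i k, c i = c k ↔ f i = f k := by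
    intro i k
    simp only [c]
    constructor
    · intro h
      split_ifs at h with h1 h2 h2
      · exact hff i k (Or.inl fun u hu => by rw [h1 u hu, h2 u hu])
      · exact absurd h.symm (Fin.succ_ne_zero _)
      · exact absurd h (Fin.succ_ne_zero _)
      · exact Fin.succ_injective _ h
    · intro h
      rw [h]
  have hc0 : ∀ i, c i = 0 ↔ ∀ u, m.δ u ∈ Q → u (f i) = 1 := by
    intro i
    simp only [c]
    split_ifs with h
    · simpa using h
    · simpa [Fin.succ_ne_zero] using h
  have hcI : ∀ i ∉ I, c i = 0 := fun i hi => (hc0 i).2 fun u hu => by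
    rw [← heI i hi u hu, huI u hu i hi]
  refine ⟨c, hcI, ?_, fun σ hσ => ?_⟩
  · intro hc
    apply hne
    rw [eq_bot_iff]
    intro x hx
    obtain ⟨u, -, rfl⟩ := hδ x hx
    have h1 := hconj u hx
    have h2 : u ∘ f = 1 := by
      funext i
      exact (hc0 i).1 (congrFun hc i) u hx
    rw [h2, map_one, mul_inv_eq_one] at h1
    rw [Subgroup.mem_bot]
    exact mul_eq_left.1 h1
  · have hk₂ : m.π σ⁻¹ ∈ K := hperm _ fun i hi => by
      rw [Equiv.Perm.inv_eq_iff_eq, hσ i hi]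
    have hk : m.π σ⁻¹ * k₁ ∈ K := K.mul_mem hk₂ hk₁
    refine ⟨m.π σ⁻¹ * k₁, hk, ?_⟩
    have hconj' : ∀ u, m.δ u ∈ Q →
        (m.π σ⁻¹ * k₁) * m.δ u * (m.π σ⁻¹ * k₁)⁻¹ = m.δ (fun i => u (f (σ i))) := by
      intro u hu
      have : (m.π σ⁻¹ * k₁) * m.δ u * (m.π σ⁻¹ * k₁)⁻¹ =
          m.π σ⁻¹ * (k₁ * m.δ u * k₁⁻¹) * (m.π σ⁻¹)⁻¹ := by
        simp only [_root_.mul_inv_rev, mul_assoc]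
      rw [this, hconj u hu, π_conj_δ, inv_inv]
      rfl
    have hmem : ∀ x, x ∈ Q.map (MulAut.conj (m.π σ⁻¹ * k₁)).toMonoidHom ↔
        ∃ u, m.δ u ∈ Q ∧ m.δ (fun i => u (f (σ i))) = x := by
      intro x
      constructor
      · rintro ⟨y, hy, rfl⟩
        obtain ⟨u, -, rfl⟩ := hδ y hy
        exact ⟨u, hy, (hconj' u hy).symm⟩
      · rintro ⟨u, hu, rfl⟩
        exact ⟨_, hu, hconj' u hu⟩
    have hmem' : ∀ v, m.δ v ∈ Q.map (MulAut.conj (m.π σ⁻¹ * k₁)).toMonoidHom ↔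
        ∃ u, m.δ u ∈ Q ∧ (fun i => u (f (σ i))) = v := by
      intro v
      rw [hmem]
      simp only [m.δ_injective.eq_iff]
    have hval : ∀ i k, ((c (σ i) : Fin 4) : ℕ) = (c (σ k) : ℕ) ↔ f (σ i) = f (σ k) := by
      intro i k
      rw [← hcf, Fin.val_inj]
    refine m.eq_blockTorus (hQ.conj hk) _ ?_ ?_ ?_ ?_ ?_ ?_
    · intro x hx
      obtain ⟨u, -, h⟩ := (hmem x).1 hx
      exact ⟨_, h⟩
    · intro i
      rw [Fin.val_eq_zero_iff, hc0]
      constructor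
      · rintro h v hv
        obtain ⟨u, hu, rfl⟩ := (hmem' v).1 hv
        exact h u hu
      · intro h u hu
        exact h _ ((hmem' _).2 ⟨u, hu, rfl⟩)
    · intro i k hik v hv
      obtain ⟨u, hu, rfl⟩ := (hmem' v).1 hv
      exact congrArg u ((hval i k).1 hik)
    · intro i k hik
      by_contra! h
      refine (hval i k).not.1 hik (hff _ _ (Or.inl fun u hu => ?_))
      exact h _ ((hmem' _).2 ⟨u, hu, rfl⟩)
    · intro i k hik
      by_contra! h
      refine (hval i k).not.1 hik (hff _ _ (Or.inr fun u hu => ?_))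
      exact h _ ((hmem' _).2 ⟨u, hu, rfl⟩)
    · exact htorus _ fun i hi => by rw [hσ i hi, hcI i hi]; rfl

end TorusModel

/-- Up to renaming labels, sorting nonzero blocks by decreasing size and putting label 0 last leaves
the six partitions of 1, 2 and 3. There are only 64 labellings to check. -/
theorem exists_perm_blk (c : Fin 3 → Fin 4) (hc : c ≠ 0) :
    ∃ σ : Equiv.Perm (Fin 3), ∃ r ∈ [(1, 0, 0), (2, 0, 0), (3, 0, 0), (1, 1, 0), (2, 1, 0),
      (1, 1, 1)], (∀ i, (c (σ i) : ℕ) = 0 ↔ blk r.1 r.2.1 r.2.2 i = 0) ∧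
      ∀ i k, (c (σ i) : ℕ) = c (σ k) ↔ blk r.1 r.2.1 r.2.2 i = blk r.1 r.2.1 r.2.2 k := by
  revert c
  decide +kernel

set_option synthInstance.maxSize 2000 in
theorem exists_perm_blk_of_apply_two (c : Fin 3 → Fin 4) (hc : c ≠ 0) (h2 : c 2 = 0) :
    ∃ σ : Equiv.Perm (Fin 3), ∃ r ∈ [(1, 0, 0), (2, 0, 0), (1, 1, 0)], σ 2 = 2 ∧
      (∀ i, (c (σ i) : ℕ) = 0 ↔ blk r.1 r.2.1 r.2.2 i = 0) ∧
      ∀ i k, (c (σ i) : ℕ) = c (σ k) ↔ blk r.1 r.2.1 r.2.2 i = blk r.1 r.2.1 r.2.2 k := by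
  revert c
  decide +kernel

/-! ### Monomial `3`-subgroups -/

/-- The 3-cycle `0 → 1 → 2 → 0`. -/
def cyc : Equiv.Perm (Fin 3) := finRotate 3

theorem cyc_inv_zero : cyc⁻¹ 0 = 2 := by decide
theorem cyc_inv_one : cyc⁻¹ 1 = 0 := by decide
theorem cyc_inv_two : cyc⁻¹ 2 = 1 := by decide

theorem eq_of_mem_alternatingGroup {τ : Equiv.Perm (Fin 3)} (h : τ ∈ alternatingGroup (Fin 3)) :
    τ = 1 ∨ τ = cyc ∨ τ = cyc⁻¹ := by
  rw [Equiv.Perm.mem_alternatingGroup] at h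
  revert τ
  decide

theorem cyc_mem : cyc ∈ alternatingGroup (Fin 3) := by
  rw [Equiv.Perm.mem_alternatingGroup]
  decide

/-! ### The operator s - 1 on triples -/

section Shift

variable {U : Type*} [CommGroup U]

/-- The operator `s - 1` of the cyclic shift `s` on triples, written multiplicatively. -/
def shiftSub (v : Fin 3 → U) : Fin 3 → U := fun i => v (cyc⁻¹ i) * (v i)⁻¹

/-- Since s³ = 1, one has (s - 1)³ = 3(s - s²), so three applications lower the exponent by a factor
3. -/
theorem shiftSub_three (v : Fin 3 → U) (k : ℕ) (hv : v ^ 3 ^ (k + 1) = 1) :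
    shiftSub (shiftSub (shiftSub v)) ^ 3 ^ k = 1 := by
  have h : shiftSub (shiftSub (shiftSub v)) =
      (fun i => v (cyc⁻¹ i) * (v (cyc⁻¹ (cyc⁻¹ i)))⁻¹) ^ 3 := by
    funext i
    fin_cases i <;>
    · simp only [shiftSub, Pi.pow_apply, cyc_inv_zero, cyc_inv_one, cyc_inv_two, Fin.zero_eta,
        Fin.mk_one, Fin.reduceFinMk]
      rw [pow_succ, pow_succ, pow_one]
      simp only [_root_.mul_inv_rev, inv_inv]
      apply Additive.ofMul.injective
      simp only [ofMul_mul, ofMul_inv]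
      abel
  have hv' : ∀ i, v i ^ 3 ^ (k + 1) = 1 := congrFun hv
  rw [h, ← pow_mul, ← pow_succ']
  funext i
  rw [Pi.pow_apply, mul_pow, inv_pow, hv', hv', Pi.one_apply, inv_one, one_mul]

/-- On triples of 3-power order s - 1 is nilpotent, so its iterates from v end in 1 ∈ S; the last
iterate before the first entry into S is the required element. -/
theorem exists_shiftSub_mem {X S : Set (Fin 3 → U)} (hX : ∀ v ∈ X, shiftSub v ∈ X)
    (hS : 1 ∈ S) {k : ℕ} {v : Fin 3 → U} (hv : v ∈ X) (hvk : v ^ 3 ^ k = 1) (hvS : v ∉ S) :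
    ∃ v' ∈ X, v' ∉ S ∧ shiftSub v' ∈ S := by
  induction k generalizing v with
  | zero =>
    rw [pow_zero, pow_one] at hvk
    exact absurd (hvk ▸ hS) hvS
  | succ k ih =>
    by_cases h1 : shiftSub v ∈ S
    · exact ⟨v, hv, hvS, h1⟩
    by_cases h2 : shiftSub (shiftSub v) ∈ S
    · exact ⟨_, hX _ hv, h1, h2⟩
    by_cases h3 : shiftSub (shiftSub (shiftSub v)) ∈ S
    · exact ⟨_, hX _ (hX _ hv), h2, h3⟩
    · exact ih (hX _ (hX _ (hX _ hv))) (shiftSub_three v k hvk) h3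

theorem eq_const_of_shiftSub_eq_one {v : Fin 3 → U} (h : shiftSub v = 1) (i : Fin 3) :
    v i = v 0 := by
  have h1 := congrFun h 1
  have h2 := congrFun h 2
  simp only [shiftSub, cyc_inv_one, cyc_inv_two, Pi.one_apply, mul_inv_eq_one] at h1 h2
  fin_cases i
  · rfl
  · exact h1.symm
  · exact h2.symm.trans h1.symm

end Shift

namespace TorusModel

set_option linter.unusedSectionVars false

variable {G B U : Type*} [Group G] [Ring B] [StarRing B] [CommGroup U] (m : TorusModel G B U)

/-- The permutation matrix of the 3-cycle. -/
def s : G := m.π cyc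

/-- Scalar matrices. -/
def scal : U →* G := m.δ.comp (Pi.constMonoidHom (Fin 3) U)

theorem scal_apply (c : U) : m.scal c = m.δ (fun _ => c) := rfl

theorem scal_injective : Function.Injective m.scal := fun _ _ h =>
  congrFun (m.δ_injective h) 0

theorem s_mul_δ (u : Fin 3 → U) : m.s * m.δ u = m.δ (fun i => u (cyc⁻¹ i)) * m.s :=
  m.π_mul_δ cyc u

theorem δ_conj_s (t u : Fin 3 → U) : m.δ t * (m.δ u * m.s) * (m.δ t)⁻¹ =
    m.δ (fun i => t i * u i * (t (cyc⁻¹ i))⁻¹) * m.s := by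
  have h := m.s_mul_δ t⁻¹
  rw [map_inv] at h
  have h2 : m.δ t * (m.δ u * m.s) * (m.δ t)⁻¹ = m.δ t * m.δ u * (m.s * (m.δ t)⁻¹) := by
    simp only [mul_assoc]
  rw [h2, h, ← mul_assoc, ← map_mul, ← map_mul]
  rfl

/-- Conjugation by `m.δ t` multiplies u by a coboundary of the cyclic shift. Starting from t 0 = 1
the coordinates of t are forced one after the other, and the equality of products closes the cycle.
-/
theorem exists_conj_eq {u v : Fin 3 → U} (h : u 0 * u 1 * u 2 = v 0 * v 1 * v 2) :
    ∃ t : Fin 3 → U, m.δ t * (m.δ u * m.s) * (m.δ t)⁻¹ = m.δ v * m.s := by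
  refine ⟨![1, v 1 * (u 1)⁻¹, v 2 * (u 2)⁻¹ * v 1 * (u 1)⁻¹], ?_⟩
  rw [δ_conj_s]
  congr 2
  funext i
  fin_cases i
  · have h' : u 0 = v 0 * v 1 * v 2 * (u 1)⁻¹ * (u 2)⁻¹ := by
      rw [← h]
      apply Additive.ofMul.injective
      simp only [ofMul_mul, ofMul_inv]
      abel
    simp only [Fin.zero_eta, cyc_inv_zero, Matrix.cons_val]
    rw [h']
    apply Additive.ofMul.injective
    simp only [ofMul_mul, ofMul_inv, ofMul_one]
    abel
  · simp [cyc_inv_one]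
  · simp only [Fin.reduceFinMk, cyc_inv_two, Matrix.cons_val]
    apply Additive.ofMul.injective
    simp only [ofMul_mul, ofMul_inv]
    abel

theorem scal_comm_π (c : U) (σ : Equiv.Perm (Fin 3)) : m.scal c * m.π σ = m.π σ * m.scal c := by
  rw [scal_apply, π_mul_δ]

theorem δ_comm (u v : Fin 3 → U) : m.δ u * m.δ v = m.δ v * m.δ u := by
  rw [← map_mul, mul_comm, map_mul]

theorem s_pow_three : m.s ^ 3 = 1 := by
  rw [s, ← map_pow, show cyc ^ 3 = 1 by decide, map_one]

theorem pow_three (u : Fin 3 → U) : (m.δ u * m.s) ^ 3 = m.scal (u 0 * u 1 * u 2) := by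
  have h : (m.δ u * m.s) ^ 3 = m.δ u * (m.s * m.δ u) * (m.s * m.δ u) * m.s := by
    simp only [pow_succ, pow_zero, one_mul, mul_assoc]
  have h2 : m.s * m.s * m.s = 1 := by
    have := m.s_pow_three
    rwa [pow_succ, pow_two] at this
  rw [h, s_mul_δ]
  have h3 : m.δ u * (m.δ (fun i => u (cyc⁻¹ i)) * m.s) * (m.δ (fun i => u (cyc⁻¹ i)) * m.s) * m.s =
      m.δ u * m.δ (fun i => u (cyc⁻¹ i)) * (m.s * m.δ (fun i => u (cyc⁻¹ i))) * (m.s * m.s) := by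
    simp only [mul_assoc]
  have h4 : ∀ a b : G, a * (b * m.s) * (m.s * m.s) = a * b := fun a b => by
    have : a * (b * m.s) * (m.s * m.s) = a * b * (m.s * m.s * m.s) := by simp only [mul_assoc]
    rw [this, h2, mul_one]
  rw [h3, s_mul_δ, h4, ← map_mul, ← map_mul, scal_apply]
  congr 1
  funext i
  fin_cases i <;>
  · simp only [Pi.mul_apply, Fin.zero_eta, Fin.mk_one, Fin.reduceFinMk, cyc_inv_zero, cyc_inv_one,
      cyc_inv_two]
    apply Additive.ofMul.injective
    simp only [ofMul_mul]
    abel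

/-- The subgroup of monomial matrices with entries of `ℓ`-power order and even permutation. -/
def monomial (ℓ : ℕ) : Subgroup G where
  carrier := {x | ∃ u : Fin 3 → U, (∀ i, u i ∈ ellPart ℓ U) ∧
    ∃ τ ∈ alternatingGroup (Fin 3), m.δ u * m.π τ = x}
  one_mem' := ⟨1, fun _ => one_mem _, 1, one_mem _, by simp⟩
  mul_mem' := by
    rintro _ _ ⟨u, hu, τ, hτ, rfl⟩ ⟨v, hv, ρ, hρ, rfl⟩
    refine ⟨u * fun i => v (τ⁻¹ i), fun i => mul_mem (hu i) (hv _), τ * ρ, mul_mem hτ hρ, ?_⟩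
    rw [map_mul, map_mul, mul_assoc, ← mul_assoc _ (m.π τ), ← π_mul_δ]
    simp only [mul_assoc]
  inv_mem' := by
    rintro _ ⟨u, hu, τ, hτ, rfl⟩
    refine ⟨fun i => (u (τ i))⁻¹, fun i => inv_mem (hu _), τ⁻¹, inv_mem hτ, ?_⟩
    rw [_root_.mul_inv_rev, ← map_inv, ← map_inv, π_mul_δ, inv_inv]
    rfl

theorem δ_mul_π_inj {u v : Fin 3 → U} {σ τ : Equiv.Perm (Fin 3)} (hB : Nontrivial B)
    (h : m.δ u * m.π σ = m.δ v * m.π τ) : u = v ∧ σ = τ := by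
  have hστ : σ = τ := by
    have h1 := congrArg m.ι h
    rw [map_mul, map_mul, ι_δ, ι_δ, ι_π, ι_π] at h1
    ext1 k
    by_contra hk
    have h2 := congrFun (congrFun h1 (σ k)) k
    rw [diagonal_mul, diagonal_mul] at h2
    simp only [permMat, of_apply, if_true, mul_one, if_neg hk, mul_zero] at h2
    have h3 := m.j_mul_star (u (σ k))
    rw [h2, zero_mul] at h3
    exact zero_ne_one h3
  subst hστ
  exact ⟨m.δ_injective (mul_right_cancel h), rfl⟩

theorem δ_mem_monomial {ℓ : ℕ} {u : Fin 3 → U} (hu : ∀ i, u i ∈ ellPart ℓ U) :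
    m.δ u ∈ m.monomial ℓ :=
  ⟨u, hu, 1, one_mem _, by simp⟩

theorem s_mem_monomial (ℓ : ℕ) : m.s ∈ m.monomial ℓ :=
  ⟨1, fun _ => one_mem _, cyc, cyc_mem, by simp [s]⟩

/-- An element of the monomial group is diagonal or it or its inverse involves the 3-cycle. -/
theorem monomial_cases {ℓ : ℕ} {x : G} (hx : x ∈ m.monomial ℓ) :
    (∃ u, (∀ i, u i ∈ ellPart ℓ U) ∧ m.δ u = x) ∨
      ∃ u, (∀ i, u i ∈ ellPart ℓ U) ∧ (x = m.δ u * m.s ∨ x⁻¹ = m.δ u * m.s) := by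
  obtain ⟨u, hu, τ, hτ, rfl⟩ := hx
  rcases eq_of_mem_alternatingGroup hτ with rfl | rfl | rfl
  · exact Or.inl ⟨u, hu, by simp⟩
  · exact Or.inr ⟨u, hu, Or.inl rfl⟩
  · refine Or.inr ⟨fun i => (u (cyc⁻¹ i))⁻¹, fun i => inv_mem (hu _), Or.inr ?_⟩
    rw [_root_.mul_inv_rev, ← map_inv, ← map_inv, π_mul_δ, inv_inv]
    rfl

/-- Elements of a monomial group containing `g = δ u * s`. -/
theorem exists_diag_mul {ℓ : ℕ} {Q : Subgroup G} (hQ : Q ≤ m.monomial ℓ) {u : Fin 3 → U}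
    (hg : m.δ u * m.s ∈ Q) {x : G} (hx : x ∈ Q) :
    ∃ v, m.δ v ∈ Q ∧ (x = m.δ v ∨ x = m.δ v * (m.δ u * m.s) ∨ x = m.δ v * (m.δ u * m.s)⁻¹) := by
  obtain ⟨a, -, τ, hτ, rfl⟩ := hQ hx
  rcases eq_of_mem_alternatingGroup hτ with rfl | rfl | rfl
  · exact ⟨a, by simpa using hx, Or.inl (by simp)⟩
  · have h : m.δ a * m.π cyc = m.δ (a * u⁻¹) * (m.δ u * m.s) := by
      rw [map_mul, map_inv, mul_assoc, inv_mul_cancel_left]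
      rfl
    refine ⟨a * u⁻¹, ?_, Or.inr (Or.inl h)⟩
    rw [h] at hx
    exact (Q.mul_mem_cancel_right hg).1 hx
  · have h : m.δ a * m.π cyc⁻¹ = m.δ (a * fun i => u (cyc i)) * (m.δ u * m.s)⁻¹ := by
      have := m.π_mul_δ cyc⁻¹ u
      rw [inv_inv] at this
      rw [map_mul, _root_.mul_inv_rev, mul_assoc, s, ← map_inv m.π, ← mul_assoc _ (m.π cyc⁻¹),
        ← this, mul_assoc, mul_inv_cancel, mul_one]
    refine ⟨_, ?_, Or.inr (Or.inr h)⟩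
    rw [h] at hx
    exact (Q.mul_mem_cancel_right (Q.inv_mem hg)).1 hx

end TorusModel

/-- Write c = γ^k with γ a generator of the cyclic 3-part: either 3 divides k, or k is prime to the
order of γ. The dichotomy decides whether a monomial element can be diagonalized. -/
theorem exists_cube_or_generates {U : Type*} [CommGroup U] [Finite U] [IsCyclic U] {c : U}
    (hc : c ∈ ellPart 3 U) :
    (∃ b ∈ ellPart 3 U, b ^ 3 = c) ∨ ∀ x ∈ ellPart 3 U, x ∈ Subgroup.zpowers c := by
  obtain ⟨⟨γ, hγ⟩, hgen⟩ := IsCyclic.exists_generator (α := ellPart 3 U)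
  have hgen' : ∀ x ∈ ellPart 3 U, x ∈ Subgroup.zpowers γ := by
    intro x hx
    obtain ⟨k, hk⟩ := Subgroup.mem_zpowers_iff.1 (hgen ⟨x, hx⟩)
    exact Subgroup.mem_zpowers_iff.2 ⟨k, congrArg Subtype.val hk⟩
  have hfin : IsOfFinOrder γ := isOfFinOrder_of_finite γ
  obtain ⟨k, rfl⟩ : ∃ k : ℕ, γ ^ k = c := hfin.mem_powers_iff_mem_zpowers.2 (hgen' c hc)
  by_cases h3 : 3 ∣ k
  · obtain ⟨t, rfl⟩ := h3
    exact Or.inl ⟨γ ^ t, pow_mem hγ t, by rw [← pow_mul, mul_comm]⟩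
  · right
    obtain ⟨N, hN⟩ := mem_ellPart.1 hγ
    have hcop : k.Coprime (orderOf γ) := by
      refine Nat.Coprime.coprime_dvd_right (orderOf_dvd_of_pow_eq_one hN) ?_
      exact Nat.Coprime.pow_right _ ((Nat.Prime.coprime_iff_not_dvd Nat.prime_three).2 h3).symm
    obtain ⟨t, ht⟩ := exists_pow_eq_self_of_coprime hcop
    intro x hx
    have : γ ∈ Subgroup.zpowers (γ ^ k) := Subgroup.mem_zpowers_iff.2 ⟨t, by simpa using ht⟩
    exact (Subgroup.zpowers_le.2 this) (hgen' x hx)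

theorem cube_eq_one_of_mem_ellPart {U : Type*} [CommGroup U] {ℓ : ℕ} {ω : U}
    (hω : ω ^ ℓ = 1) : ω ∈ ellPart ℓ U := ⟨1, by rwa [pow_one]⟩

/-! ### Scalars, cube roots of unity and the Fourier matrix -/

namespace TorusModel

set_option linter.unusedSectionVars false

variable {G B U : Type*} [Group G] [Ring B] [StarRing B] [CommGroup U] (m : TorusModel G B U)

theorem scal_comm {ℓ : ℕ} (c : U) {x : G} (hx : x ∈ m.monomial ℓ) :
    m.scal c * x = x * m.scal c := by
  obtain ⟨u, -, τ, -, rfl⟩ := hx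
  rw [← mul_assoc, mul_assoc _ (m.π τ), ← scal_comm_π, scal_apply, δ_comm, mul_assoc]

/-- One nontrivial scalar in Q forces all entries of a matrix centralizing Q to commute with U. All
scalars then centralize C(Q), and they centralize the monomial group anyway. -/
theorem scal_mem {ℓ : ℕ} {Q : Subgroup G} (hQ : RadicalIn ℓ ⊤ Q) (hQm : Q ≤ m.monomial ℓ)
    {c : U} (hc : m.scal c ∈ Q) (hc1 : c ≠ 1) {c' : U} (hc' : c' ∈ ellPart ℓ U) :
    m.scal c' ∈ Q := by
  refine hQ.mem_of_commute trivial (m.exists_pow_eq_one fun _ => hc')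
    (fun y hy => m.scal_comm c' (hQm hy)) fun x _ hx => ?_
  refine (m.mul_δ_eq_iff x _ _).2 fun i k => ?_
  have := (m.mul_δ_eq_iff x _ _).1 (hx _ hc).eq.symm i k
  exact m.commute_of_commute c c' _ hc1 this

-- A nontrivial c with c³ = 1 and ω are both roots of x² + x + 1, so j(c) - j(ω²) intertwines `j c`
-- with `j ω` and must vanish unless c = ω^{±1}.
include m in
theorem cube_root {ω c : U} (hω : ω ^ 3 = 1) (hω1 : ω ≠ 1) (hc : c ^ 3 = 1) :
    ∃ i : ℕ, c = ω ^ i := by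
  by_cases hc1 : c = 1
  · exact ⟨0, by simpa using hc1⟩
  by_cases hcω : c = ω
  · exact ⟨1, by simpa using hcω⟩
  refine ⟨2, ?_⟩
  have hinv : ω⁻¹ = ω ^ 2 := by
    rw [inv_eq_iff_mul_eq_one, ← pow_succ', hω]
  rw [← hinv]
  by_contra hcω'
  have h1 := m.one_add_add c hc hc1
  have h2 := m.one_add_add ω hω hω1
  have hb : m.j c - m.j (ω ^ 2) = 0 := by
    refine m.eq_zero_of_intertwine c ω _ ?_ hcω hcω'
    have h6 : m.j ω = - 1 - m.j (ω ^ 2) := by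
      rw [← sub_eq_zero, ← h2]
      abel
    have h7 : m.j (c ^ 2) = - 1 - m.j c := by
      rw [← sub_eq_zero, ← h1]
      abel
    have h8 : m.j c * m.j c = m.j (c ^ 2) := by rw [← map_mul, pow_two]
    have h9 : m.j (ω ^ 2) * m.j ω = 1 := by rw [← map_mul, ← pow_succ, hω, map_one]
    rw [mul_sub, sub_mul, h9, h8, h7, h6, mul_sub]
    simp only [mul_neg, mul_one]
    abel
  exact hcω' (hinv ▸ m.j_injective (sub_eq_zero.1 hb))

/-- `diag(1, ω, ω²)`. -/
def dω (ω : U) : G := m.δ ![1, ω, ω ^ 2]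

/-- The matrix diag(1, ω, ω²) separates coordinate 0 from the others but not 1 from 2, because ω² =
ω⁻¹. Its product with ω, diag(ω, ω², 1), separates those. So x is diagonal, and commuting with the
scalar ω puts its entries into U. -/
theorem exists_δ_of_commute {ω : U} (hω : ω ^ 3 = 1) (hω1 : ω ≠ 1) {x : G}
    (h1 : m.scal ω * x = x * m.scal ω) (h2 : m.dω ω * x = x * m.dω ω) : ∃ v, m.δ v = x := by
  have h3 : m.δ (![1, ω, ω ^ 2] * fun _ => ω) * x = x * m.δ (![1, ω, ω ^ 2] * fun _ => ω) := by
    rw [map_mul, mul_assoc]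
    change _ * (m.scal ω * x) = _
    rw [h1, ← mul_assoc]
    change m.dω ω * x * _ = _
    rw [h2, mul_assoc]
    rfl
  rw [dω, mul_δ_eq_iff] at h2
  rw [mul_δ_eq_iff] at h3
  rw [scal_apply, mul_δ_eq_iff] at h1
  have hinv : ω⁻¹ = ω ^ 2 := by
    rw [inv_eq_iff_mul_eq_one, ← pow_succ', hω]
  have hω2 : ω ^ 2 ≠ 1 := fun h => hω1 (by rw [pow_succ, h, one_mul] at hω; exact hω)
  have hne : ω ≠ ω ^ 2 := fun h => hω1 (m.eq_one_of_eq_inv ω (hinv ▸ h))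
  have hne' : ω ^ 2 ≠ ω⁻¹⁻¹ := by rw [inv_inv]; exact hne.symm
  have hω3 : ω ^ 2 * ω = 1 := by rw [← pow_succ, hω]
  have off : ∀ i k, i ≠ k → m.ι x i k = 0 := by
    have h01 := fun h h' => m.eq_zero_of_intertwine _ _ _ (h2 0 1) h h'
    have h10 := fun h h' => m.eq_zero_of_intertwine _ _ _ (h2 1 0) h h'
    have h02 := fun h h' => m.eq_zero_of_intertwine _ _ _ (h2 0 2) h h'
    have h20 := fun h h' => m.eq_zero_of_intertwine _ _ _ (h2 2 0) h h'
    have h12 := fun h h' => m.eq_zero_of_intertwine _ _ _ (h3 1 2) h h'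
    have h21 := fun h h' => m.eq_zero_of_intertwine _ _ _ (h3 2 1) h h'
    simp only [Matrix.cons_val, Pi.mul_apply, hω3, inv_one, ne_eq, ← pow_two] at h01 h10 h02 h20 h12 h21
    have hi1 : (1 : U) ≠ ω⁻¹ := fun h => hω1 (inv_eq_one.1 h.symm)
    have hi2 : (1 : U) ≠ (ω ^ 2)⁻¹ := fun h => hω2 (inv_eq_one.1 h.symm)
    have e01 := h01 (Ne.symm hω1) hi1
    have e10 := h10 hω1 hω1
    have e02 := h02 (Ne.symm hω2) hi2
    have e20 := h20 hω2 hω2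
    have e12 := h12 hω2 hω2
    have e21 := h21 (Ne.symm hω2) hi2
    intro i k hik
    fin_cases i <;> fin_cases k <;> first | exact absurd rfl hik | assumption
  have hdiag : ∀ i, ∃ u, m.j u = m.ι x i i := by
    intro i
    refine m.exists_of_norm_one _ (fun u => m.commute_of_commute ω u _ hω1 (h1 i i)) ?_
    have h := congrFun (congrFun (m.ι_mul_star x) i) i
    rw [Matrix.mul_apply, Finset.sum_eq_single i] at h
    · rwa [star_eq_conjTranspose, conjTranspose_apply, one_apply_eq] at h
    · intro l _ hl
      rw [off i l (Ne.symm hl), zero_mul]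
    · simp
  choose v hv using hdiag
  refine ⟨v, m.ι_injective ?_⟩
  rw [ι_δ]
  ext i k
  by_cases hik : i = k
  · subst hik
    rw [diagonal_apply_eq, hv]
  · rw [diagonal_apply_ne _ hik, off i k hik]

/-- The discrete Fourier transform diagonalizes the 3-cycle. -/
theorem exists_fourier {ω : U} (hω : ω ^ 3 = 1) (hω1 : ω ≠ 1) :
    ∃ f : G, f * m.s * f⁻¹ = m.dω ω ∧ ∀ c, f * m.scal c * f⁻¹ = m.scal c := by
  let M : Matrix (Fin 3) (Fin 3) B := Matrix.of fun i k => m.j (ω ^ ((i : ℕ) * k))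
  have h2 := m.one_add_add ω hω hω1
  have hinv : ω⁻¹ = ω ^ 2 := by
    rw [inv_eq_iff_mul_eq_one, ← pow_succ', hω]
  have hM : M * star M = 1 := by
    have h22 : (2 : B) = 0 := m.two_eq_zero
    -- In characteristic two 3 = 1, so the Fourier matrix is unitary without a normalizing factor.
    have h3 : (1 : B) + 1 + 1 = 1 := by
      have : (1 : B) + 1 = 0 := by rw [one_add_one_eq_two, h22]
      rw [this, zero_add]
    have hj : ∀ u v, m.j u * m.j v = m.j (u * v) := fun u v => (map_mul _ _ _).symm
    have e2 : (ω ^ 2) ^ 2 = ω := by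
      rw [← pow_mul, show 2 * 2 = 3 + 1 from rfl, pow_add, hω, one_mul, pow_one]
    have e1 : ω ^ 2 * ω = 1 := by rw [← pow_succ, hω]
    have e1' : ω * ω ^ 2 = 1 := by rw [← pow_succ', hω]
    have e4 : ω ^ 4 = ω := by rw [show 4 = 3 + 1 from rfl, pow_add, hω, one_mul, pow_one]
    have hinv2 : (ω ^ 2)⁻¹ = ω := by rw [← hinv, inv_inv]
    have h2' : 1 + m.j (ω ^ 2) + m.j ω = 0 := by rw [← h2]; abel
    ext i k
    rw [Matrix.mul_apply, Fin.sum_univ_three]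
    simp only [star_eq_conjTranspose, conjTranspose_apply, M, of_apply, m.star_j, hj]
    fin_cases i <;> fin_cases k <;>
      simp [-map_pow, -map_mul, ← pow_two, e1, e1', e2, e4, hinv, hinv2, h2, h2', h3]
  refine ⟨m.lift M hM, ?_, fun c => ?_⟩
  · rw [mul_inv_eq_iff_eq_mul]
    apply m.ι_injective
    rw [map_mul, map_mul, ι_lift, s, ι_π, dω, ι_δ]
    ext i k
    rw [mul_permMat, diagonal_mul]
    simp only [M, of_apply]
    rw [← map_mul]
    congr 1
    have e4 : ω ^ 4 = ω := by rw [show 4 = 3 + 1 from rfl, pow_add, hω, one_mul, pow_one]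
    have e2 : (ω ^ 2) ^ 2 = ω := by rw [← pow_mul, e4]
    fin_cases i <;> fin_cases k <;> simp [cyc, e4, e2, ← pow_succ, ← pow_succ', hω, ← pow_two]
  · rw [mul_inv_eq_iff_eq_mul, eq_comm, scal_apply, mul_δ_eq_iff]
    intro i k
    rw [ι_lift]
    simp only [M, of_apply]
    rw [← map_mul, mul_comm, map_mul]

end TorusModel

/-! ### Non-diagonal radical subgroups of the monomial 3-group -/

namespace TorusModel

set_option linter.unusedSectionVars false

variable {G B U : Type*} [Group G] [Ring B] [StarRing B] [CommGroup U] (m : TorusModel G B U)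

/-- `diag(c, 1, 1)` times the 3-cycle. -/
def γ (c : U) : G := m.δ ![c, 1, 1] * m.s

theorem γ_pow_three (c : U) : m.γ c ^ 3 = m.scal c := by
  rw [γ, pow_three]
  simp

/-- The central product of the scalars of `3`-power order with the extraspecial group generated by
`diag(1, ω, ω²)` and the 3-cycle. -/
def extra (ω : U) : Subgroup G :=
  (ellPart 3 U).map m.scal ⊔ (Subgroup.zpowers (m.dω ω) ⊔ Subgroup.zpowers m.s)

theorem δ_mul_s_pow_three_eq_one {a : Fin 3 → U} (h : (m.δ a * m.s) ^ 3 = 1) :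
    a 0 * a 1 * a 2 = 1 := by
  rw [pow_three, ← map_one m.scal] at h
  exact m.scal_injective h

theorem conj_δ_comm (t v : Fin 3 → U) : m.δ t * m.δ v * (m.δ t)⁻¹ = m.δ v := by
  rw [δ_comm, mul_inv_cancel_right]

theorem scal_of_commute_γ {u v : Fin 3 → U} (h : m.δ v * (m.δ u * m.s) = m.δ u * m.s * m.δ v) :
    ∃ c, m.scal c = m.δ v := by
  rw [mul_assoc, s_mul_δ, ← mul_assoc, ← mul_assoc, ← map_mul, ← map_mul, mul_comm u] at h
  have h1 := m.δ_injective (mul_right_cancel h)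
  have h2 : v = fun i => v (cyc⁻¹ i) := mul_right_cancel h1
  refine ⟨v 0, ?_⟩
  rw [scal_apply]
  congr 1
  funext i
  refine (eq_const_of_shiftSub_eq_one ?_ i).symm
  funext k
  rw [shiftSub, Pi.one_apply, mul_inv_eq_one]
  exact (congrFun h2 k).symm

/-- A monomial subgroup whose diagonal elements are scalar is conjugate into the diagonal torus
unless it is generated by an element whose cube generates the scalars. -/
theorem conj_of_scalar [Finite U] [IsCyclic U] {ω : U} (hω : ω ^ 3 = 1) (hω1 : ω ≠ 1)
    {Q : Subgroup G} (hQp : IsPGroup 3 Q) (hQm : Q ≤ m.monomial 3) {u : Fin 3 → U} (hu : ∀ i, u i ∈ ellPart 3 U)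
    (hg : m.δ u * m.s ∈ Q) (hsc : ∀ v, m.δ v ∈ Q → ∃ c, m.scal c = m.δ v) :
    (∃ Q', ConjIn ⊤ Q Q' ∧ ∀ x ∈ Q', ∃ v, m.δ v = x) ∨
      ∃ c ∈ ellPart 3 U, (∀ x ∈ ellPart 3 U, x ∈ Subgroup.zpowers c) ∧
        ConjIn ⊤ Q (Subgroup.zpowers (m.γ c)) := by
  set g := m.δ u * m.s with hgdef
  have hc : u 0 * u 1 * u 2 ∈ ellPart 3 U := mul_mem (mul_mem (hu 0) (hu 1)) (hu 2)
  -- The product of the coordinates of u is the scalar g³. If it is b³, then g is conjugate to b·s,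
  -- which the Fourier matrix makes diagonal while fixing all scalars.
  rcases exists_cube_or_generates hc with ⟨b, -, hb⟩ | hgen
  · left
    obtain ⟨t, ht⟩ := m.exists_conj_eq (u := u) (v := fun _ => b)
      (by rw [← hb, pow_succ, pow_two])
    rw [← hgdef] at ht
    obtain ⟨f, hfs, hfc⟩ := m.exists_fourier hω hω1
    refine ⟨_, ⟨f * m.δ t, trivial, rfl⟩, ?_⟩
    clear_value g
    have hconj : ∀ a b : G, f * m.δ t * (a * b) * (f * m.δ t)⁻¹ =
        (f * m.δ t * a * (f * m.δ t)⁻¹) * (f * m.δ t * b * (f * m.δ t)⁻¹) := fun a b => by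
      simp [mul_assoc]
    have h1 : f * m.δ t * g * (f * m.δ t)⁻¹ = m.δ ((fun _ => b) * ![1, ω, ω ^ 2]) := by
      have : f * m.δ t * g * (f * m.δ t)⁻¹ = f * (m.δ t * g * (m.δ t)⁻¹) * f⁻¹ := by
        simp only [_root_.mul_inv_rev, mul_assoc]
      rw [this, ht]
      have : f * ((m.δ fun _ => b) * m.s) * f⁻¹ = (f * m.scal b * f⁻¹) * (f * m.s * f⁻¹) := by
        rw [scal_apply]
        simp only [mul_assoc, inv_mul_cancel_left]
      rw [this, hfs, hfc, map_mul]
      rfl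
    have h2 : ∀ v, m.δ v ∈ Q → f * m.δ t * m.δ v * (f * m.δ t)⁻¹ = m.δ v := by
      intro v hv
      obtain ⟨c, hc⟩ := hsc v hv
      have : f * m.δ t * m.δ v * (f * m.δ t)⁻¹ = f * (m.δ t * m.δ v * (m.δ t)⁻¹) * f⁻¹ := by
        simp only [_root_.mul_inv_rev, mul_assoc]
      rw [this, conj_δ_comm, ← hc, hfc]
    rintro _ ⟨x, hx, rfl⟩
    obtain ⟨v, hv, h | h | h⟩ := m.exists_diag_mul hQm (hgdef ▸ hg) hx
    · exact ⟨v, by rw [h]; exact (h2 v hv).symm⟩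
    · refine ⟨v * ((fun _ => b) * ![1, ω, ω ^ 2]), ?_⟩
      rw [map_mul, ← h1, h, ← hgdef]
      change _ = f * m.δ t * (m.δ v * g) * (f * m.δ t)⁻¹
      rw [hconj, h2 v hv]
    · refine ⟨v * ((fun _ => b) * ![1, ω, ω ^ 2])⁻¹, ?_⟩
      rw [map_mul, map_inv, ← h1, h, ← hgdef]
      change _ = f * m.δ t * (m.δ v * g⁻¹) * (f * m.δ t)⁻¹
      rw [hconj, h2 v hv]
      simp only [_root_.mul_inv_rev, mul_assoc, inv_inv]
  · right
    refine ⟨_, hc, hgen, ?_⟩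
    obtain ⟨t, ht⟩ := m.exists_conj_eq (u := u) (v := ![u 0 * u 1 * u 2, 1, 1]) (by simp)
    -- Here g³ already generates all scalars of 3-power order, hence all diagonal elements of Q.
    have hQ : Q = Subgroup.zpowers g := by
      apply le_antisymm
      · have hscal : ∀ v, m.δ v ∈ Q → m.δ v ∈ Subgroup.zpowers g := by
          intro v hv
          obtain ⟨c, hc'⟩ := hsc v hv
          have hcell : c ∈ ellPart 3 U :=
            m.ellPart_of_mem (u := fun _ => c) hQp (by rwa [← scal_apply, hc']) 0
          obtain ⟨k, hk⟩ := Subgroup.mem_zpowers_iff.1 (hgen c hcell)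
          rw [← hc', ← hk, map_zpow, ← pow_three]
          exact Subgroup.zpow_mem _ (Subgroup.pow_mem _ (Subgroup.mem_zpowers g) 3) k
        intro x hx
        obtain ⟨v, hv, h | h | h⟩ := m.exists_diag_mul hQm hg hx
        · exact h ▸ hscal v hv
        · rw [h]
          exact Subgroup.mul_mem _ (hscal v hv) (Subgroup.mem_zpowers g)
        · rw [h]
          exact Subgroup.mul_mem _ (hscal v hv) (Subgroup.inv_mem _ (Subgroup.mem_zpowers g))
      · exact Subgroup.zpowers_le.2 hg
    refine ⟨m.δ t, trivial, ?_⟩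
    rw [hQ, MonoidHom.map_zpowers]
    congr 1

/-- Rotating the entries 1, ω, ω² only multiplies them by a common power of ω. Thus diag(1, ω, ω²)
is central modulo scalars in the monomial group. -/
theorem exists_conj_dω {ω : U} (hω : ω ^ 3 = 1) {ℓ : ℕ} {x : G} (hx : x ∈ m.monomial ℓ) :
    ∃ i : ℕ, x * m.dω ω * x⁻¹ = m.scal (ω ^ i) * m.dω ω := by
  obtain ⟨u, -, τ, hτ, rfl⟩ := hx
  have h1 : m.δ u * m.π τ * m.dω ω * (m.δ u * m.π τ)⁻¹ =
      m.δ u * (m.π τ * m.dω ω * (m.π τ)⁻¹) * (m.δ u)⁻¹ := by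
    simp only [_root_.mul_inv_rev, mul_assoc]
  rw [h1, dω, π_conj_δ, conj_δ_comm]
  have e4 : ω ^ 4 = ω := by rw [show 4 = 3 + 1 from rfl, pow_add, hω, one_mul, pow_one]
  rcases eq_of_mem_alternatingGroup hτ with rfl | rfl | rfl
  · exact ⟨0, by simp⟩
  · refine ⟨2, ?_⟩
    rw [scal_apply, ← map_mul]
    congr 1
    funext i
    fin_cases i
    · simp [cyc_inv_zero]
    · simp [cyc_inv_one, ← pow_succ, hω]
    · simp [cyc_inv_two, ← pow_add, e4]
  · refine ⟨1, ?_⟩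
    rw [scal_apply, ← map_mul, inv_inv]
    congr 1
    funext i
    fin_cases i
    · simp [cyc]
    · simp [cyc, ← pow_two]
    · simp [cyc, ← pow_succ', hω]

/-! ### Radical 3-subgroups containing diag(1, ω, ω²) and a non-diagonal element -/

section Nonscalar

variable {ω : U} (hω : ω ^ 3 = 1) (hω1 : ω ≠ 1) {Q : Subgroup G} (hQ : RadicalIn 3 ⊤ Q)
  (hQm : Q ≤ m.monomial 3) (hZ : ∀ c ∈ ellPart 3 U, m.scal c ∈ Q) (hd : m.dω ω ∈ Q)
  {u : Fin 3 → U} (hg : m.δ u * m.s ∈ Q)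

-- A scalar centralizes Q, hence so does its conjugate under N(Q). Commuting with `m.scal ω` and
-- `m.dω ω` makes the conjugate diagonal, and commuting with the non-diagonal element makes it
-- scalar.
include hω hω1 hQm hZ hd hg in
theorem exists_scal_conj {n : G} (hn : n ∈ Subgroup.normalizer (Q : Set G)) (c : U) :
    ∃ c', m.scal c' = n * m.scal c * n⁻¹ := by
  have hz : ∀ x ∈ Q, n * m.scal c * n⁻¹ * x = x * (n * m.scal c * n⁻¹) := by
    intro x hx
    have hx' : n⁻¹ * x * n ∈ Q := by
      rw [Subgroup.mem_normalizer_iff.1 hn]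
      simpa [mul_assoc] using hx
    have h := m.scal_comm c (hQm hx')
    have h2 : n * (m.scal c * (n⁻¹ * x * n)) * n⁻¹ = n * (n⁻¹ * x * n * m.scal c) * n⁻¹ := by rw [h]
    simpa [mul_assoc] using h2
  obtain ⟨v, hv⟩ := m.exists_δ_of_commute hω hω1
    (hz _ (hZ ω (cube_eq_one_of_mem_ellPart hω))).symm (hz _ hd).symm
  have := hz _ hg
  rw [← hv] at this ⊢
  exact m.scal_of_commute_γ this

-- If N(Q) keeps `m.dω ω` diagonal, it keeps every diagonal element diagonal, since conjugates still
-- commute with `m.scal ω` and `m.dω ω`. Radicality then puts all diagonal 3-elements of N(Q) into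
-- Q. A diagonal 3-element v outside Q could be chosen with (s - 1)v in Q; it would normalize Q and
-- so lie in Q.
include hω hω1 hQ hQm hZ hd hg in
theorem eq_monomial (hu : ∀ i, u i ∈ ellPart 3 U)
    (hN : ∀ n ∈ Subgroup.normalizer (Q : Set G), ∃ v, m.δ v = n * m.dω ω * n⁻¹) :
    Q = m.monomial 3 := by
  have hωl : ω ∈ ellPart 3 U := cube_eq_one_of_mem_ellPart hω
  -- The pattern i + 1 is injective and never 0, so its block torus is the whole 3-part of the
  -- diagonal torus.
  let A : Subgroup G := m.blockTorus 3 (fun i => i + 1) ⊓ Subgroup.normalizer (Q : Set G)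
  have hAQ : A ≤ Q := by
    refine hQ.le_of_normalized A le_top ?_ inf_le_right ?_
    · rintro ⟨_, ⟨v, hv, rfl⟩, -⟩
      obtain ⟨k, hk⟩ := m.exists_pow_eq_one hv.1
      exact ⟨k, Subtype.ext hk⟩
    · rintro n - hn _ ⟨⟨v, hv, rfl⟩, hvN⟩
      refine ⟨?_, Subgroup.mul_mem _ (Subgroup.mul_mem _ hn hvN) (Subgroup.inv_mem _ hn)⟩
      have hcomm : ∀ y : G, (∃ w, m.δ w = n⁻¹ * y * n) →
          y * (n * m.δ v * n⁻¹) = n * m.δ v * n⁻¹ * y := by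
        rintro y ⟨w, hw⟩
        have h := m.δ_comm w v
        rw [hw] at h
        have h2 : n * (n⁻¹ * y * n * m.δ v) * n⁻¹ = n * (m.δ v * (n⁻¹ * y * n)) * n⁻¹ := by rw [h]
        simpa [mul_assoc] using h2
      obtain ⟨c, hc⟩ := m.exists_scal_conj hω hω1 hQm hZ hd hg (inv_mem hn) ω
      obtain ⟨w, hw⟩ := m.exists_δ_of_commute hω hω1
        (hcomm (m.scal ω) ⟨fun _ => c, by rw [← scal_apply, hc, inv_inv]⟩)
        (hcomm (m.dω ω) (by simpa using hN _ (inv_mem hn)))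
      rw [← hw]
      refine m.δ_mem_blockTorus.2 ?_
      refine ⟨?_, fun i hi => by simp at hi, fun i k hik => by
        rw [Fin.ext (Nat.succ_injective hik)]⟩
      obtain ⟨k, hk⟩ := m.exists_pow_eq_one hv.1
      intro i
      refine ⟨k, ?_⟩
      have h1 : m.δ w ^ 3 ^ k = 1 := by rw [hw, conj_pow, hk, mul_one, mul_inv_cancel]
      rw [← map_pow, ← map_one m.δ] at h1
      exact congrFun (m.δ_injective h1) i
  have hshift : ∀ v, m.δ v ∈ Q → m.δ (fun i => v (cyc⁻¹ i)) ∈ Q := by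
    intro v hv
    have : m.δ (fun i => v (cyc⁻¹ i)) = (m.δ u * m.s) * m.δ v * (m.δ u * m.s)⁻¹ := by
      have h1 : (m.δ u * m.s) * m.δ v * (m.δ u * m.s)⁻¹ =
          m.δ u * (m.s * m.δ v * m.s⁻¹) * (m.δ u)⁻¹ := by
        simp only [_root_.mul_inv_rev, mul_assoc]
      rw [h1, s, π_conj_δ, conj_δ_comm]
    rw [this]
    exact Q.mul_mem (Q.mul_mem hg hv) (Q.inv_mem hg)
  -- The commutator of `m.δ v` with a monomial matrix depends only on its permutation: it is
  -- trivial, the inverse of (s - 1)v, or the inverse of (s² - 1)v = (s - 1)v + s(s - 1)v.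
  have hconj : ∀ v, m.δ (shiftSub v) ∈ Q → ∀ x ∈ Q, m.δ v * x * (m.δ v)⁻¹ ∈ Q := by
    intro v hv x hx
    obtain ⟨a, -, τ, hτ, rfl⟩ := hQm hx
    have h1 : m.δ v * (m.δ a * m.π τ) * (m.δ v)⁻¹ =
        m.δ (fun i => v i * (v (τ⁻¹ i))⁻¹) * (m.δ a * m.π τ) := by
      have h2 := m.π_mul_δ τ v⁻¹
      rw [map_inv] at h2
      rw [← mul_assoc, mul_assoc _ (m.π τ), h2, ← mul_assoc, ← mul_assoc, ← map_mul, ← map_mul,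
        ← map_mul]
      congr 2
      funext i
      simp only [Pi.mul_apply, Pi.inv_apply]
      rw [mul_right_comm]
    rw [h1]
    refine Q.mul_mem ?_ hx
    rcases eq_of_mem_alternatingGroup hτ with rfl | rfl | rfl
    · have : (fun i => v i * (v ((1 : Equiv.Perm (Fin 3))⁻¹ i))⁻¹) = 1 := by
        funext i
        simp
      rw [this, map_one]
      exact one_mem Q
    · rw [← inv_mem_iff, ← map_inv]
      convert hv using 2
      funext i
      simp [shiftSub]
    · have h3 := Q.mul_mem hv (hshift _ hv)
      rw [← map_mul] at h3
      rw [← inv_mem_iff, ← map_inv]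
      convert h3 using 2
      funext i
      have h4 : cyc⁻¹ (cyc⁻¹ i) = cyc i := by
        revert i
        decide
      simp only [shiftSub, Pi.mul_apply, Pi.inv_apply, inv_inv, h4]
      apply Additive.ofMul.injective
      simp only [ofMul_mul, ofMul_inv]
      abel
  have hD : ∀ v : Fin 3 → U, (∀ i, v i ∈ ellPart 3 U) → m.δ v ∈ Q := by
    intro v hv
    by_contra hvQ
    obtain ⟨k, hk⟩ := m.exists_pow_eq_one hv
    rw [← map_pow, ← map_one m.δ] at hk
    obtain ⟨w, hw, hwQ, hwS⟩ := exists_shiftSub_mem (X := {v | ∀ i, v i ∈ ellPart 3 U})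
      (S := {v | m.δ v ∈ Q}) (fun v hv i => mul_mem (hv _) (inv_mem (hv i)))
      (by simp) hv (m.δ_injective hk) hvQ
    refine hwQ (hAQ ⟨⟨w, ⟨hw, fun i hi => by simp at hi, fun i k hik => by
        rw [Fin.ext (Nat.succ_injective hik)]⟩, rfl⟩, ?_⟩)
    refine Subgroup.mem_normalizer_iff.2 fun x => ⟨hconj w hwS x, fun hx => ?_⟩
    have hwS' : m.δ (shiftSub w⁻¹) ∈ Q := by
      have : (shiftSub w⁻¹)⁻¹ = shiftSub w := by
        funext i
        simp [shiftSub, mul_comm]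
      rw [← inv_mem_iff, ← map_inv, this]
      exact hwS
    have := hconj w⁻¹ hwS' _ hx
    rw [map_inv] at this
    simpa [mul_assoc] using this
  refine le_antisymm hQm ?_
  have hs : m.s ∈ Q := (Q.mul_mem_cancel_left (hD u hu)).1 hg
  rintro _ ⟨v, hv, τ, hτ, rfl⟩
  refine Q.mul_mem (hD v hv) ?_
  rcases eq_of_mem_alternatingGroup hτ with rfl | rfl | rfl
  · simp
  · exact hs
  · rw [map_inv]
    exact Q.inv_mem hs

-- The conjugate h of `m.dω ω` has order 3 and, like `m.dω ω`, is central in Q modulo scalars. As h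
-- is not diagonal, h or h⁻¹ is δ(a)s with a₀a₁a₂ = 1, which a diagonal matrix conjugates to s.
-- Almost commuting with δ(a)s forces every diagonal element of Q to be a scalar times a power of
-- `m.dω ω`.
include hω hω1 hQ hQm hZ hd hg in
theorem conj_extra {n : G} (hn : n ∈ Subgroup.normalizer (Q : Set G))
    (hnd : ¬ ∃ v, m.δ v = n * m.dω ω * n⁻¹) : ConjIn ⊤ Q (m.extra ω) := by
  have hωl : ω ∈ ellPart 3 U := cube_eq_one_of_mem_ellPart hω
  set h := n * m.dω ω * n⁻¹ with hh
  have hhQ : h ∈ Q := (Subgroup.mem_normalizer_iff.1 hn _).1 hd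
  have hd3 : m.dω ω ^ 3 = 1 := by
    rw [dω, ← map_pow, ← map_one m.δ]
    congr 1
    funext i
    fin_cases i
    · simp
    · simpa using hω
    · simpa [hω] using pow_right_comm ω 2 3
  have hh3 : h ^ 3 = 1 := by rw [hh, conj_pow, hd3, mul_one, mul_inv_cancel]
  have hyh : ∀ y ∈ Q, ∃ c, y * h * y⁻¹ = m.scal c * h := by
    intro y hy
    have hx : n⁻¹ * y * n ∈ Q := by
      rw [Subgroup.mem_normalizer_iff.1 hn]
      simpa [mul_assoc] using hy
    obtain ⟨i, hi⟩ := m.exists_conj_dω hω (hQm hx)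
    obtain ⟨c, hc⟩ := m.exists_scal_conj hω hω1 hQm hZ hd hg hn (ω ^ i)
    refine ⟨c, ?_⟩
    have h2 : n * (n⁻¹ * y * n * m.dω ω * (n⁻¹ * y * n)⁻¹) * n⁻¹ =
        n * (m.scal (ω ^ i) * m.dω ω) * n⁻¹ := by rw [hi]
    rw [hc, hh]
    simpa [mul_assoc] using h2
  obtain ⟨a, ha, hka⟩ : ∃ a : Fin 3 → U, (h = m.δ a * m.s ∨ h⁻¹ = m.δ a * m.s) ∧ True := by
    rcases m.monomial_cases (hQm hhQ) with h1 | ⟨a, -, h1⟩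
    · exact absurd (h1.imp fun _ h => h.2) hnd
    · exact ⟨a, h1, trivial⟩
  have hkQ : m.δ a * m.s ∈ Q := by
    rcases ha with h1 | h1
    · exact h1 ▸ hhQ
    · exact h1 ▸ Q.inv_mem hhQ
  have hk3 : (m.δ a * m.s) ^ 3 = 1 := by
    rcases ha with h1 | h1
    · rw [← h1, hh3]
    · rw [← h1, inv_pow, hh3, inv_one]
  have hyk : ∀ y ∈ Q, ∃ c, y * (m.δ a * m.s) * y⁻¹ = m.scal c * (m.δ a * m.s) := by
    intro y hy
    obtain ⟨c, hc⟩ := hyh y hy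
    rcases ha with h1 | h1
    · exact ⟨c, by rw [← h1, hc]⟩
    · refine ⟨c⁻¹, ?_⟩
      have h2 : y * h⁻¹ * y⁻¹ = (y * h * y⁻¹)⁻¹ := by simp [mul_assoc]
      rw [← h1, h2, hc, _root_.mul_inv_rev, ← map_inv, m.scal_comm c⁻¹ (hQm (Q.inv_mem hhQ))]
  have hdiag : ∀ v, m.δ v ∈ Q → ∃ c ∈ ellPart 3 U, ∃ i : ℕ, m.δ v = m.scal c * m.dω ω ^ i := by
    intro v hv
    obtain ⟨c, hc⟩ := hyk _ hv
    rw [δ_conj_s, ← mul_assoc, scal_apply, ← map_mul] at hc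
    have h1 := m.δ_injective (mul_right_cancel hc)
    -- Going once around the cycle gives c³ = 1, so consecutive coordinates differ by a power of ω.
    have h2 : ∀ i, v i = c * v (cyc⁻¹ i) := by
      intro i
      have := congrFun h1 i
      simp only [Pi.mul_apply] at this
      rw [mul_right_comm] at this
      exact mul_inv_eq_iff_eq_mul.1 (mul_right_cancel this)
    have h20 := h2 0
    have h21 := h2 1
    have h22 := h2 2
    rw [cyc_inv_zero] at h20
    rw [cyc_inv_one] at h21
    rw [cyc_inv_two, h21] at h22
    have hc3 : c ^ 3 = 1 := by
      rw [h22] at h20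
      have h3 : c ^ 3 * v 0 = 1 * v 0 := by
        rw [one_mul]
        nth_rw 2 [h20]
        rw [pow_succ, pow_two]
        simp only [mul_assoc]
      exact mul_right_cancel h3
    obtain ⟨i, hi⟩ := m.cube_root hω hω1 hc3
    refine ⟨v 0, m.ellPart_of_mem hQ.isPGroup hv 0, i, ?_⟩
    rw [dω, scal_apply, ← map_pow, ← map_mul]
    congr 1
    funext k
    fin_cases k
    · simp
    · simp [h21, hi, mul_comm]
    · simp only [Fin.reduceFinMk, Pi.mul_apply, Pi.pow_apply, Matrix.cons_val]
      rw [h22, hi, ← mul_assoc, ← pow_two, mul_comm, ← pow_mul, ← pow_mul, mul_comm i]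
  obtain ⟨t, ht⟩ := m.exists_conj_eq (u := a) (v := 1) (by
    rw [m.δ_mul_s_pow_three_eq_one hk3]
    simp)
  rw [map_one, one_mul] at ht
  have hdl : ∀ v, m.δ v ∈ Q → m.δ v ∈ m.extra ω := by
    intro v hv
    obtain ⟨c, hc, i, hci⟩ := hdiag v hv
    rw [hci]
    refine mul_mem (Subgroup.mem_sup_left ⟨c, hc, rfl⟩) (pow_mem ?_ i)
    exact Subgroup.mem_sup_right (Subgroup.mem_sup_left (Subgroup.mem_zpowers _))
  have hsl : m.s ∈ m.extra ω :=
    Subgroup.mem_sup_right (Subgroup.mem_sup_right (Subgroup.mem_zpowers _))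
  refine ⟨m.δ t, trivial, le_antisymm ?_ ?_⟩
  · rintro _ ⟨x, hx, rfl⟩
    change m.δ t * x * (m.δ t)⁻¹ ∈ _
    obtain ⟨v, hv, h | h | h⟩ := m.exists_diag_mul hQm hkQ hx
    · rw [h, conj_δ_comm]
      exact hdl v hv
    · have : m.δ t * x * (m.δ t)⁻¹ = (m.δ t * m.δ v * (m.δ t)⁻¹) *
          (m.δ t * (m.δ a * m.s) * (m.δ t)⁻¹) := by
        rw [h]
        simp only [mul_assoc, inv_mul_cancel_left]
      rw [this, conj_δ_comm, ht]
      exact mul_mem (hdl v hv) hsl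
    · have : m.δ t * x * (m.δ t)⁻¹ = (m.δ t * m.δ v * (m.δ t)⁻¹) *
          (m.δ t * (m.δ a * m.s) * (m.δ t)⁻¹)⁻¹ := by
        rw [h]
        simp only [_root_.mul_inv_rev, inv_inv, mul_assoc, inv_mul_cancel_left]
      rw [this, conj_δ_comm, ht]
      exact mul_mem (hdl v hv) (inv_mem hsl)
  · refine sup_le ?_ (sup_le (Subgroup.zpowers_le.2 ?_) (Subgroup.zpowers_le.2 ?_))
    · rintro _ ⟨c, hc, rfl⟩
      exact ⟨m.scal c, hZ c hc, m.conj_δ_comm t _⟩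
    · exact ⟨m.dω ω, hd, m.conj_δ_comm t _⟩
    · exact ⟨_, hkQ, ht⟩

end Nonscalar

/-- The monomial radical `3`-subgroups. -/
theorem radical_monomial_cases [Finite U] [IsCyclic U] {ω : U} (hω : ω ^ 3 = 1) (hω1 : ω ≠ 1)
    {Q : Subgroup G} (hQ : RadicalIn 3 ⊤ Q) (hQm : Q ≤ m.monomial 3) :
    (∃ Q', ConjIn ⊤ Q Q' ∧ ∀ x ∈ Q', ∃ v, m.δ v = x) ∨
    (∃ c ∈ ellPart 3 U, (∀ x ∈ ellPart 3 U, x ∈ Subgroup.zpowers c) ∧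
        ConjIn ⊤ Q (Subgroup.zpowers (m.γ c))) ∨
    ConjIn ⊤ Q (m.extra ω) ∨ Q = m.monomial 3 := by
  by_cases hdiag : ∀ x ∈ Q, ∃ v, m.δ v = x
  · exact Or.inl ⟨Q, conjIn_refl _ _, hdiag⟩
  push Not at hdiag
  obtain ⟨x, hx, hxd⟩ := hdiag
  obtain ⟨u, hu, hg⟩ : ∃ u : Fin 3 → U, (∀ i, u i ∈ ellPart 3 U) ∧ m.δ u * m.s ∈ Q := by
    rcases m.monomial_cases (hQm hx) with ⟨v, -, hv⟩ | ⟨u, hu, h | h⟩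
    · exact absurd hv (hxd v)
    · exact ⟨u, hu, h ▸ hx⟩
    · exact ⟨u, hu, h ▸ Q.inv_mem hx⟩
  by_cases hsc : ∀ v, m.δ v ∈ Q → ∃ c, m.scal c = m.δ v
  · rcases m.conj_of_scalar hω hω1 hQ.isPGroup hQm hu hg hsc with h | h
    · exact Or.inl h
    · exact Or.inr (Or.inl h)
  push Not at hsc
  obtain ⟨v, hv, hvs⟩ := hsc
  have hXs : ∀ v ∈ {v | m.δ v ∈ Q}, shiftSub v ∈ {v | m.δ v ∈ Q} := by
    intro v hv
    have : m.δ (shiftSub v) = (m.δ u * m.s) * m.δ v * (m.δ u * m.s)⁻¹ * (m.δ v)⁻¹ := by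
      have h1 : (m.δ u * m.s) * m.δ v * (m.δ u * m.s)⁻¹ =
          m.δ u * (m.s * m.δ v * m.s⁻¹) * (m.δ u)⁻¹ := by
        simp only [_root_.mul_inv_rev, mul_assoc]
      rw [h1, s, π_conj_δ, conj_δ_comm, ← map_inv, ← map_mul]
      rfl
    change m.δ (shiftSub v) ∈ Q
    rw [this]
    exact Q.mul_mem (Q.mul_mem (Q.mul_mem hg hv) (Q.inv_mem hg)) (Q.inv_mem hv)
  obtain ⟨k, hk⟩ := m.exists_pow_eq_one (m.ellPart_of_mem hQ.isPGroup hv)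
  rw [← map_pow, ← map_one m.δ] at hk
  have hk := m.δ_injective hk
  -- A nontrivial element fixed by the shift, that is, a nontrivial scalar of Q.
  obtain ⟨a, haQ, ha1, haS⟩ := exists_shiftSub_mem (S := {1}) hXs rfl hv hk (fun h => hvs 1 (by
    rw [Set.mem_singleton_iff.1 h, map_one, map_one]))
  -- A non-scalar element whose consecutive coordinates have a constant ratio c. Then c is a
  -- nontrivial cube root of unity, and b divided by its coordinate 0 is diag(1, c⁻¹, c⁻²).
  obtain ⟨b, hbQ, hb1, hbS⟩ := exists_shiftSub_mem
    (S := {v | ∃ c, m.scal c = m.δ v}) hXs ⟨1, by simp⟩ hv hk (by simpa using hvs)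
  have hac := eq_const_of_shiftSub_eq_one haS
  have hZ : ∀ c ∈ ellPart 3 U, m.scal c ∈ Q := by
    intro c hc
    refine m.scal_mem hQ hQm (c := a 0) ?_ ?_ hc
    · have : m.scal (a 0) = m.δ a := by
        rw [scal_apply]
        congr 1
        funext i
        exact (hac i).symm
      rw [this]
      exact haQ
    · intro h
      apply ha1
      funext i
      rw [hac i, h, Pi.one_apply]
  obtain ⟨c, hc⟩ := hbS
  have hc' := congrFun (m.δ_injective (hc.symm.trans (m.scal_apply c)))
  simp only [shiftSub] at hc'
  have h0 := hc' 0
  have h1 := hc' 1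
  have h2 := hc' 2
  rw [cyc_inv_zero] at h0
  rw [cyc_inv_one, mul_inv_eq_iff_eq_mul] at h1
  rw [cyc_inv_two, mul_inv_eq_iff_eq_mul] at h2
  have hc3 : c ^ 3 = 1 := by
    rw [mul_inv_eq_iff_eq_mul, h1, h2] at h0
    have : c ^ 3 * b 2 = 1 * b 2 := by
      rw [one_mul]
      nth_rw 2 [h0]
      rw [pow_succ, pow_two]
      simp only [mul_assoc]
    exact mul_right_cancel this
  have hc1 : c ≠ 1 := by
    rintro rfl
    apply hb1
    refine ⟨b 2, ?_⟩
    rw [scal_apply]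
    congr 1
    funext i
    fin_cases i
    · simp [h1, h2]
    · simp [h2]
    · rfl
  have hωl : ω ∈ ellPart 3 U := cube_eq_one_of_mem_ellPart hω
  have hd : m.dω ω ∈ Q := by
    obtain ⟨i, hi⟩ := m.cube_root hc3 hc1 hω
    have hdc : m.dω c⁻¹ ∈ Q := by
      have h3 : m.dω c⁻¹ = m.scal (b 0)⁻¹ * m.δ b := by
        rw [dω, scal_apply, ← map_mul]
        congr 1
        funext k
        fin_cases k
        · simp
        · simp [h1]
        · simp only [Fin.reduceFinMk, Matrix.cons_val, Pi.mul_apply, h1, h2]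
          apply Additive.ofMul.injective
          simp only [ofMul_mul, ofMul_inv, ofMul_pow]
          abel
      rw [h3]
      exact Q.mul_mem (hZ _ (inv_mem (m.ellPart_of_mem hQ.isPGroup hbQ 0))) hbQ
    have h4 : m.dω ω = (m.dω c⁻¹)⁻¹ ^ i := by
      rw [dω, dω, ← map_inv, ← map_pow, hi]
      congr 1
      funext k
      fin_cases k
      · simp
      · simp
      · simp [← pow_mul, mul_comm]
    rw [h4]
    exact Q.pow_mem (Q.inv_mem hdc) i
  by_cases hN : ∀ n ∈ Subgroup.normalizer (Q : Set G), ∃ v, m.δ v = n * m.dω ω * n⁻¹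
  · exact Or.inr (Or.inr (Or.inr (m.eq_monomial hω hω1 hQ hQm hZ hd hg hu hN)))
  · push Not at hN
    obtain ⟨n, hn, hnd⟩ := hN
    exact Or.inr (Or.inr (Or.inl (m.conj_extra hω hω1 hQ hQm hZ hd hg hn (by
      rintro ⟨v, hv⟩; exact hnd v hv))))

end TorusModel

/-! ### Conjugacy of the cyclic non-diagonal 3-groups -/

namespace TorusModel

set_option linter.unusedSectionVars false

variable {G B U : Type*} [Group G] [Ring B] [StarRing B] [CommGroup U] (m : TorusModel G B U)

theorem conjIn_zpowers_γ {u : Fin 3 → U} :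
    ConjIn ⊤ (Subgroup.zpowers (m.δ u * m.s)) (Subgroup.zpowers (m.γ (u 0 * u 1 * u 2))) := by
  obtain ⟨t, ht⟩ := m.exists_conj_eq (u := u) (v := ![u 0 * u 1 * u 2, 1, 1]) (by simp)
  refine ⟨m.δ t, trivial, ?_⟩
  rw [MonoidHom.map_zpowers]
  congr 1

/-- A transposition turns the 3-cycle into its inverse; inverting the conjugate of γ(c) restores the
cycle and replaces c by c⁻¹. -/
theorem conjIn_zpowers_γ_inv (c : U) :
    ConjIn ⊤ (Subgroup.zpowers (m.γ c)) (Subgroup.zpowers (m.γ c⁻¹)) := by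
  have h : ConjIn ⊤ (Subgroup.zpowers (m.γ c))
      (Subgroup.zpowers (m.δ ![1, c⁻¹, 1] * m.s)) := by
    refine ⟨m.π (Equiv.swap 1 2), trivial, ?_⟩
    rw [MonoidHom.map_zpowers, ← Subgroup.zpowers_inv]
    congr 1
    change (m.π (Equiv.swap 1 2) * m.γ c * (m.π (Equiv.swap 1 2))⁻¹)⁻¹ = _
    have h1 : (m.π (Equiv.swap 1 2) * m.γ c * (m.π (Equiv.swap 1 2))⁻¹) =
        (m.π (Equiv.swap 1 2) * m.δ ![c, 1, 1] * (m.π (Equiv.swap 1 2))⁻¹) *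
        m.π (Equiv.swap 1 2 * cyc * (Equiv.swap 1 2)⁻¹) := by
      rw [map_mul, map_mul, map_inv, γ, s]
      simp only [mul_assoc, inv_mul_cancel_left]
    rw [h1, show (Equiv.swap 1 2 * cyc * (Equiv.swap 1 2)⁻¹ : Equiv.Perm (Fin 3)) = cyc⁻¹ by decide,
      π_conj_δ, _root_.mul_inv_rev, map_inv, inv_inv, ← map_inv m.δ]
    change m.s * _ = _
    rw [s_mul_δ]
    congr 2
    funext i
    fin_cases i
    · simp [cyc_inv_zero, show (Equiv.swap (1 : Fin 3) 2) 2 = 1 by decide]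
    · simp [cyc_inv_one, show (Equiv.swap (1 : Fin 3) 2) 0 = 0 by decide]
    · simp [cyc_inv_two, show (Equiv.swap (1 : Fin 3) 2) 1 = 2 by decide]
  refine conjIn_trans h ?_
  simpa using m.conjIn_zpowers_γ (u := ![1, c⁻¹, 1])

/-- Because γ(c)³ = c, the power γ(c)^(3t+1) equals c^t γ(c), whose coordinates have product
c^(3t+1). By hypothesis it generates the same group as γ(c). -/
theorem conjIn_zpowers_γ_of_pow {c : U} {t : ℤ} (h : c ∈ Subgroup.zpowers (c ^ (3 * t + 1))) :
    ConjIn ⊤ (Subgroup.zpowers (m.γ c)) (Subgroup.zpowers (m.γ (c ^ (3 * t + 1)))) := by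
  have h1 : m.γ c ^ (3 * t + 1) = m.δ ((fun _ => c ^ t) * ![c, 1, 1]) * m.s := by
    rw [_root_.zpow_add, zpow_one, _root_.zpow_mul, map_mul, mul_assoc]
    congr 1
    rw [← scal_apply, map_zpow, ← γ_pow_three, zpow_ofNat]
  have h2 : Subgroup.zpowers (m.γ c) =
      Subgroup.zpowers (m.δ ((fun _ => c ^ t) * ![c, 1, 1]) * m.s) := by
    rw [← h1]
    apply le_antisymm
    · have h3 : m.scal c ∈ Subgroup.zpowers (m.γ c ^ (3 * t + 1)) := by
        have h4 : m.scal (c ^ (3 * t + 1)) = (m.γ c ^ (3 * t + 1)) ^ 3 := by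
          rw [map_zpow, ← γ_pow_three, ← zpow_natCast, ← zpow_natCast, ← _root_.zpow_mul, ← _root_.zpow_mul,
            mul_comm]
        obtain ⟨n, hn⟩ := Subgroup.mem_zpowers_iff.1 h
        have h6 := Subgroup.zpow_mem _ (Subgroup.pow_mem _
          (Subgroup.mem_zpowers (m.γ c ^ (3 * t + 1))) 3) n
        rwa [← h4, ← map_zpow, hn] at h6
      rw [Subgroup.zpowers_le]
      have h5 : m.γ c = (m.scal c ^ t)⁻¹ * m.γ c ^ (3 * t + 1) := by
        rw [_root_.zpow_add, zpow_one, _root_.zpow_mul, ← γ_pow_three, zpow_ofNat]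
        exact (inv_mul_cancel_left _ _).symm
      have h6 := Subgroup.mul_mem _ (Subgroup.inv_mem _ (Subgroup.zpow_mem _ h3 t))
        (Subgroup.mem_zpowers (m.γ c ^ (3 * t + 1)))
      rwa [← h5] at h6
    · rw [Subgroup.zpowers_le]
      exact Subgroup.zpow_mem _ (Subgroup.mem_zpowers _) _
  rw [h2]
  have := m.conjIn_zpowers_γ (u := (fun _ => c ^ t) * ![c, 1, 1])
  have h6 : ((fun _ => c ^ t) * ![c, 1, 1] : Fin 3 → U) 0 *
      ((fun _ => c ^ t) * ![c, 1, 1] : Fin 3 → U) 1 *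
      ((fun _ => c ^ t) * ![c, 1, 1] : Fin 3 → U) 2 = c ^ (3 * t + 1) := by
    simp only [Pi.mul_apply, Matrix.cons_val, mul_one]
    rw [← _root_.zpow_add_one, ← _root_.zpow_add, ← _root_.zpow_add]
    congr 1
    ring
  rwa [h6] at this

/-- With c' = c^k, both generating, 3 does not divide k. If k ≡ 1 mod 3 a power of γ(c) does the
job; if k ≡ 2, inversion reduces to that case. -/
theorem conjIn_zpowers_γ_of_generates {c c' : U} {ω : U} (hω : ω ^ 3 = 1) (hω1 : ω ≠ 1)
    (hc' : c' ∈ ellPart 3 U)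
    (hcg : ∀ x ∈ ellPart 3 U, x ∈ Subgroup.zpowers c) (hc : c ∈ ellPart 3 U)
    (hcg' : ∀ x ∈ ellPart 3 U, x ∈ Subgroup.zpowers c') :
    ConjIn ⊤ (Subgroup.zpowers (m.γ c)) (Subgroup.zpowers (m.γ c')) := by
  obtain ⟨k, rfl⟩ := Subgroup.mem_zpowers_iff.1 (hcg c' hc')
  have hk : k % 3 = 0 ∨ k % 3 = 1 ∨ k % 3 = 2 := by omega
  rcases hk with hk | hk | hk
  · exfalso
    obtain ⟨t, rfl⟩ := Int.dvd_of_emod_eq_zero hk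
    obtain ⟨n, hn⟩ := Subgroup.mem_zpowers_iff.1 (hcg' c hc)
    obtain ⟨r, hr⟩ := Subgroup.mem_zpowers_iff.1 (hcg ω (cube_eq_one_of_mem_ellPart hω))
    obtain ⟨N, hN⟩ := mem_ellPart.1 hc
    have h1 : c ^ (3 * t * n - 1) = 1 := by
      rw [_root_.zpow_sub, _root_.zpow_mul, hn, zpow_one, mul_inv_cancel]
    have h2 := orderOf_dvd_iff_zpow_eq_one.2 h1
    obtain ⟨j, -, hj⟩ := (Nat.dvd_prime_pow Nat.prime_three).1 (orderOf_dvd_of_pow_eq_one hN)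
    rcases j with - | j
    · rw [pow_zero, orderOf_eq_one_iff] at hj
      rw [hj, _root_.one_zpow] at hr
      exact hω1 hr.symm
    · rw [hj, pow_succ] at h2
      push_cast at h2
      have h3 : (3 : ℤ) ∣ 3 * t * n - 1 := (Dvd.intro_left _ rfl).trans h2
      rw [mul_assoc] at h3
      omega
  · have hkt : k = 3 * (k / 3) + 1 := by omega
    rw [hkt] at hcg' ⊢
    exact m.conjIn_zpowers_γ_of_pow (hcg' c hc)
  · refine conjIn_trans (m.conjIn_zpowers_γ_inv c) ?_
    have hkt : k = - (3 * (- (k / 3) - 1) + 1) := by omega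
    have h2 : c ^ k = c⁻¹ ^ (3 * (- (k / 3) - 1) + 1) := by
      rw [_root_.inv_zpow', ← hkt]
    rw [h2] at hcg' ⊢
    exact m.conjIn_zpowers_γ_of_pow (hcg' _ (inv_mem hc))

/-- A cyclic monomial `3`-group of the largest possible order. -/
theorem conjIn_zpowers_γ_of_isCyclic [Finite U] [IsCyclic U] {ω : U} (hω : ω ^ 3 = 1)
    (hω1 : ω ≠ 1) {S : Subgroup G} (hS : IsCyclic S) (hSm : S ≤ m.monomial 3)
    (hSc : ∃ x ∈ S, x ^ Nat.card (ellPart 3 U) ≠ 1) {c : U} (hc : c ∈ ellPart 3 U)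
    (hcg : ∀ x ∈ ellPart 3 U, x ∈ Subgroup.zpowers c) :
    ConjIn ⊤ S (Subgroup.zpowers (m.γ c)) := by
  obtain ⟨x, hxS, hx⟩ := hSc
  obtain ⟨⟨y, hyS⟩, hy⟩ := hS
  have hSy : S = Subgroup.zpowers y := by
    apply le_antisymm
    · intro z hz
      obtain ⟨k, hk⟩ := Subgroup.mem_zpowers_iff.1 (hy ⟨z, hz⟩)
      exact Subgroup.mem_zpowers_iff.2 ⟨k, congrArg Subtype.val hk⟩
    · exact Subgroup.zpowers_le.2 hyS
  have hpow : ∀ b ∈ ellPart 3 U, b ^ Nat.card (ellPart 3 U) = 1 := fun b hb =>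
    congrArg Subtype.val (pow_card_eq_one' (x := (⟨b, hb⟩ : ellPart 3 U)))
  have hxy : ∀ z, y ∈ Subgroup.zpowers z → z ^ Nat.card (ellPart 3 U) ≠ 1 := by
    intro z hz h
    rw [hSy] at hxS
    obtain ⟨k, rfl⟩ := Subgroup.mem_zpowers_iff.1 ((Subgroup.zpowers_le.2 hz) hxS)
    apply hx
    rw [← zpow_natCast, ← _root_.zpow_mul, mul_comm, _root_.zpow_mul, zpow_natCast, h, _root_.one_zpow]
  obtain ⟨a, ha, hya⟩ : ∃ a : Fin 3 → U, (∀ i, a i ∈ ellPart 3 U) ∧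
      Subgroup.zpowers y = Subgroup.zpowers (m.δ a * m.s) := by
    -- A diagonal generator is excluded, since its order would divide the order of the 3-part of U.
    rcases m.monomial_cases (hSm hyS) with ⟨v, hv, hvy⟩ | ⟨a, ha, h | h⟩
    · exfalso
      refine hxy y (Subgroup.mem_zpowers y) ?_
      rw [← hvy, ← map_pow, ← map_one m.δ]
      congr 1
      funext i
      exact hpow _ (hv i)
    · exact ⟨a, ha, by rw [h]⟩
    · exact ⟨a, ha, by rw [← h, Subgroup.zpowers_inv]⟩
  rw [hSy, hya]
  refine conjIn_trans m.conjIn_zpowers_γ ?_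
  have hprod : a 0 * a 1 * a 2 ∈ ellPart 3 U := mul_mem (mul_mem (ha 0) (ha 1)) (ha 2)
  refine m.conjIn_zpowers_γ_of_generates hω hω1 hc ?_ hprod hcg
  rcases exists_cube_or_generates hprod with ⟨b, hb, hb3⟩ | h
  -- If the product is b³ and the 3-part of U has order 3r, the 3r-th power of the generator is the
  -- scalar b^(3r) = 1, against `hSc`.
  · exfalso
    refine hxy _ (hya ▸ Subgroup.mem_zpowers y) ?_
    have h3 : 3 ∣ Nat.card (ellPart 3 U) := by
      have h1 : orderOf (⟨ω, cube_eq_one_of_mem_ellPart hω⟩ : ellPart 3 U) = 3 :=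
        orderOf_eq_prime (Subtype.ext hω) (fun h => hω1 (congrArg Subtype.val h))
      have h2 := orderOf_dvd_natCard (⟨ω, cube_eq_one_of_mem_ellPart hω⟩ : ellPart 3 U)
      rwa [h1] at h2
    obtain ⟨r, hr⟩ := h3
    have h4 := hpow b hb
    rw [hr] at h4 ⊢
    rw [pow_mul, pow_three, ← hb3, ← map_pow, ← pow_mul, h4, map_one]
  · exact h

end TorusModel

/-! ### Orders, fixed vectors and non-conjugacy -/

theorem card_blockSub {ℓ : ℕ} {U : Type*} [CommGroup U] {b : Fin 3 → ℕ} {k : ℕ}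
    (rep : Fin k → Fin 3) (cls : Fin 3 → Fin k) (h1 : ∀ j, cls (rep j) = j)
    (h2 : ∀ j, b (rep j) ≠ 0) (h3 : ∀ i, b i ≠ 0 → b (rep (cls i)) = b i)
    (h4 : ∀ i i', b i = b i' → b i ≠ 0 → cls i = cls i') :
    Nat.card (blockSub ℓ U b) = Nat.card (ellPart ℓ U) ^ k := by
  classical
  have e : blockSub ℓ U b ≃ (Fin k → ellPart ℓ U) :=
    { toFun := fun u j => ⟨u.1 (rep j), u.2.1 _⟩
      invFun := fun f => ⟨fun i => if b i = 0 then 1 else (f (cls i) : U), by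
        refine ⟨fun i => ?_, fun i hi => if_pos hi, fun i i' hii' => ?_⟩
        · dsimp only
          split_ifs
          · exact one_mem _
          · exact (f _).2
        · by_cases hi : b i = 0
          · simp [hi, ← hii']
          · simp only [if_neg hi, ← hii', h4 i i' hii' hi]⟩
      left_inv := by
        rintro ⟨u, hu⟩
        ext i
        by_cases hi : b i = 0
        · simp [hi, hu.2.1 i hi]
        · simp [hi, hu.2.2 _ _ (h3 i hi)]
      right_inv := by
        intro f
        funext j
        ext
        simp [h2, h1] }
  rw [Nat.card_congr e, Nat.card_fun, Nat.card_fin]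

namespace TorusModel

set_option linter.unusedSectionVars false

variable {G B U : Type*} [Group G] [Ring B] [StarRing B] [CommGroup U] (m : TorusModel G B U)

theorem card_blockTorus {ℓ : ℕ} {b : Fin 3 → ℕ} :
    Nat.card (m.blockTorus ℓ b) = Nat.card (blockSub ℓ U b) :=
  (Nat.card_congr (Subgroup.equivMapOfInjective _ _ m.δ_injective).toEquiv).symm

theorem card_monomial [Nontrivial B] {ℓ : ℕ} :
    Nat.card (m.monomial ℓ) = 3 * Nat.card (ellPart ℓ U) ^ 3 := by
  have e : (Fin 3 → ellPart ℓ U) × alternatingGroup (Fin 3) ≃ m.monomial ℓ := by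
    refine Equiv.ofBijective (fun p => ⟨m.δ (fun i => p.1 i) * m.π p.2,
      ⟨_, fun i => (p.1 i).2, _, p.2.2, rfl⟩⟩) ⟨?_, ?_⟩
    · rintro ⟨u, σ⟩ ⟨v, τ⟩ h
      obtain ⟨h1, h2⟩ := m.δ_mul_π_inj inferInstance (congrArg Subtype.val h)
      ext i
      · exact congrFun h1 i
      · simp only at h2
        rw [h2]
    · rintro ⟨_, u, hu, τ, hτ, rfl⟩
      exact ⟨⟨fun i => ⟨u i, hu i⟩, ⟨τ, hτ⟩⟩, rfl⟩
  have h3 : Nat.card (alternatingGroup (Fin 3)) = 3 := by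
    have := two_mul_nat_card_alternatingGroup (α := Fin 3)
    rw [Nat.card_perm, Nat.card_fin] at this
    simp only [Nat.factorial] at this
    omega
  rw [← Nat.card_congr e, Nat.card_prod, Nat.card_fun, Nat.card_fin, h3, mul_comm]

/-- The vectors fixed by a subgroup. -/
def fixed (A : Subgroup G) : Set (Fin 3 → B) := {x | ∀ g ∈ A, m.ι g *ᵥ x = x}

theorem card_fixed_eq {A A' : Subgroup G} (h : ConjIn ⊤ A A') :
    Nat.card (m.fixed A) = Nat.card (m.fixed A') := by
  obtain ⟨k, -, rfl⟩ := h
  have hk : ∀ x, m.ι k⁻¹ *ᵥ (m.ι k *ᵥ x) = x := fun x => by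
    rw [mulVec_mulVec, ← map_mul, inv_mul_cancel, map_one, one_mulVec]
  have hk' : ∀ x, m.ι k *ᵥ (m.ι k⁻¹ *ᵥ x) = x := fun x => by
    rw [mulVec_mulVec, ← map_mul, mul_inv_cancel, map_one, one_mulVec]
  refine Nat.card_congr
    { toFun := fun x => ⟨m.ι k *ᵥ x.1, ?_⟩
      invFun := fun x => ⟨m.ι k⁻¹ *ᵥ x.1, ?_⟩
      left_inv := fun x => Subtype.ext (hk _)
      right_inv := fun x => Subtype.ext (hk' _) }
  · rintro _ ⟨g, hg, rfl⟩
    change m.ι (k * g * k⁻¹) *ᵥ _ = _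
    rw [map_mul, ← mulVec_mulVec, hk, map_mul, ← mulVec_mulVec, x.2 g hg]
  · intro g hg
    have := x.2 _ ⟨g, hg, rfl⟩
    change m.ι (k * g * k⁻¹) *ᵥ _ = _ at this
    rw [map_mul, map_mul, ← mulVec_mulVec, ← mulVec_mulVec] at this
    rw [← hk (m.ι g *ᵥ _), this]

/-- A nontrivial u has no nonzero fixed quaternion, as such a quaternion would intertwine u with 1.
So exactly the coordinates labelled 0 contribute. -/
theorem card_fixed_blockTorus {ℓ : ℕ} (hU : ∃ u ∈ ellPart ℓ U, u ≠ 1) (b : Fin 3 → ℕ) :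
    Nat.card (m.fixed (m.blockTorus ℓ b)) =
      Nat.card B ^ (Finset.univ.filter fun i => b i = 0).card := by
  classical
  obtain ⟨u, hu, hu1⟩ := hU
  have hu2 : u ≠ (1 : U)⁻¹ := by rwa [inv_one]
  have hfix : ∀ x, x ∈ m.fixed (m.blockTorus ℓ b) ↔ ∀ i, b i ≠ 0 → x i = 0 := by
    intro x
    constructor
    · intro hx i hi
      have hmem : (fun k => if b k = 0 then 1 else u) ∈ blockSub ℓ U b := by
        refine ⟨fun k => ?_, fun k hk => if_pos hk, fun k l hkl => by simp only [hkl]⟩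
        dsimp only
        split_ifs
        · exact one_mem _
        · exact hu
      have := congrFun (hx _ (m.δ_mem_blockTorus.2 hmem)) i
      rw [ι_δ, mulVec_diagonal, if_neg hi] at this
      refine m.eq_zero_of_intertwine u 1 _ ?_ hu1 hu2
      rw [this, map_one, mul_one]
    · rintro hx _ ⟨v, hv, rfl⟩
      rw [ι_δ]
      funext i
      rw [mulVec_diagonal]
      by_cases hi : b i = 0
      · rw [hv.2.1 i hi, map_one, one_mul]
      · rw [hx i hi, mul_zero]
  have e : m.fixed (m.blockTorus ℓ b) ≃ ((Finset.univ.filter fun i => b i = 0) → B) :=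
    { toFun := fun x i => x.1 i
      invFun := fun y => ⟨fun i => if h : b i = 0 then y ⟨i, by simpa using h⟩ else 0,
        (hfix _).2 fun i hi => dif_neg hi⟩
      left_inv := by
        rintro ⟨x, hx⟩
        ext i
        by_cases hi : b i = 0
        · simp [hi]
        · simp [hi, (hfix x).1 hx i hi]
      right_inv := by
        intro y
        funext ⟨i, hi⟩
        have : b i = 0 := by simpa using hi
        simp [this] }
  rw [Nat.card_congr e, Nat.card_fun, Nat.card_eq_finsetCard]

/-- The subgroup `blockTorus` for the pattern `blk`. -/
def blkTorus (ℓ r₁ r₂ r₃ : ℕ) : Subgroup G := m.blockTorus ℓ fun i => blk r₁ r₂ r₃ i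

/-- The order detects the number of nontrivial blocks and the fixed vectors detect the number of
trivial coordinates; together these distinguish the six patterns. -/
theorem pairwise_not_conj [Finite U] [Finite B] [Nontrivial B] {ℓ : ℕ}
    (hU : ∃ u ∈ ellPart ℓ U, u ≠ 1) :
    [m.blkTorus ℓ 1 0 0, m.blkTorus ℓ 2 0 0, m.blkTorus ℓ 3 0 0, m.blkTorus ℓ 1 1 0,
      m.blkTorus ℓ 2 1 0, m.blkTorus ℓ 1 1 1].Pairwise fun A A' => ¬ ConjIn ⊤ A A' := by
  have hN : 1 < Nat.card (ellPart ℓ U) := by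
    obtain ⟨u, hu, hu1⟩ := hU
    have : Nontrivial (ellPart ℓ U) := ⟨⟨u, hu⟩, 1, fun h => hu1 (congrArg Subtype.val h)⟩
    exact Finite.one_lt_card
  have hB : 1 < Nat.card B := Finite.one_lt_card
  have c1 : Nat.card (m.blkTorus ℓ 1 0 0) = Nat.card (ellPart ℓ U) ^ 1 :=
    m.card_blockTorus.trans (card_blockSub ![0] (fun _ => 0) (by decide) (by decide) (by decide)
      (by decide))
  have c2 : Nat.card (m.blkTorus ℓ 2 0 0) = Nat.card (ellPart ℓ U) ^ 1 :=
    m.card_blockTorus.trans (card_blockSub ![0] (fun _ => 0) (by decide) (by decide) (by decide)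
      (by decide))
  have c3 : Nat.card (m.blkTorus ℓ 3 0 0) = Nat.card (ellPart ℓ U) ^ 1 :=
    m.card_blockTorus.trans (card_blockSub ![0] (fun _ => 0) (by decide) (by decide) (by decide)
      (by decide))
  have c4 : Nat.card (m.blkTorus ℓ 1 1 0) = Nat.card (ellPart ℓ U) ^ 2 :=
    m.card_blockTorus.trans (card_blockSub ![0, 1] ![0, 1, 0] (by decide) (by decide) (by decide)
      (by decide))
  have c5 : Nat.card (m.blkTorus ℓ 2 1 0) = Nat.card (ellPart ℓ U) ^ 2 :=
    m.card_blockTorus.trans (card_blockSub ![0, 2] ![0, 0, 1] (by decide) (by decide) (by decide)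
      (by decide))
  have c6 : Nat.card (m.blkTorus ℓ 1 1 1) = Nat.card (ellPart ℓ U) ^ 3 :=
    m.card_blockTorus.trans (card_blockSub ![0, 1, 2] ![0, 1, 2] (by decide) (by decide)
      (by decide) (by decide))
  have f1 : Nat.card (m.fixed (m.blkTorus ℓ 1 0 0)) = Nat.card B ^ 2 :=
    m.card_fixed_blockTorus hU _
  have f2 : Nat.card (m.fixed (m.blkTorus ℓ 2 0 0)) = Nat.card B ^ 1 :=
    m.card_fixed_blockTorus hU _
  have f3 : Nat.card (m.fixed (m.blkTorus ℓ 3 0 0)) = Nat.card B ^ 0 :=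
    m.card_fixed_blockTorus hU _
  have f4 : Nat.card (m.fixed (m.blkTorus ℓ 1 1 0)) = Nat.card B ^ 1 :=
    m.card_fixed_blockTorus hU _
  have f5 : Nat.card (m.fixed (m.blkTorus ℓ 2 1 0)) = Nat.card B ^ 0 :=
    m.card_fixed_blockTorus hU _
  have key : ∀ {A A' : Subgroup G} {a a' : ℕ}, Nat.card A = Nat.card (ellPart ℓ U) ^ a →
      Nat.card A' = Nat.card (ellPart ℓ U) ^ a' → a ≠ a' → ¬ ConjIn ⊤ A A' := by
    intro A A' a a' h h' hne hc
    have := hc.card_eq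
    rw [h, h'] at this
    exact hne (Nat.pow_right_injective hN this)
  have key' : ∀ {A A' : Subgroup G} {a a' : ℕ}, Nat.card (m.fixed A) = Nat.card B ^ a →
      Nat.card (m.fixed A') = Nat.card B ^ a' → a ≠ a' → ¬ ConjIn ⊤ A A' := by
    intro A A' a a' h h' hne hc
    have := m.card_fixed_eq hc
    rw [h, h'] at this
    exact hne (Nat.pow_right_injective hB this)
  simp only [List.pairwise_cons, List.mem_cons, List.not_mem_nil, or_false, forall_eq_or_imp,
    forall_eq, false_imp_iff, implies_true, List.Pairwise.nil, and_true]
  exact ⟨⟨key' f1 f2 (by decide), key' f1 f3 (by decide), key c1 c4 (by decide),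
    key c1 c5 (by decide), key c1 c6 (by decide)⟩, ⟨key' f2 f3 (by decide), key c2 c4 (by decide),
    key c2 c5 (by decide), key c2 c6 (by decide)⟩, ⟨key c3 c4 (by decide), key c3 c5 (by decide),
    key c3 c6 (by decide)⟩, ⟨key' f4 f5 (by decide), key c4 c6 (by decide)⟩, key c5 c6 (by decide)⟩

theorem extra_le_monomial {ω : U} (hω : ω ^ 3 = 1) : m.extra ω ≤ m.monomial 3 := by
  have hωl : ω ∈ ellPart 3 U := cube_eq_one_of_mem_ellPart hω
  refine sup_le ?_ (sup_le (Subgroup.zpowers_le.2 ?_) (Subgroup.zpowers_le.2 ?_))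
  · rintro _ ⟨c, hc, rfl⟩
    exact m.δ_mem_monomial fun _ => hc
  · refine m.δ_mem_monomial fun i => ?_
    fin_cases i
    · exact one_mem _
    · exact hωl
    · exact pow_mem hωl 2
  · exact m.s_mem_monomial 3

/-- Elements of the central product send s to a scalar multiple of s under conjugation, whereas
diag(ω, 1, 1) does not. -/
theorem extra_ne_monomial {ω : U} (hω : ω ^ 3 = 1) (hω1 : ω ≠ 1) :
    m.extra ω ≠ m.monomial 3 := by
  have hωl : ω ∈ ellPart 3 U := cube_eq_one_of_mem_ellPart hω
  let C : Subgroup G :=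
    { carrier := {x | x ∈ m.monomial 3 ∧ ∃ c, x * m.s * x⁻¹ = m.scal c * m.s}
      one_mem' := ⟨one_mem _, 1, by simp⟩
      mul_mem' := by
        rintro x y ⟨hx, c, hc⟩ ⟨hy, c', hc'⟩
        refine ⟨mul_mem hx hy, c' * c, ?_⟩
        have h1 : x * y * m.s * (x * y)⁻¹ = x * (y * m.s * y⁻¹) * x⁻¹ := by
          simp only [_root_.mul_inv_rev, mul_assoc]
        rw [h1, hc', ← mul_assoc x, ← m.scal_comm c' hx, map_mul, mul_assoc, mul_assoc,
          ← mul_assoc x, hc, mul_assoc]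
      inv_mem' := by
        rintro x ⟨hx, c, hc⟩
        refine ⟨inv_mem hx, c⁻¹, ?_⟩
        have h1 := m.scal_comm c (inv_mem hx)
        rw [mul_inv_eq_iff_eq_mul] at hc
        rw [inv_inv, map_inv, eq_inv_mul_iff_mul_eq, ← mul_assoc, ← mul_assoc, h1, mul_assoc x⁻¹,
          mul_assoc x⁻¹, ← hc, inv_mul_cancel_left] }
  have hle : m.extra ω ≤ C := by
    refine sup_le ?_ (sup_le (Subgroup.zpowers_le.2 ?_) (Subgroup.zpowers_le.2 ?_))
    · rintro _ ⟨c, hc, rfl⟩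
      exact ⟨m.δ_mem_monomial fun _ => hc, 1, by
        rw [m.scal_comm c (m.s_mem_monomial 3), mul_inv_cancel_right, map_one, one_mul]⟩
    · refine ⟨m.extra_le_monomial hω (Subgroup.mem_sup_right
        (Subgroup.mem_sup_left (Subgroup.mem_zpowers _))), ω, ?_⟩
      have := m.δ_conj_s ![1, ω, ω ^ 2] 1
      rw [map_one, one_mul] at this
      rw [dω, this, scal_apply]
      congr 2
      funext i
      fin_cases i
      · simp only [Fin.zero_eta, cyc_inv_zero, Matrix.cons_val, Pi.one_apply, mul_one, one_mul]
        rw [inv_eq_iff_mul_eq_one, ← pow_succ, hω]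
      · simp [cyc_inv_one]
      · simp [cyc_inv_two, pow_two]
    · exact ⟨m.s_mem_monomial 3, 1, by simp⟩
  intro h
  have h1 : m.δ ![ω, 1, 1] ∈ m.monomial 3 := by
    refine m.δ_mem_monomial fun i => ?_
    fin_cases i
    · exact hωl
    · exact one_mem _
    · exact one_mem _
  rw [← h] at h1
  obtain ⟨-, c, hc⟩ := hle h1
  have := m.δ_conj_s ![ω, 1, 1] 1
  rw [map_one, one_mul] at this
  rw [this, scal_apply] at hc
  have h2 := m.δ_injective (mul_right_cancel hc)
  have h3 := congrFun h2 0
  have h4 := congrFun h2 2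
  simp only [cyc_inv_zero, cyc_inv_two, Matrix.cons_val, Pi.one_apply, mul_one, inv_one] at h3 h4
  exact hω1 (h3.trans h4.symm)

/-- Conjugation preserves exponents. -/
theorem pow_eq_one_of_conj {A A' : Subgroup G} (h : ConjIn ⊤ A A') {n : ℕ}
    (hA : ∀ x ∈ A, x ^ n = 1) : ∀ x ∈ A', x ^ n = 1 := by
  obtain ⟨k, -, rfl⟩ := h
  rintro _ ⟨x, hx, rfl⟩
  rw [← map_pow, hA x hx, map_one]

/-- Conjugation preserves commutativity. -/
theorem comm_of_conj {A A' : Subgroup G} (h : ConjIn ⊤ A A')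
    (hA : ∀ x ∈ A, ∀ y ∈ A, x * y = y * x) : ∀ x ∈ A', ∀ y ∈ A', x * y = y * x := by
  obtain ⟨k, -, rfl⟩ := h
  rintro _ ⟨x, hx, rfl⟩ _ ⟨y, hy, rfl⟩
  rw [← map_mul, hA x hx y hy, map_mul]

theorem blockTorus_comm {ℓ : ℕ} {b : Fin 3 → ℕ} :
    ∀ x ∈ m.blockTorus ℓ b, ∀ y ∈ m.blockTorus ℓ b, x * y = y * x := by
  rintro _ ⟨u, -, rfl⟩ _ ⟨v, -, rfl⟩
  exact m.δ_comm u v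

theorem blockTorus_pow {ℓ : ℕ} {b : Fin 3 → ℕ} :
    ∀ x ∈ m.blockTorus ℓ b, x ^ Nat.card (ellPart ℓ U) = 1 := by
  rintro _ ⟨u, hu, rfl⟩
  rw [← map_pow, ← map_one m.δ]
  congr 1
  funext i
  exact congrArg Subtype.val (pow_card_eq_one' (x := (⟨u i, hu.1 i⟩ : ellPart ℓ U)))

theorem extra_not_comm {ω : U} (hω1 : ω ≠ 1) :
    ¬ ∀ x ∈ m.extra ω, ∀ y ∈ m.extra ω, x * y = y * x := by
  intro h
  have h1 := h (m.dω ω) (Subgroup.mem_sup_right (Subgroup.mem_sup_left (Subgroup.mem_zpowers _)))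
    m.s (Subgroup.mem_sup_right (Subgroup.mem_sup_right (Subgroup.mem_zpowers _)))
  rw [dω, s_mul_δ] at h1
  have h2 := congrFun (m.δ_injective (mul_right_cancel h1)) 1
  simp only [cyc_inv_one, Matrix.cons_val] at h2
  exact hω1 h2

/-- The exponent separates S from the tori, commutativity separates P and `m.extra ω` from S and the
tori, and the order separates P from `m.extra ω`. -/
theorem pairwise_not_conj_three [Finite G] [Finite U] [Finite B] [Nontrivial B] {ω : U}
    (hω : ω ^ 3 = 1) (hω1 : ω ≠ 1) {S P : Subgroup G}
    (hS : ∀ x ∈ S, ∀ y ∈ S, x * y = y * x)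
    (hSc : ∃ x ∈ S, x ^ Nat.card (ellPart 3 U) ≠ 1) (hP : ConjIn ⊤ (m.monomial 3) P) :
    ([m.blkTorus 3 1 0 0, m.blkTorus 3 2 0 0, m.blkTorus 3 3 0 0, m.blkTorus 3 1 1 0,
      m.blkTorus 3 2 1 0, m.blkTorus 3 1 1 1] ++ [S, P, m.extra ω]).Pairwise
        fun A A' => ¬ ConjIn ⊤ A A' := by
  have hPn : ¬ ∀ x ∈ P, ∀ y ∈ P, x * y = y * x := fun h =>
    m.extra_not_comm hω1 fun x hx y hy => comm_of_conj (conjIn_symm hP) h x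
      (m.extra_le_monomial hω hx) y (m.extra_le_monomial hω hy)
  rw [List.pairwise_append]
  refine ⟨m.pairwise_not_conj ⟨ω, cube_eq_one_of_mem_ellPart hω, hω1⟩, ?_, ?_⟩
  · simp only [List.pairwise_cons, List.mem_cons, List.not_mem_nil, or_false, forall_eq_or_imp,
      forall_eq, false_imp_iff, implies_true, List.Pairwise.nil, and_true]
    refine ⟨⟨fun h => hPn (comm_of_conj h hS), fun h => m.extra_not_comm hω1 (comm_of_conj h hS)⟩,
      fun h => m.extra_ne_monomial hω hω1 ?_⟩
    refine Subgroup.eq_of_le_of_card_ge (m.extra_le_monomial hω) ?_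
    rw [(conjIn_trans hP h).card_eq]
  · intro A hA A' hA'
    obtain ⟨b, rfl⟩ : ∃ b, m.blockTorus 3 b = A := by
      simp only [List.mem_cons, List.not_mem_nil, or_false] at hA
      rcases hA with rfl | rfl | rfl | rfl | rfl | rfl <;> exact ⟨_, rfl⟩
    simp only [List.mem_cons, List.not_mem_nil, or_false] at hA'
    intro hc
    rcases hA' with rfl | rfl | rfl
    · obtain ⟨x, hx, hx1⟩ := hSc
      exact hx1 (pow_eq_one_of_conj hc m.blockTorus_pow x hx)
    · exact hPn (comm_of_conj hc m.blockTorus_comm)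
    · exact m.extra_not_comm hω1 (comm_of_conj hc m.blockTorus_comm)

end TorusModel

/-! ### Symplectic groups in characteristic two as unitary groups over quaternions -/

/-- The transpose with respect to the standard alternating form in characteristic two. -/
def rev {n : ℕ} {F : Type*} (A : Matrix (Fin n ⊕ Fin n) (Fin n ⊕ Fin n) F) :
    Matrix (Fin n ⊕ Fin n) (Fin n ⊕ Fin n) F :=
  Aᵀ.submatrix Sum.swap Sum.swap

section Symplectic

variable {n : ℕ} {F : Type*} [Field F] [CharP F 2]

/-- In characteristic two J has no signs: it is the permutation matrix that exchanges e_i and f_i.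
-/
theorem J_mul_mul_J (N : Matrix (Fin n ⊕ Fin n) (Fin n ⊕ Fin n) F) :
    J (Fin n) F * N * J (Fin n) F = N.submatrix Sum.swap Sum.swap := by
  have h1 : (-1 : Matrix (Fin n) (Fin n) F) = 1 := by
    ext i k
    simp [CharTwo.neg_eq]
  rw [J, h1, ← fromBlocks_toBlocks N, fromBlocks_multiply, fromBlocks_multiply]
  ext (i | i) (k | k) <;> simp

theorem J_mul_J : J (Fin n) F * J (Fin n) F = 1 := by
  have := J_mul_mul_J (1 : Matrix (Fin n ⊕ Fin n) (Fin n ⊕ Fin n) F)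
  rw [mul_one] at this
  rw [this]
  exact submatrix_one_equiv (Equiv.sumComm (Fin n) (Fin n))

theorem rev_eq (A : Matrix (Fin n ⊕ Fin n) (Fin n ⊕ Fin n) F) :
    rev A = J (Fin n) F * Aᵀ * J (Fin n) F :=
  (J_mul_mul_J _).symm

theorem mem_symplecticGroup_iff (A : Matrix (Fin n ⊕ Fin n) (Fin n ⊕ Fin n) F) :
    A ∈ symplecticGroup (Fin n) F ↔ A * rev A = 1 := by
  rw [SymplecticGroup.mem_iff, rev_eq]
  constructor
  · intro h
    rw [← mul_assoc, ← mul_assoc, h, J_mul_J]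
  · intro h
    rw [← mul_assoc, ← mul_assoc] at h
    have h2 : A * J (Fin n) F * Aᵀ * J (Fin n) F * J (Fin n) F = J (Fin n) F := by rw [h, one_mul]
    rwa [mul_assoc, J_mul_J, mul_one] at h2

end Symplectic

/-- `2 × 2` matrices, as a split quaternion algebra. -/
abbrev Quat (F : Type*) : Type _ := Matrix (Fin 1 ⊕ Fin 1) (Fin 1 ⊕ Fin 1) F

/-- The canonical involution in characteristic two. -/
instance quatStarRing {F : Type*} [Field F] : StarRing (Quat F) where
  star := rev
  star_involutive b := by
    ext (i | i) (k | k) <;> rfl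
  star_mul a b := by
    simp only [rev]
    rw [transpose_mul, ← submatrix_mul_equiv _ _ Sum.swap (Equiv.sumComm (Fin 1) (Fin 1)) Sum.swap]
    rfl
  star_add a b := rfl

section Quat

variable {F : Type*} [Field F]

theorem star_quat (b : Quat F) : star b = rev b := rfl

omit [Field F] in
theorem quat_ext_iff {a b : Quat F} : a = b ↔
    a (Sum.inl 0) (Sum.inl 0) = b (Sum.inl 0) (Sum.inl 0) ∧
    a (Sum.inl 0) (Sum.inr 0) = b (Sum.inl 0) (Sum.inr 0) ∧
    a (Sum.inr 0) (Sum.inl 0) = b (Sum.inr 0) (Sum.inl 0) ∧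
    a (Sum.inr 0) (Sum.inr 0) = b (Sum.inr 0) (Sum.inr 0) := by
  constructor
  · rintro rfl
    simp
  · rintro ⟨h1, h2, h3, h4⟩
    ext (i | i) (k | k) <;> fin_cases i <;> fin_cases k <;> assumption

theorem quat_add_star [CharP F 2] (b : Quat F) : b + star b =
    (b (Sum.inl 0) (Sum.inl 0) + b (Sum.inr 0) (Sum.inr 0)) • (1 : Quat F) := by
  rw [quat_ext_iff]
  simp [star_quat, rev, CharTwo.add_self_eq_zero, add_comm]

/-- The centralizer of a quaternion of nonzero trace is commutative. -/
theorem quat_comm [CharP F 2] {x b y : Quat F} (hx : x ≠ star x) (hb : x * b = b * x)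
    (hy : x * y = y * x) : y * b = b * y := by
  have h2 : ∀ a : F, a + a = 0 := CharTwo.add_self_eq_zero
  have hne : x (Sum.inl 0) (Sum.inl 0) - x (Sum.inr 0) (Sum.inr 0) ≠ 0 := by
    intro h
    apply hx
    rw [quat_ext_iff]
    simp [star_quat, rev, sub_eq_zero.1 h]
  rw [quat_ext_iff] at hb hy ⊢
  simp only [Matrix.mul_apply, Fintype.sum_sum_type, Finset.univ_unique, Finset.sum_singleton,
    Fin.default_eq_zero, Fin.isValue] at hb hy ⊢
  obtain ⟨hb1, hb2, hb3, hb4⟩ := hb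
  obtain ⟨hy1, hy2, hy3, hy4⟩ := hy
  generalize x (Sum.inl 0) (Sum.inl 0) = x1 at *
  generalize x (Sum.inl 0) (Sum.inr 0) = x2 at *
  generalize x (Sum.inr 0) (Sum.inl 0) = x3 at *
  generalize x (Sum.inr 0) (Sum.inr 0) = x4 at *
  generalize b (Sum.inl 0) (Sum.inl 0) = b1 at *
  generalize b (Sum.inl 0) (Sum.inr 0) = b2 at *
  generalize b (Sum.inr 0) (Sum.inl 0) = b3 at *
  generalize b (Sum.inr 0) (Sum.inr 0) = b4 at *
  generalize y (Sum.inl 0) (Sum.inl 0) = y1 at *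
  generalize y (Sum.inl 0) (Sum.inr 0) = y2 at *
  generalize y (Sum.inr 0) (Sum.inl 0) = y3 at *
  generalize y (Sum.inr 0) (Sum.inr 0) = y4 at *
  -- Commuting with x makes the off-diagonal entries of b and y proportional to those of x, with
  -- factors given by differences of diagonal entries. As x₁ ≠ x₄, these relations determine b and y
  -- up to scalars.
  have eb2 : b2 * (x1 - x4) = x2 * (b1 - b4) := by linear_combination hb2
  have eb3 : b3 * (x1 - x4) = x3 * (b1 - b4) := by linear_combination -hb3
  have ey2 : y2 * (x1 - x4) = x2 * (y1 - y4) := by linear_combination hy2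
  have ey3 : y3 * (x1 - x4) = x3 * (y1 - y4) := by linear_combination -hy3
  have key : y2 * b3 = b2 * y3 := by
    apply mul_right_cancel₀ (mul_ne_zero hne hne)
    linear_combination (b3 * (x1 - x4)) * ey2 + x2 * (y1 - y4) * eb3 - (y3 * (x1 - x4)) * eb2 -
      x2 * (b1 - b4) * ey3
  refine ⟨by linear_combination key, ?_, ?_, by linear_combination -key⟩
  · apply mul_right_cancel₀ hne
    linear_combination (y1 - y4) * eb2 - (b1 - b4) * ey2
  · apply mul_right_cancel₀ hne
    linear_combination (b1 - b4) * ey3 - (y1 - y4) * eb3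

/-- The identification of `3 × 3` matrices of quaternions with `6 × 6` matrices. -/
def blockEquiv (n : ℕ) (F : Type*) [Field F] :
    Matrix (Fin n) (Fin n) (Quat F) ≃+* Matrix (Fin n ⊕ Fin n) (Fin n ⊕ Fin n) F :=
  (compRingEquiv (Fin n) (Fin 1 ⊕ Fin 1) F).trans
    (reindexRingEquiv F
          ((Equiv.prodSumDistrib (Fin n) (Fin 1) (Fin 1)).trans
            (Equiv.sumCongr (Equiv.prodUnique (Fin n) (Fin 1))
              (Equiv.prodUnique (Fin n) (Fin 1)))))

theorem blockEquiv_apply (n : ℕ) (M : Matrix (Fin n) (Fin n) (Quat F)) (x y : Fin n ⊕ Fin n) :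
    blockEquiv n F M x y = M (Sum.elim id id x) (Sum.elim id id y)
      (Sum.map (fun _ => 0) (fun _ => 0) x) (Sum.map (fun _ => 0) (fun _ => 0) y) := by
  rcases x with i | i <;> rcases y with k | k <;> rfl

/-- Conjugate transposition over the quaternions is the adjoint for the alternating form, so the
unitary matrices are exactly the symplectic ones. -/
theorem blockEquiv_star (n : ℕ) (M : Matrix (Fin n) (Fin n) (Quat F)) :
    blockEquiv n F (star M) = rev (blockEquiv n F M) := by
  ext x y
  simp only [rev, submatrix_apply, transpose_apply, blockEquiv_apply, star_eq_conjTranspose,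
    conjTranspose_apply, star_quat]
  rcases x with i | i <;> rcases y with k | k <;> rfl

variable [CharP F 2]

/-- The embedding of `Sp_6` into `3 × 3` matrices of quaternions. -/
def quatEmb (F : Type*) [Field F] : Sp 3 F →* Matrix (Fin 3) (Fin 3) (Quat F) :=
  ((blockEquiv 3 F).symm : _ →* _).comp (symplecticGroup (Fin 3) F).subtype

omit [CharP F 2] in
theorem quatEmb_apply (g : Sp 3 F) : quatEmb F g = (blockEquiv 3 F).symm g.1 := rfl

omit [CharP F 2] in
theorem blockEquiv_quatEmb (g : Sp 3 F) : blockEquiv 3 F (quatEmb F g) = g.1 := by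
  exact (blockEquiv 3 F).apply_symm_apply _

theorem quatEmb_mul_star (g : Sp 3 F) : quatEmb F g * star (quatEmb F g) = 1 := by
  apply (blockEquiv 3 F).injective
  rw [map_mul, blockEquiv_star, blockEquiv_quatEmb, map_one]
  exact (mem_symplecticGroup_iff _).1 g.2

theorem exists_quatEmb (M : Matrix (Fin 3) (Fin 3) (Quat F)) (hM : M * star M = 1) :
    ∃ g, quatEmb F g = M := by
  refine ⟨⟨blockEquiv 3 F M, ?_⟩, ?_⟩
  · rw [mem_symplecticGroup_iff, ← blockEquiv_star, ← map_mul, hM, map_one]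
  · exact (blockEquiv 3 F).symm_apply_apply _

omit [CharP F 2] in
theorem quatEmb_injective : Function.Injective (quatEmb F) := by
  intro a b h
  exact Subtype.ext ((blockEquiv 3 F).symm.injective h)

/-- Construction of the torus model of `Sp_6` from a group of norm one quaternions. -/
def mkModel {U : Type*} [CommGroup U] (j : U →* Quat F) (hj : Function.Injective j)
    (hstar : ∀ u, star (j u) = j u⁻¹) (htr : ∀ u, j u + j u⁻¹ = 0 → u = 1)
    (w : Quat F) (hw : w * star w = 1) (hwj : ∀ u, w * j u = j u⁻¹ * w)
    (hN : ∀ b, (∀ u, j u * b = b * j u) → b * star b = 1 → ∃ u, j u = b) :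
    TorusModel (Sp 3 F) (Quat F) U :=
  have h2 : (2 : Quat F) = 0 := by
    rw [← one_add_one_eq_two, quat_ext_iff]
    simp [CharTwo.add_self_eq_zero]
  have hmul : ∀ u v, j u * j v = j (u * v) := fun u v => (map_mul _ _ _).symm
  have htr' : ∀ u, j u + j u⁻¹ = (j u (Sum.inl 0) (Sum.inl 0) + j u (Sum.inr 0) (Sum.inr 0)) •
      (1 : Quat F) := fun u => by rw [← hstar, quat_add_star]
  -- For u ≠ v the quaternion j(u) - j(v) is invertible: in characteristic two its norm is the trace
  -- of j(uv⁻¹), which `htr` shows to be nonzero.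
  have hnorm : ∀ u v b, u ≠ v → (j u - j v) * b = 0 → b = 0 := by
    intro u v b huv hb
    have h1 : (j u⁻¹ - j v⁻¹) * (j u - j v) = 2 - (j (u * v⁻¹) + j (u * v⁻¹)⁻¹) := by
      rw [sub_mul, mul_sub, mul_sub, hmul, hmul, hmul, hmul, inv_mul_cancel, inv_mul_cancel,
        map_one, ← one_add_one_eq_two, _root_.mul_inv_rev, inv_inv, mul_comm u⁻¹, mul_comm v⁻¹]
      abel
    have h3 : (2 - (j (u * v⁻¹) + j (u * v⁻¹)⁻¹)) * b = 0 := by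
      rw [← h1, mul_assoc, hb, mul_zero]
    rw [h2, zero_sub, htr', neg_mul, smul_mul_assoc, one_mul, neg_eq_zero, smul_eq_zero] at h3
    refine h3.resolve_left fun h4 => huv ?_
    have h5 := htr' (u * v⁻¹)
    rw [h4, zero_smul] at h5
    exact mul_inv_eq_one.1 (htr _ h5)
  { ι := quatEmb F
    ι_injective := quatEmb_injective
    ι_mul_star := quatEmb_mul_star
    exists_of_mul_star := exists_quatEmb
    j := j
    j_injective := hj
    star_j := hstar
    eq_zero_of_intertwine := by
      intro u v b hb huv huv'
      by_contra hb0
      have h1 : j u⁻¹ * b = b * j v⁻¹ := by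
        calc j u⁻¹ * b = j u⁻¹ * (b * j v) * j v⁻¹ := by
              rw [mul_assoc, mul_assoc, hmul, mul_inv_cancel, map_one, mul_one]
          _ = b * j v⁻¹ := by
              rw [← hb, ← mul_assoc, hmul, inv_mul_cancel, map_one, one_mul]
      have h3 : (j u + j u⁻¹) * b = b * (j v + j v⁻¹) := by rw [add_mul, mul_add, hb, h1]
      have h4 : j u + j u⁻¹ = j v + j v⁻¹ := by
        rw [htr', htr', smul_mul_assoc, one_mul, mul_smul_comm, mul_one, ← sub_eq_zero,
          ← sub_smul, smul_eq_zero] at h3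
        rw [htr', htr', sub_eq_zero.1 (h3.resolve_right hb0)]
      -- An intertwiner b ≠ 0 makes the scalar traces equal, so `j u` is a root of the quadratic
      -- polynomial whose roots are `j v` and `j v⁻¹`.
      have h5 : (j u - j v) * (j u - j v⁻¹) = 0 := by
        have h6 : (j u - j v) * (j u - j v⁻¹) = j u * j u - j u * (j v + j v⁻¹) + 1 := by
          rw [sub_mul, mul_sub, mul_sub, mul_add, hmul v v⁻¹, mul_inv_cancel, map_one, hmul v u,
            mul_comm v u, ← hmul]
          abel
        rw [h6, ← h4, mul_add, hmul u u⁻¹, mul_inv_cancel, map_one]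
        abel
      exact huv' (hj (sub_eq_zero.1 (hnorm u v _ huv h5)))
    commute_of_commute := by
      intro u v b hu hb
      refine quat_comm (x := j u) (fun h => hu (htr u ?_)) hb (by rw [hmul, hmul, mul_comm])
      rw [hstar] at h
      rw [← h, ← two_mul, h2, zero_mul]
    eq_one_of_eq_inv := by
      intro u hu
      apply htr
      rw [← hu, ← two_mul, h2, zero_mul]
    w := w
    w_mul_star := hw
    w_mul_j := hwj
    exists_of_norm_one := hN
    two_eq_zero := h2
    one_add_add := by
      intro ζ hζ hζ1
      refine hnorm ζ 1 _ hζ1 ?_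
      have h3 : j ζ * j (ζ ^ 2) = 1 := by rw [hmul, ← pow_succ', hζ, map_one]
      rw [map_one, sub_mul, one_mul, mul_add, mul_add, mul_one, h3, hmul, ← pow_two]
      abel }

end Quat

section Frame

variable {F : Type*} [Field F] [Finite F] [CharP F 2]

theorem frame_isFrame (k : ℕ) [NeZero (2 * k)] : IsFrame k (frame F k) :=
  (exists_frame F k).choose_spec

theorem ext_pow_card (d : ℕ) [NeZero d] (x : Ext F d) : x ^ (Nat.card F ^ d) = x := by
  have : Fintype (Ext F d) := Fintype.ofFinite _
  have h := FiniteField.pow_card x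
  rwa [← Nat.card_eq_fintype_card, FiniteField.natCard_extension] at h

/-- The `q ^ k`-power map. -/
def frobPow (d k : ℕ) [NeZero d] : Ext F d →ₐ[F] Ext F d :=
  have : Fintype F := Fintype.ofFinite F
  (FiniteField.frobeniusAlgHom F (Ext F d)) ^ k

theorem frobPow_apply (d k : ℕ) [NeZero d] (x : Ext F d) :
    frobPow d k x = x ^ (Nat.card F ^ k) := by
  let : Fintype F := Fintype.ofFinite F
  rw [frobPow, AlgHom.coe_pow, FiniteField.coe_frobeniusAlgHom, Nat.card_eq_fintype_card,
    pow_iterate]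

theorem trace_pow_card (d : ℕ) [NeZero d] (x : Ext F d) :
    Algebra.trace F (Ext F d) (x ^ Nat.card F) = Algebra.trace F (Ext F d) x := by
  have : Fintype F := Fintype.ofFinite F
  have h := Algebra.trace_eq_of_algEquiv
    (FiniteField.frobeniusAlgEquivOfAlgebraic F (Ext F d)) x
  rwa [FiniteField.coe_frobeniusAlgEquivOfAlgebraic, ← Nat.card_eq_fintype_card] at h

/-- Adjoint endomorphisms have adjoint matrices with respect to a symplectic frame. -/
theorem rev_toMatrix (k : ℕ) [NeZero (2 * k)] (f g : Ext F (2 * k) →ₗ[F] Ext F (2 * k))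
    (h : ∀ x y, Algebra.trace F (Ext F (2 * k)) (f x * y ^ (Nat.card F ^ k)) =
      Algebra.trace F (Ext F (2 * k)) (x * g y ^ (Nat.card F ^ k))) :
    rev (LinearMap.toMatrix (frame F k) (frame F k) f) =
      LinearMap.toMatrix (frame F k) (frame F k) g := by
  set β := frame F k
  set A := LinearMap.toMatrix β β f
  set B := LinearMap.toMatrix β β g
  have hpow : ∀ y : Ext F (2 * k), y ^ (Nat.card F ^ k) = frobPow (2 * k) k y :=
    fun y => (frobPow_apply _ _ _).symm
  have key : Aᵀ * J (Fin k) F = J (Fin k) F * B := by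
    ext a b
    have h1 := h (β a) (β b)
    have hf : f (β a) = ∑ i, A i a • β i := by
      rw [← β.sum_repr (f (β a))]
      exact Finset.sum_congr rfl fun i _ => by rw [← LinearMap.toMatrix_apply β β]
    have hg : g (β b) = ∑ i, B i b • β i := by
      rw [← β.sum_repr (g (β b))]
      exact Finset.sum_congr rfl fun i _ => by rw [← LinearMap.toMatrix_apply β β]
    rw [hf, hg, Finset.sum_mul, map_sum, hpow (∑ i, _), map_sum, Finset.mul_sum, map_sum] at h1
    rw [Matrix.mul_apply, Matrix.mul_apply]
    convert h1 using 2 with i _ i _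
    · rw [smul_mul_assoc, map_smul, frame_isFrame k i b, transpose_apply, smul_eq_mul]
    · rw [map_smul, ← hpow, mul_smul_comm, map_smul, frame_isFrame k a i, smul_eq_mul, mul_comm]
  rw [rev_eq, mul_assoc, key, ← mul_assoc, J_mul_J, one_mul]

/-- For the form Tr(x y^(q^k)) the adjoint of multiplication by u is multiplication by u^(q^k),
because the q^k-power map has order dividing two. -/
theorem rev_leftMulMatrix (k : ℕ) [NeZero (2 * k)] (u : Ext F (2 * k)) :
    rev (Algebra.leftMulMatrix (frame F k) u) =
      Algebra.leftMulMatrix (frame F k) (u ^ (Nat.card F ^ k)) := by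
  refine rev_toMatrix k _ _ fun x y => ?_
  have h : u ^ (Nat.card F ^ k * Nat.card F ^ k) = u := by
    rw [← pow_add, ← two_mul, ext_pow_card]
  change Algebra.trace F (Ext F (2 * k)) (u * x * _) =
    Algebra.trace F (Ext F (2 * k)) (x * (u ^ (Nat.card F ^ k) * y) ^ _)
  rw [mul_pow, ← pow_mul, h]
  congr 1
  ring

/-- The norm one group of `F_{q^{2k}}` over `F_{q^k}`. -/
abbrev NormOne (F : Type*) [Field F] [Finite F] [CharP F 2] (k : ℕ) [NeZero (2 * k)] : Type _ :=
  (powMonoidHom (Nat.card F ^ k + 1) : (Ext F (2 * k))ˣ →* (Ext F (2 * k))ˣ).ker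

theorem NormOne.pow_eq {k : ℕ} [NeZero (2 * k)] (u : NormOne F k) :
    ((u : (Ext F (2 * k))ˣ) : Ext F (2 * k)) ^ (Nat.card F ^ k) =
      (((u⁻¹ : NormOne F k) : (Ext F (2 * k))ˣ) : Ext F (2 * k)) := by
  have h : (u : (Ext F (2 * k))ˣ) ^ (Nat.card F ^ k + 1) = 1 := u.2
  have h2 : (u : (Ext F (2 * k))ˣ) ^ (Nat.card F ^ k) = (u : (Ext F (2 * k))ˣ)⁻¹ := by
    rw [eq_inv_iff_mul_eq_one, ← pow_succ, h]
  have := congrArg Units.val h2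
  rwa [Units.val_pow_eq_pow_val] at this

theorem card_normOne (k : ℕ) [NeZero (2 * k)] : Nat.card (NormOne F k) = Nat.card F ^ k + 1 := by
  have h1 : Nat.card (Ext F (2 * k))ˣ = Nat.card F ^ (2 * k) - 1 := by
    rw [Nat.card_units, FiniteField.natCard_extension]
  have h2 : Nat.card F ^ (2 * k) - 1 = (Nat.card F ^ k + 1) * (Nat.card F ^ k - 1) := by
    rw [mul_comm 2, pow_mul, ← Nat.sq_sub_sq, one_pow]
  rw [IsCyclic.card_powMonoidHom_ker, h1, h2, Nat.gcd_mul_right_left]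

/-- Multiplication by norm one elements. -/
def normOneEmb (F : Type*) [Field F] [Finite F] [CharP F 2] (k : ℕ) [NeZero (2 * k)] :
    NormOne F k →* Matrix (Fin k ⊕ Fin k) (Fin k ⊕ Fin k) F where
  toFun u := Algebra.leftMulMatrix (frame F k) ((u : (Ext F (2 * k))ˣ) : Ext F (2 * k))
  map_one' := by simp
  map_mul' u v := by simp

theorem normOneEmb_injective (k : ℕ) [NeZero (2 * k)] :
    Function.Injective (normOneEmb F k) := fun _ _ h =>
  Subtype.ext (Units.ext (Algebra.leftMulMatrix_injective _ h))

theorem rev_normOneEmb (k : ℕ) [NeZero (2 * k)] (u : NormOne F k) :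
    rev (normOneEmb F k u) = normOneEmb F k u⁻¹ := by
  change rev (Algebra.leftMulMatrix (frame F k) _) = Algebra.leftMulMatrix (frame F k) _
  rw [rev_leftMulMatrix, u.pow_eq]

theorem normOneEmb_mem (k : ℕ) [NeZero (2 * k)] (u : NormOne F k) :
    normOneEmb F k u ∈ symplecticGroup (Fin k) F := by
  rw [mem_symplecticGroup_iff, rev_normOneEmb, ← map_mul, mul_inv_cancel, map_one]

/-! ### The split torus -/

variable (F) in
/-- `x ↦ diag(x, x⁻¹)`. -/
def splitEmb : Fˣ →* Quat F where
  toFun x := diagonal (Sum.elim (fun _ => (x : F)) (fun _ => ((x⁻¹ : Fˣ) : F)))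
  map_one' := by
    rw [quat_ext_iff]
    simp
  map_mul' x y := by
    rw [quat_ext_iff]
    simp [mul_comm]

omit [Finite F] [CharP F 2] in
theorem splitEmb_commute {x : Fˣ} (hx : x ≠ x⁻¹) {b : Quat F}
    (h : splitEmb F x * b = b * splitEmb F x) :
    b (Sum.inl 0) (Sum.inr 0) = 0 ∧ b (Sum.inr 0) (Sum.inl 0) = 0 := by
  have hne : (x : F) - ((x⁻¹ : Fˣ) : F) ≠ 0 := fun h => hx (Units.ext (sub_eq_zero.1 h))
  rw [quat_ext_iff] at h
  obtain ⟨-, h2, h3, -⟩ := h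
  simp only [splitEmb, MonoidHom.coe_mk, OneHom.coe_mk, diagonal_mul, mul_diagonal,
    Sum.elim_inl, Sum.elim_inr] at h2 h3
  constructor
  · refine ((mul_eq_zero (a := (x : F) - ((x⁻¹ : Fˣ) : F))).1 ?_).resolve_left hne
    linear_combination h2
  · refine ((mul_eq_zero (a := (x : F) - ((x⁻¹ : Fˣ) : F))).1 ?_).resolve_left hne
    linear_combination -h3

omit [Finite F] in
theorem units_eq_one_of_eq_inv {x : Fˣ} (hx : x = x⁻¹) : x = 1 := by
  have h1 : (x : F) ^ 2 = 1 := by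
    have : x * x = 1 := by
      nth_rw 2 [hx]
      exact mul_inv_cancel x
    rw [pow_two, ← Units.val_mul, this, Units.val_one]
  have h2 : ((x : F) + 1) ^ 2 = 0 := by
    rw [CharTwo.add_sq, h1, one_pow, CharTwo.add_self_eq_zero]
  have h3 : (x : F) + 1 = 0 := by simpa using h2
  exact Units.ext (CharTwo.add_eq_zero.1 h3)

omit [Finite F] [CharP F 2] in
theorem splitEmb_comm_diag (x : Fˣ) {b : Quat F} (h1 : b (Sum.inl 0) (Sum.inr 0) = 0)
    (h2 : b (Sum.inr 0) (Sum.inl 0) = 0) : splitEmb F x * b = b * splitEmb F x := by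
  rw [quat_ext_iff]
  simp [splitEmb, h1, h2, mul_comm]

variable (F) in
/-- The torus model for `q ≡ 1`. -/
def splitModel (h : ∃ x : Fˣ, x ≠ 1) : TorusModel (Sp 3 F) (Quat F) Fˣ :=
  mkModel (splitEmb F)
    (fun x y hxy => by
      rw [quat_ext_iff] at hxy
      exact Units.ext (by simpa [splitEmb] using hxy.1))
    (fun x => by
      rw [quat_ext_iff]
      simp [splitEmb, star_quat, rev])
    (fun x hx => by
      rw [quat_ext_iff] at hx
      refine units_eq_one_of_eq_inv (Units.ext ?_)
      have := hx.1
      simp only [splitEmb, MonoidHom.coe_mk, OneHom.coe_mk, Matrix.add_apply, diagonal_apply_eq,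
        Sum.elim_inl, Matrix.zero_apply] at this
      exact CharTwo.add_eq_zero.1 this)
    -- J exchanges the two diagonal entries x and x⁻¹.
    (J (Fin 1) F)
    (by
      rw [star_quat, rev_eq, ← mul_assoc, ← mul_assoc, J_mul_J, one_mul, J_transpose, neg_mul,
        J_mul_J]
      rw [quat_ext_iff]
      simp [CharTwo.neg_eq])
    (fun x => by
      rw [quat_ext_iff]
      simp [splitEmb, J, mul_diagonal, diagonal_mul])
    (fun b hb hbb => by
      obtain ⟨x, hx⟩ := h
      obtain ⟨h1, h2⟩ := splitEmb_commute (fun h => hx (units_eq_one_of_eq_inv h)) (hb x)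
      have h3 := (quat_ext_iff.1 hbb).1
      simp [Matrix.mul_apply, star_quat, rev, h1] at h3
      refine ⟨Units.mkOfMulEqOne _ _ h3, ?_⟩
      rw [quat_ext_iff]
      simp [splitEmb, h1, h2]
      exact inv_eq_of_mul_eq_one_right h3)

/-! ### The non-split torus -/

omit [Finite F] [CharP F 2] in
/-- A matrix that commutes with all multiplications is a multiplication. -/
theorem exists_eq_leftMulMatrix {K ι : Type*} [Fintype ι] [DecidableEq ι] [CommRing K]
    [Algebra F K] (β : Module.Basis ι F K) {b : Matrix ι ι F}
    (h : ∀ y, Algebra.leftMulMatrix β y * b = b * Algebra.leftMulMatrix β y) :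
    ∃ e, b = Algebra.leftMulMatrix β e := by
  -- A linear map commuting with all multiplications is multiplication by its value at 1.
  refine ⟨Matrix.toLin β β b 1, ?_⟩
  apply (Matrix.toLin β β).injective
  refine LinearMap.ext fun z => ?_
  have h1 := LinearMap.congr_fun (congrArg (Matrix.toLin β β) (h z)) 1
  rw [Matrix.toLin_mul β β β, Matrix.toLin_mul β β β] at h1
  simp only [LinearMap.comp_apply, Algebra.leftMulMatrix_apply, Matrix.toLin_toMatrix,
    Algebra.coe_lmul_eq_mul, LinearMap.mul_apply', mul_one] at h1 ⊢
  rw [← h1, mul_comm]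

instance charP_ext (d : ℕ) [NeZero d] : CharP (Ext F d) 2 :=
  charP_of_injective_algebraMap (algebraMap F (Ext F d)).injective 2

theorem normOneEmb_add_inv {u : NormOne F 1} (hu : normOneEmb F 1 u + normOneEmb F 1 u⁻¹ = 0) :
    u = 1 := by
  change Algebra.leftMulMatrix (frame F 1) _ + Algebra.leftMulMatrix (frame F 1) _ = 0 at hu
  rw [← map_add, map_eq_zero_iff _ (Algebra.leftMulMatrix_injective _)] at hu
  exact Subtype.ext (units_eq_one_of_eq_inv (Units.ext (CharTwo.add_eq_zero.1 hu)))

theorem exists_eq_leftMulMatrix_of_commute {u : NormOne F 1} (hu : u ≠ 1) {b : Quat F}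
    (h : normOneEmb F 1 u * b = b * normOneEmb F 1 u) :
    ∃ e, b = Algebra.leftMulMatrix (frame F 1) e := by
  refine exists_eq_leftMulMatrix _ fun y => quat_comm (x := normOneEmb F 1 u) ?_ h ?_
  · intro h1
    rw [star_quat, rev_normOneEmb] at h1
    refine hu (normOneEmb_add_inv ?_)
    rw [← h1, ← two_smul F, CharTwo.two_eq_zero, zero_smul]
  · change Algebra.leftMulMatrix _ _ * _ = _ * Algebra.leftMulMatrix _ _
    exact (map_mul _ _ _).symm.trans ((congrArg _ (mul_comm _ _)).trans (map_mul _ _ _))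

theorem normOne_of_leftMulMatrix {e : Ext F (2 * 1)}
    (h : Algebra.leftMulMatrix (frame F 1) e * rev (Algebra.leftMulMatrix (frame F 1) e) = 1) :
    ∃ u : NormOne F 1, ((u : (Ext F (2 * 1))ˣ) : Ext F (2 * 1)) = e := by
  rw [rev_leftMulMatrix, ← map_mul, ← map_one (Algebra.leftMulMatrix (frame F 1))] at h
  have h1 := Algebra.leftMulMatrix_injective _ h
  refine ⟨⟨Units.mkOfMulEqOne _ _ h1, ?_⟩, rfl⟩
  rw [MonoidHom.mem_ker]
  exact Units.ext ((pow_succ' e _).trans h1)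

variable (F) in
/-- The torus model for `q ≡ -1`. -/
def normModel (h : ∃ x : NormOne F 1, x ≠ 1) : TorusModel (Sp 3 F) (Quat F) (NormOne F 1) :=
  have hq2 : ∀ x : Ext F (2 * 1), (x ^ Nat.card F ^ 1) ^ Nat.card F ^ 1 = x := fun x => by
    rw [← pow_mul, ← pow_add]
    exact ext_pow_card (2 * 1) x
  have htoMatrix : ∀ u, normOneEmb F 1 u = LinearMap.toMatrix (frame F 1) (frame F 1)
    (LinearMap.mul F (Ext F (2 * 1)) ((u : (Ext F (2 * 1))ˣ) : Ext F (2 * 1))) := fun _ => rfl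
  mkModel (normOneEmb F 1) (normOneEmb_injective 1) (rev_normOneEmb 1)
    (fun _ => normOneEmb_add_inv)
    -- The reflection is the map x ↦ x^q, an involution that is its own adjoint and inverts norm one
    -- elements.
    (LinearMap.toMatrix (frame F 1) (frame F 1) (frobPow (2 * 1) 1).toLinearMap)
    (by
      rw [star_quat, rev_toMatrix 1 _ (frobPow (2 * 1) 1).toLinearMap, ← LinearMap.toMatrix_comp,
        ← LinearMap.toMatrix_id (frame F 1)]
      · congr 1
        refine LinearMap.ext fun x => ?_
        simp only [LinearMap.comp_apply, AlgHom.toLinearMap_apply, frobPow_apply, hq2,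
          LinearMap.id_apply]
      · intro x y
        simp only [AlgHom.toLinearMap_apply, frobPow_apply, hq2]
        nth_rw 2 [← trace_pow_card]
        have := hq2 y
        rw [pow_one] at this ⊢
        rw [mul_pow])
    (by
      intro u
      rw [htoMatrix, htoMatrix, ← LinearMap.toMatrix_comp, ← LinearMap.toMatrix_comp]
      congr 1
      refine LinearMap.ext fun x => ?_
      simp only [LinearMap.comp_apply, AlgHom.toLinearMap_apply, frobPow_apply,
          LinearMap.mul_apply', ← u.pow_eq, mul_pow])
    (fun b hb hbb => by
      obtain ⟨x, hx⟩ := h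
      obtain ⟨e, rfl⟩ := exists_eq_leftMulMatrix_of_commute hx (hb x)
      obtain ⟨u, rfl⟩ := normOne_of_leftMulMatrix hbb
      exact ⟨u, rfl⟩)

end Frame

/-! ### Centers of products of general linear and unitary groups -/

namespace TorusModel

variable {G B U : Type*} [Group G] [Ring B] [StarRing B] [CommGroup U] (m : TorusModel G B U)

/-- The defining property of a product of general linear groups over the commutant of the torus. -/
def IsLevi (r₁ r₂ r₃ : ℕ) (x : G) : Prop :=
  (∀ i k : Fin 3, (blk r₁ r₂ r₃ i ≠ blk r₁ r₂ r₃ k ∨ blk r₁ r₂ r₃ i = 0) →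
    m.ι x i k = (1 : Matrix (Fin 3) (Fin 3) B) i k) ∧
  ∀ i k u, m.j u * m.ι x i k = m.ι x i k * m.j u

theorem isLevi_δ {r₁ r₂ r₃ : ℕ} {v : Fin 3 → U}
    (hv : ∀ i : Fin 3, blk r₁ r₂ r₃ i = 0 → v i = 1) : m.IsLevi r₁ r₂ r₃ (m.δ v) := by
  constructor
  · intro i k hik
    rw [ι_δ]
    by_cases h : i = k
    · subst h
      rw [diagonal_apply_eq, one_apply_eq, hv i (hik.resolve_left (not_not.2 rfl)), map_one]
    · rw [diagonal_apply_ne _ h, one_apply_ne h]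
  · intro i k u
    rw [ι_δ]
    by_cases h : i = k
    · subst h
      rw [diagonal_apply_eq, ← map_mul, ← map_mul, mul_comm]
    · rw [diagonal_apply_ne _ h, mul_zero, zero_mul]

theorem isLevi_π_swap {r₁ r₂ r₃ : ℕ} {i k : Fin 3} (hi : blk r₁ r₂ r₃ i ≠ 0)
    (hik : blk r₁ r₂ r₃ i = blk r₁ r₂ r₃ k) : m.IsLevi r₁ r₂ r₃ (m.π (Equiv.swap i k)) := by
  have hb : ∀ l, blk r₁ r₂ r₃ (Equiv.swap i k l) = blk r₁ r₂ r₃ l := by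
    intro l
    rw [Equiv.swap_apply_def]
    split_ifs with h1 h2
    · rw [h1, hik]
    · rw [h2, hik]
    · rfl
  have hfix : ∀ l : Fin 3, blk r₁ r₂ r₃ l = 0 → Equiv.swap i k l = l := by
    intro l hl
    refine Equiv.swap_apply_of_ne_of_ne ?_ ?_
    · rintro rfl
      exact hi hl
    · rintro rfl
      exact hi (hik.trans hl)
  constructor
  · intro a b hab
    rw [ι_π, permMat, of_apply, one_apply]
    refine if_congr ?_ rfl rfl
    constructor
    · intro h
      have h0 : blk r₁ r₂ r₃ a = blk r₁ r₂ r₃ b := by rw [h, hb]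
      rw [h, hfix]
      exact h0 ▸ hab.resolve_left (not_not.2 h0)
    · rintro rfl
      exact (hfix a (hab.resolve_left (not_not.2 rfl))).symm
  · intro a b u
    rw [ι_π, permMat, of_apply]
    split_ifs <;> simp

/-- X contains the torus elements supported on one nontrivial coordinate, which kill the
off-diagonal entries of a central element. It also contains transpositions inside a block, which
make the diagonal entries of that block equal. -/
theorem OCenter_eq_blkTorus {ℓ r₁ r₂ r₃ : ℕ} {X : Subgroup G}
    (hX : ∀ x, x ∈ X ↔ m.IsLevi r₁ r₂ r₃ x) (ht : ∃ t : U, t ≠ 1) :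
    OCenter ℓ X = m.blkTorus ℓ r₁ r₂ r₃ := by
  classical
  ext x
  rw [mem_OCenter]
  constructor
  · rintro ⟨hx, hc, e, he⟩
    obtain ⟨t, ht⟩ := ht
    obtain ⟨hx1, hx2⟩ := (hX x).1 hx
    have hoff : ∀ i k, i ≠ k → m.ι x i k = 0 := by
      intro i k hik
      by_cases hi : blk r₁ r₂ r₃ i = 0
      · rw [hx1 i k (Or.inr hi), one_apply_ne hik]
      · have h1 := hc (m.δ (Pi.mulSingle i t)) ((hX _).2 (m.isLevi_δ fun l hl =>
          Pi.mulSingle_eq_of_ne (M := fun _ => U) (fun hli => hi (by rwa [← hli])) t))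
        have h2 := (m.mul_δ_eq_iff _ _ _).1 h1 i k
        rw [Pi.mulSingle_eq_same, Pi.mulSingle_eq_of_ne hik.symm] at h2
        exact m.eq_zero_of_intertwine _ _ _ h2 ht (by rwa [inv_one])
    have hdiag : ∀ i, ∃ u, m.j u = m.ι x i i := by
      intro i
      refine m.exists_of_norm_one _ (hx2 i i) ?_
      have h1 := congrFun (congrFun (m.ι_mul_star x) i) i
      rwa [one_apply_eq, Matrix.mul_apply, Finset.sum_eq_single i, star_apply] at h1
      · intro k _ hk
        rw [hoff i k hk.symm, zero_mul]
      · simp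
    choose u hu using hdiag
    have hxu : m.δ u = x := by
      apply m.ι_injective
      ext i k
      rw [ι_δ]
      by_cases hik : i = k
      · rw [hik, diagonal_apply_eq, hu]
      · rw [diagonal_apply_ne _ hik, hoff i k hik]
    rw [← hxu]
    refine m.δ_mem_blockTorus.2 ⟨fun i => ⟨e, ?_⟩, fun i hi => ?_, fun i k hik => ?_⟩
    · rw [← hxu, ← map_pow, ← map_one m.δ] at he
      exact congrFun (m.δ_injective he) i
    · apply m.j_injective
      rw [hu, hx1 i i (Or.inr hi), one_apply_eq, map_one]
    · by_cases hi : blk r₁ r₂ r₃ i = 0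
      · apply m.j_injective
        rw [hu, hu, hx1 i i (Or.inr hi), hx1 k k (Or.inr (hik.symm.trans hi)), one_apply_eq, one_apply_eq]
      · have h1 := hc _ ((hX _).2 (m.isLevi_π_swap hi hik))
        rw [← hxu, π_mul_δ] at h1
        have h2 := congrFun (m.δ_injective (mul_right_cancel h1)) i
        simpa using h2.symm
  · rintro ⟨u, hu, rfl⟩
    refine ⟨(hX _).2 (m.isLevi_δ hu.2.1), fun y hy => ?_, m.exists_pow_eq_one hu.1⟩
    obtain ⟨hy1, hy2⟩ := (hX y).1 hy
    refine ((m.mul_δ_eq_iff y u u).2 fun i k => ?_).symm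
    by_cases hik : blk r₁ r₂ r₃ i = blk r₁ r₂ r₃ k
    · rw [hu.2.2 i k hik]
      exact hy2 _ _ _
    · rw [hy1 i k (Or.inl hik), one_apply_ne (fun h => hik (by rw [h])), mul_zero, zero_mul]

theorem blkTorus_three (ℓ : ℕ) : m.blkTorus ℓ 3 0 0 = (ellPart ℓ U).map m.scal := by
  have hb : ∀ i : Fin 3, blk 3 0 0 i = 1 := fun i => if_pos i.2
  ext x
  constructor
  · rintro ⟨u, hu, rfl⟩
    refine ⟨u 0, hu.1 0, ?_⟩
    rw [scal_apply]
    congr 1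
    funext i
    exact hu.2.2 0 i ((hb 0).trans (hb i).symm)
  · rintro ⟨c, hc, rfl⟩
    refine ⟨fun _ => c, ⟨fun _ => hc, fun i hi => ?_, fun _ _ _ => rfl⟩, rfl⟩
    exact absurd ((hb i).symm.trans hi) one_ne_zero

theorem dω_pow (ω : U) (k : ℕ) : m.dω ω ^ k = m.dω (ω ^ k) := by
  rw [dω, dω, ← map_pow]
  congr 1
  funext i
  fin_cases i
  · simp
  · simp
  · simp [← pow_mul, mul_comm]

end TorusModel

/-! ### Matching of the matrix groups with the two torus models -/

section Identify

variable {F : Type*} [Field F] [Finite F] [CharP F 2]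

omit [Finite F] [CharP F 2] in
theorem spToGL_injective (n : ℕ) : Function.Injective (spToGL n F) := fun _ _ h =>
  Subtype.ext (congrArg Units.val h)

omit [Finite F] [CharP F 2] in
theorem quatEmb_eq_iff {g : Sp 3 F} {M : Matrix (Fin 3) (Fin 3) (Quat F)} :
    quatEmb F g = M ↔ g.1 = blockEquiv 3 F M := by
  rw [quatEmb_apply, RingEquiv.symm_apply_eq]

theorem resGL_eq_iff {A : GL (Fin 3) (Ext F (2 * 1))} {g : Sp 3 F} :
    resGL 3 F A = spToGL 3 F g ↔
      quatEmb F g = A.1.map (Algebra.leftMulMatrix (frame F 1)) := by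
  rw [quatEmb_eq_iff, ← Units.val_inj]
  exact eq_comm

omit [Finite F] [CharP F 2] in
theorem hyp_eq_iff {A : GL (Fin 3) F} {g : Sp 3 F} : hyp 3 F A = g ↔
    quatEmb F g = of fun i k => diagonal (Sum.elim (fun _ => A.1 i k) (fun _ => A⁻¹.1 k i)) := by
  rw [quatEmb_eq_iff, ← Subtype.val_inj, eq_comm]
  refine Eq.congr_right ?_
  ext (i | i) (k | k) <;> simp [blockEquiv_apply, hyp]

/-- Commuting with the split torus means that every quaternion entry is diagonal. The upper left
components then form a matrix A, and unitarity says that the lower right ones form ᵗA⁻¹. -/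
theorem mem_embPlus_levi (h : ∃ x : Fˣ, x ≠ 1) {r₁ r₂ r₃ : ℕ} (x : Sp 3 F) :
    x ∈ embPlus (levi F r₁ r₂ r₃) ↔ (splitModel F h).IsLevi r₁ r₂ r₃ x := by
  constructor
  · rintro ⟨A, hA, hx⟩
    have hA' : A⁻¹ ∈ levi F r₁ r₂ r₃ := inv_mem hA
    have hx' := hyp_eq_iff.1 hx
    constructor
    · intro i k hik
      change quatEmb F x i k = _
      rw [hx', of_apply, hA i k hik]
      have h1 : A⁻¹.1 k i = (1 : Matrix (Fin 3) (Fin 3) F) k i := by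
        apply hA'
        rcases hik with h | h
        · exact Or.inl h.symm
        · by_cases h2 : blk r₁ r₂ r₃ k = 0
          · exact Or.inr h2
          · exact Or.inl fun h3 => h2 (h3.trans h)
      rw [h1]
      by_cases hik : i = k
      · subst hik
        rw [one_apply_eq, one_apply_eq, quat_ext_iff]
        simp
      · rw [one_apply_ne hik, one_apply_ne hik, one_apply_ne (Ne.symm hik), quat_ext_iff]
        simp
    · intro i k u
      change splitEmb F u * quatEmb F x i k = quatEmb F x i k * splitEmb F u
      rw [hx', of_apply]
      exact splitEmb_comm_diag u (by simp) (by simp)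
  · rintro ⟨h1, h2⟩
    change ∀ i k u, splitEmb F u * quatEmb F x i k = quatEmb F x i k * splitEmb F u at h2
    obtain ⟨t, ht⟩ := h
    have h3 := fun i k => splitEmb_commute (fun h => ht (units_eq_one_of_eq_inv h)) (h2 i k t)
    have h4 := quatEmb_mul_star x
    let P : Matrix (Fin 3) (Fin 3) F := of fun i k => quatEmb F x i k (Sum.inl 0) (Sum.inl 0)
    let S : Matrix (Fin 3) (Fin 3) F := of fun i k => quatEmb F x k i (Sum.inr 0) (Sum.inr 0)
    have hPS : P * S = 1 := by
      ext i k
      have h5 := congrFun (congrFun (congrFun (congrFun h4 i) k) (Sum.inl 0)) (Sum.inl 0)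
      rw [Matrix.mul_apply, Matrix.sum_apply] at h5
      rw [Matrix.mul_apply]
      convert h5 using 1
      · refine Finset.sum_congr rfl fun l _ => ?_
        rw [Matrix.mul_apply]
        simp [(h3 i l).1, star_apply, star_quat, rev, P, S]
      · by_cases hik : i = k
        · subst hik
          simp
        · simp [hik]
    refine ⟨⟨P, S, hPS, mul_eq_one_comm.1 hPS⟩, ?_, ?_⟩
    · intro i k hik
      have h5 := (quat_ext_iff.1 (h1 i k hik)).1
      refine h5.trans ?_
      by_cases hik : i = k
      · subst hik
        simp
      · simp [hik]
    · rw [hyp_eq_iff]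
      ext1 i k
      rw [quat_ext_iff]
      simp [h3 i k, P, S]

theorem star_map_leftMulMatrix (E : Matrix (Fin 3) (Fin 3) (Ext F (2 * 1))) :
    star (E.map (Algebra.leftMulMatrix (frame F 1))) =
      (E.map fun x => x ^ Nat.card F)ᵀ.map (Algebra.leftMulMatrix (frame F 1)) := by
  ext1 i k
  rw [star_apply, map_apply, star_quat, rev_leftMulMatrix, pow_one]
  rfl

theorem mul_star_map_leftMulMatrix {E : Matrix (Fin 3) (Fin 3) (Ext F (2 * 1))} :
    E.map (Algebra.leftMulMatrix (frame F 1)) * star (E.map (Algebra.leftMulMatrix (frame F 1))) = 1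
      ↔ E * (E.map fun x => x ^ Nat.card F)ᵀ = 1 := by
  have hinj : Function.Injective
      ((Algebra.leftMulMatrix (frame F 1)).toRingHom.mapMatrix (m := Fin 3)) :=
    Matrix.map_injective (Algebra.leftMulMatrix_injective _)
  rw [star_map_leftMulMatrix, ← hinj.eq_iff, map_mul, map_one]
  rfl

/-- Commuting with the non-split torus means that every quaternion entry is a multiplication by an
element of F_{q²}; quaternionic unitarity then becomes the defining equation of `GU`. -/
theorem mem_embMinus_levi (h : ∃ x : NormOne F 1, x ≠ 1) {r₁ r₂ r₃ : ℕ} (x : Sp 3 F) :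
    x ∈ embMinus (levi (Ext F (2 * 1)) r₁ r₂ r₃) ↔ (normModel F h).IsLevi r₁ r₂ r₃ x := by
  have hone : ∀ i k, Algebra.leftMulMatrix (frame F 1)
      ((1 : Matrix (Fin 3) (Fin 3) (Ext F (2 * 1))) i k) =
        (1 : Matrix (Fin 3) (Fin 3) (Quat F)) i k := by
    intro i k
    by_cases hik : i = k
    · rw [hik, one_apply_eq, one_apply_eq, map_one]
    · rw [one_apply_ne hik, one_apply_ne hik, map_zero]
  constructor
  · rintro ⟨A, ⟨hA, -⟩, hx⟩
    have hx' := resGL_eq_iff.1 hx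
    constructor
    · intro i k hik
      change quatEmb F x i k = _
      rw [hx', map_apply, hA i k hik, hone]
    · intro i k u
      change Algebra.leftMulMatrix (frame F 1) _ * quatEmb F x i k =
        quatEmb F x i k * Algebra.leftMulMatrix (frame F 1) _
      rw [hx', map_apply]
      exact (map_mul _ _ _).symm.trans ((congrArg _ (mul_comm _ _)).trans (map_mul _ _ _))
  · rintro ⟨h1, h2⟩
    obtain ⟨t, ht⟩ := h
    choose E hE using fun i k => exists_eq_leftMulMatrix_of_commute ht (h2 i k t)
    have hx : quatEmb F x = (of E).map (Algebra.leftMulMatrix (frame F 1)) := by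
      ext1 i k
      exact hE i k
    have h4 := quatEmb_mul_star x
    rw [hx, mul_star_map_leftMulMatrix] at h4
    refine ⟨⟨of E, _, h4, mul_eq_one_comm.1 h4⟩, ⟨?_, h4⟩, resGL_eq_iff.2 hx⟩
    intro i k hik
    apply Algebra.leftMulMatrix_injective (frame F 1)
    rw [hone]
    exact (hE i k).symm.trans (h1 i k hik)

theorem Qr_one (h : ∃ x : Fˣ, x ≠ 1) (ℓ r₁ r₂ r₃ : ℕ) :
    Qr F ℓ 1 r₁ r₂ r₃ = (splitModel F h).blkTorus ℓ r₁ r₂ r₃ := by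
  rw [Qr, prodGL, if_pos rfl]
  exact TorusModel.OCenter_eq_blkTorus _ (mem_embPlus_levi h) h

theorem Qr_neg_one (h : ∃ x : NormOne F 1, x ≠ 1) (ℓ r₁ r₂ r₃ : ℕ) :
    Qr F ℓ (-1) r₁ r₂ r₃ = (normModel F h).blkTorus ℓ r₁ r₂ r₃ := by
  rw [Qr, prodGL, if_neg (by decide)]
  exact TorusModel.OCenter_eq_blkTorus _ (mem_embMinus_levi h) h

theorem eq_or_eq_of_cube_root {K : Type*} [Field K] [CharP K 2] {ω w : K} (hω : ω ^ 3 = 1)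
    (hω1 : ω ≠ 1) (hw : w ^ 2 + w + 1 = 0) : w = ω ∨ w = ω ^ 2 := by
  have h1 : ω ^ 2 + ω + 1 = 0 := by
    refine ((mul_eq_zero (a := ω - 1)).1 ?_).resolve_left (sub_ne_zero.2 hω1)
    linear_combination hω
  have h2 : (w - ω) * (w - ω ^ 2) = 0 := by linear_combination hw + hω - w * h1
  rcases mul_eq_zero.1 h2 with h | h
  · exact Or.inl (sub_eq_zero.1 h)
  · exact Or.inr (sub_eq_zero.1 h)

theorem cyc_matrix {K : Type*} [Field K] (i k : Fin 3) :
    (!![0, 0, 1; 1, 0, 0; 0, 1, 0] : Matrix (Fin 3) (Fin 3) K) i k =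
      if i = cyc k then 1 else 0 := by
  have h0 : cyc 0 = 1 := by decide
  have h1 : cyc 1 = 2 := by decide
  have h2 : cyc 2 = 0 := by decide
  fin_cases i <;> fin_cases k <;> simp [h0, h1, h2]

theorem R_one (h : ∃ x : Fˣ, x ≠ 1) {ω : Fˣ} (hω : ω ^ 3 = 1) (hω1 : ω ≠ 1) :
    R F 1 = (splitModel F h).extra ω := by
  have hd : ∀ (A : GL (Fin 3) F) (η : Fˣ), A.1 = diagonal ![1, (η : F), (η : F) ^ 2] →
      hyp 3 F A = (splitModel F h).dω η := by
    intro A η hA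
    have hA' : A⁻¹.1 = diagonal ![1, ((η⁻¹ : Fˣ) : F), ((η⁻¹ : Fˣ) : F) ^ 2] := by
      have h1 : A.1 * diagonal ![1, ((η⁻¹ : Fˣ) : F), ((η⁻¹ : Fˣ) : F) ^ 2] = 1 := by
        rw [hA, diagonal_mul_diagonal, ← diagonal_one]
        congr 1
        funext i
        fin_cases i <;> simp
      rw [← mul_one A⁻¹.1, ← h1, ← mul_assoc, Units.inv_mul, one_mul]
    rw [hyp_eq_iff]
    change (splitModel F h).ι _ = _
    rw [TorusModel.dω, TorusModel.ι_δ, hA, hA']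
    change diagonal (fun i => splitEmb F _) = _
    ext1 i k
    rw [quat_ext_iff]
    fin_cases i <;> fin_cases k <;> simp [splitEmb]
  have hs : ∀ A : GL (Fin 3) F, A.1 = !![0, 0, 1; 1, 0, 0; 0, 1, 0] →
      hyp 3 F A = (splitModel F h).s := by
    intro A hA
    have hA' : A⁻¹.1 = !![0, 0, 1; 1, 0, 0; 0, 1, 0]ᵀ := by
      have h1 : A.1 * !![0, 0, 1; 1, 0, 0; 0, 1, 0]ᵀ = 1 := by
        rw [hA]
        ext i k
        fin_cases i <;> fin_cases k <;> simp [Matrix.mul_apply, Fin.sum_univ_three]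
      rw [← mul_one A⁻¹.1, ← h1, ← mul_assoc, Units.inv_mul, one_mul]
    rw [hyp_eq_iff]
    change (splitModel F h).ι _ = _
    rw [TorusModel.s, TorusModel.ι_π, hA, hA']
    ext1 i k
    rw [quat_ext_iff, of_apply, transpose_apply, cyc_matrix, TorusModel.permMat, of_apply]
    split_ifs <;> simp
  rw [R, Qr_one h, if_pos rfl, TorusModel.blkTorus_three, TorusModel.extra]
  congr 1
  apply le_antisymm
  · rw [embPlus, Subgroup.map_le_iff_le_comap, extraspecial, Subgroup.closure_le]
    rintro A (⟨w, hw, hA⟩ | hA)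
    -- `extraspecial` admits either primitive cube root of unity; both are powers of the chosen ω.
    · obtain ⟨k, rfl⟩ : ∃ k : ℕ, w = ((ω ^ k : Fˣ) : F) := by
        rcases eq_or_eq_of_cube_root (by rw [← Units.val_pow_eq_pow_val, hω, Units.val_one])
          (fun h => hω1 (Units.ext h)) hw with h | h
        · exact ⟨1, by rw [h, pow_one]⟩
        · exact ⟨2, by rw [h, Units.val_pow_eq_pow_val]⟩
      refine Subgroup.mem_sup_left ?_
      rw [hd A _ hA, ← TorusModel.dω_pow]
      exact pow_mem (Subgroup.mem_zpowers _) k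
    · refine Subgroup.mem_sup_right ?_
      rw [hs A hA]
      exact Subgroup.mem_zpowers _
  · rw [sup_le_iff, Subgroup.zpowers_le, Subgroup.zpowers_le]
    constructor
    · have h1 : (ω : F) ^ 2 + ω + 1 = 0 := by
        refine ((mul_eq_zero (a := (ω : F) - 1)).1 ?_).resolve_left
          (sub_ne_zero.2 fun h => hω1 (Units.ext h))
        have : (ω : F) ^ 3 = 1 := by rw [← Units.val_pow_eq_pow_val, hω, Units.val_one]
        linear_combination this
      have hdet : IsUnit (diagonal ![1, (ω : F), (ω : F) ^ 2]) := by
        rw [Matrix.isUnit_iff_isUnit_det, det_diagonal]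
        simp [Fin.prod_univ_three]
      exact ⟨hdet.unit, Subgroup.subset_closure (Or.inl ⟨ω, h1, hdet.unit_spec⟩),
        hd _ _ hdet.unit_spec⟩
    · have hdet : IsUnit (!![0, 0, 1; 1, 0, 0; 0, 1, 0] : Matrix (Fin 3) (Fin 3) F) := by
        rw [Matrix.isUnit_iff_isUnit_det, det_fin_three]
        simp
      exact ⟨hdet.unit, Subgroup.subset_closure (Or.inr hdet.unit_spec), hs _ hdet.unit_spec⟩

theorem R_neg_one (h : ∃ x : NormOne F 1, x ≠ 1) {ω : NormOne F 1} (hω : ω ^ 3 = 1)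
    (hω1 : ω ≠ 1) : R F (-1) = (normModel F h).extra ω := by
  have hv : ∀ η : NormOne F 1, ∀ k : ℕ, (((η ^ k : NormOne F 1) : (Ext F (2 * 1))ˣ) :
      Ext F (2 * 1)) = ((η : (Ext F (2 * 1))ˣ) : Ext F (2 * 1)) ^ k := fun η k => by
    simp
  have hω' : ((ω : (Ext F (2 * 1))ˣ) : Ext F (2 * 1)) ^ 3 = 1 := by
    rw [← hv, hω]
    rfl
  have hω1' : ((ω : (Ext F (2 * 1))ˣ) : Ext F (2 * 1)) ≠ 1 := fun h =>
    hω1 (Subtype.ext (Units.ext h))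
  have hd : ∀ (A : GL (Fin 3) (Ext F (2 * 1))) (η : NormOne F 1),
      A.1 = diagonal ![1, ((η : (Ext F (2 * 1))ˣ) : Ext F (2 * 1)),
        ((η : (Ext F (2 * 1))ˣ) : Ext F (2 * 1)) ^ 2] →
      resGL 3 F A = spToGL 3 F ((normModel F h).dω η) := by
    intro A η hA
    rw [resGL_eq_iff]
    change (normModel F h).ι _ = _
    rw [TorusModel.dω, TorusModel.ι_δ, hA]
    change diagonal (fun i => Algebra.leftMulMatrix (frame F 1) _) = _
    rw [diagonal_map (map_zero _)]
    congr 1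
    funext i
    fin_cases i <;> simp
  have hs : ∀ A : GL (Fin 3) (Ext F (2 * 1)), A.1 = !![0, 0, 1; 1, 0, 0; 0, 1, 0] →
      resGL 3 F A = spToGL 3 F (normModel F h).s := by
    intro A hA
    rw [resGL_eq_iff]
    change (normModel F h).ι _ = _
    rw [TorusModel.s, TorusModel.ι_π, hA]
    ext1 i k
    rw [map_apply, cyc_matrix, TorusModel.permMat, of_apply]
    split_ifs
    · rw [map_one]
    · rw [map_zero]
  have hGU : ∀ (A : GL (Fin 3) (Ext F (2 * 1))) (g : Sp 3 F), resGL 3 F A = spToGL 3 F g →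
      A ∈ GU 3 F := by
    intro A g hA
    have h1 := quatEmb_mul_star g
    rwa [resGL_eq_iff.1 hA, mul_star_map_leftMulMatrix] at h1
  rw [R, Qr_neg_one h, if_neg (by decide), TorusModel.blkTorus_three, TorusModel.extra]
  congr 1
  apply le_antisymm
  · rintro g ⟨A, ⟨hA, -⟩, hg⟩
    have hle : extraspecial (Ext F (2 * 1)) ≤ (((Subgroup.zpowers ((normModel F h).dω ω) ⊔
        Subgroup.zpowers (normModel F h).s)).map (spToGL 3 F)).comap (resGL 3 F) := by
      rw [extraspecial, Subgroup.closure_le]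
      rintro A (⟨w, hw, hA⟩ | hA)
      · obtain ⟨k, rfl⟩ : ∃ k : ℕ, w = (((ω ^ k : NormOne F 1) : (Ext F (2 * 1))ˣ) :
            Ext F (2 * 1)) := by
          rcases eq_or_eq_of_cube_root hω' hω1' hw with h | h
          · exact ⟨1, by rw [h, hv]; exact (pow_one _).symm⟩
          · exact ⟨2, by rw [h, hv]⟩
        refine ⟨_, Subgroup.mem_sup_left ?_, (hd A _ hA).symm⟩
        rw [← TorusModel.dω_pow]
        exact pow_mem (Subgroup.mem_zpowers _) k
      · exact ⟨_, Subgroup.mem_sup_right (Subgroup.mem_zpowers _), (hs A hA).symm⟩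
    obtain ⟨g', hg', h2⟩ := hle hA
    rwa [← spToGL_injective 3 (h2.trans hg)]
  · rw [sup_le_iff, Subgroup.zpowers_le, Subgroup.zpowers_le]
    constructor
    · have h1 : ((ω : (Ext F (2 * 1))ˣ) : Ext F (2 * 1)) ^ 2 +
          ((ω : (Ext F (2 * 1))ˣ) : Ext F (2 * 1)) + 1 = 0 := by
        refine ((mul_eq_zero (a := ((ω : (Ext F (2 * 1))ˣ) : Ext F (2 * 1)) - 1)).1
          ?_).resolve_left (sub_ne_zero.2 hω1')
        linear_combination hω'
      have hdet : IsUnit (diagonal ![1, ((ω : (Ext F (2 * 1))ˣ) : Ext F (2 * 1)),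
          ((ω : (Ext F (2 * 1))ˣ) : Ext F (2 * 1)) ^ 2]) := by
        rw [Matrix.isUnit_iff_isUnit_det, det_diagonal]
        simp [Fin.prod_univ_three]
      exact ⟨hdet.unit, ⟨Subgroup.subset_closure (Or.inl ⟨_, h1, hdet.unit_spec⟩),
        hGU _ _ (hd _ _ hdet.unit_spec)⟩, hd _ _ hdet.unit_spec⟩
    · have hdet : IsUnit (!![0, 0, 1; 1, 0, 0; 0, 1, 0] :
          Matrix (Fin 3) (Fin 3) (Ext F (2 * 1))) := by
        rw [Matrix.isUnit_iff_isUnit_det, det_fin_three]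
        simp
      exact ⟨hdet.unit, ⟨Subgroup.subset_closure (Or.inr hdet.unit_spec),
        hGU _ _ (hs _ hdet.unit_spec)⟩, hs _ hdet.unit_spec⟩

end Identify

/-! ### The order of the symplectic group -/

section Count

variable {F V : Type*} [Field F] [AddCommGroup V] [Module F V]

/-- The families with standard symplectic Gram matrix. -/
abbrev Fam (B : LinearMap.BilinForm F V) (n : ℕ) : Type _ :=
  {v : Fin n ⊕ Fin n → V // ∀ i j, B (v i) (v j) = J (Fin n) F i j}

/-- The orthogonal space of a pair of vectors. -/
def perp (B : LinearMap.BilinForm F V) (p : V × V) : Submodule F V :=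
  LinearMap.ker ((B p.1).prod (B p.2))

theorem mem_perp {B : LinearMap.BilinForm F V} {p : V × V} {z : V} :
    z ∈ perp B p ↔ B p.1 z = 0 ∧ B p.2 z = 0 := by
  exact Prod.mk_eq_zero

theorem J_inl_inl {n : ℕ} (i j : Fin n) : J (Fin n) F (Sum.inl i) (Sum.inl j) = 0 := by simp [J]
theorem J_inr_inr {n : ℕ} (i j : Fin n) : J (Fin n) F (Sum.inr i) (Sum.inr j) = 0 := by simp [J]
theorem J_inl_inr {n : ℕ} (i j : Fin n) :
    J (Fin n) F (Sum.inl i) (Sum.inr j) = if i = j then -1 else 0 := by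
  simp [J, Matrix.one_apply, apply_ite]
theorem J_inr_inl {n : ℕ} (i j : Fin n) :
    J (Fin n) F (Sum.inr i) (Sum.inl j) = if i = j then 1 else 0 := by
  simp [J, Matrix.one_apply]

theorem J_succ {n : ℕ} (i j : Fin n ⊕ Fin n) :
    J (Fin (n + 1)) F (Sum.map Fin.succ Fin.succ i) (Sum.map Fin.succ Fin.succ j) =
      J (Fin n) F i j := by
  rcases i with i | i <;> rcases j with j | j <;>
    simp [J_inl_inl, J_inr_inr, J_inl_inr, J_inr_inl]

/-- Splitting off the first hyperbolic pair. -/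
def famFiberEquiv {B : LinearMap.BilinForm F V} (hB : B.IsAlt) (n : ℕ)
    (p : {p : V × V // B p.1 p.2 = -1}) :
    {v : Fam B (n + 1) // (v.1 (Sum.inl 0), v.1 (Sum.inr 0)) = p.1} ≃
      Fam (B.restrict (perp B p.1)) n where
  toFun v := ⟨fun i => ⟨v.1.1 (Sum.map Fin.succ Fin.succ i), by
      rw [mem_perp, ← congrArg Prod.fst v.2, ← congrArg Prod.snd v.2]
      rcases i with i | i <;>
        simp [v.1.2, J_inl_inl, J_inr_inr, J_inl_inr, J_inr_inl, (Fin.succ_ne_zero i).symm]⟩,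
    fun i j => (v.1.2 _ _).trans (J_succ i j)⟩
  invFun w := ⟨⟨Sum.elim (Fin.cons p.1.1 fun i => (w.1 (Sum.inl i)).1)
      (Fin.cons p.1.2 fun i => (w.1 (Sum.inr i)).1), by
      have h1 : ∀ i, B p.1.1 (w.1 i).1 = 0 := fun i => (mem_perp.1 (w.1 i).2).1
      have h2 : ∀ i, B p.1.2 (w.1 i).1 = 0 := fun i => (mem_perp.1 (w.1 i).2).2
      have h1' : ∀ i, B (w.1 i).1 p.1.1 = 0 := fun i => by rw [← hB.neg_eq, h1, neg_zero]
      have h2' : ∀ i, B (w.1 i).1 p.1.2 = 0 := fun i => by rw [← hB.neg_eq, h2, neg_zero]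
      have h3 : ∀ i j, B (w.1 i).1 (w.1 j).1 = J (Fin n) F i j := w.2
      have h4 : B p.1.2 p.1.1 = 1 := by rw [← hB.neg_eq, p.2, neg_neg]
      have h5 : ∀ x, B x x = 0 := hB
      rintro (i | i) (j | j) <;> refine Fin.cases ?_ (fun i => ?_) i <;>
        refine Fin.cases ?_ (fun j => ?_) j <;>
        simp [h1, h2, h1', h2', h3, h4, h5, p.2, J_inl_inl, J_inr_inr, J_inl_inr, J_inr_inl,
          (Fin.succ_ne_zero _).symm]⟩, by simp⟩
  left_inv v := by
    refine Subtype.ext (Subtype.ext (funext fun i => ?_))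
    rcases i with i | i <;> refine Fin.cases ?_ (fun i => ?_) i
    · simp [← v.2]
    · simp
    · simp [← v.2]
    · simp
  right_inv w := by
    refine Subtype.ext (funext fun i => Subtype.ext ?_)
    rcases i with i | i <;> simp

theorem perp_surjective {B : LinearMap.BilinForm F V} (hB : B.IsAlt) {p : V × V}
    (hp : B p.1 p.2 = -1) : Function.Surjective ((B p.1).prod (B p.2)) := by
  rintro ⟨a, b⟩
  have h4 : B p.2 p.1 = 1 := by rw [← hB.neg_eq, hp, neg_neg]
  have h5 : ∀ x, B x x = 0 := hB
  refine ⟨b • p.1 - a • p.2, ?_⟩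
  simp [hp, h4, h5]

theorem finrank_perp [FiniteDimensional F V] {B : LinearMap.BilinForm F V} (hB : B.IsAlt) {p : V × V}
    (hp : B p.1 p.2 = -1) : Module.finrank F (perp B p) + 2 = Module.finrank F V := by
  have h := LinearMap.finrank_range_add_finrank_ker ((B p.1).prod (B p.2))
  rw [LinearMap.range_eq_top.2 (perp_surjective hB hp), finrank_top, Module.finrank_prod,
    Module.finrank_self] at h
  rw [perp]
  omega

theorem nondegenerate_perp {B : LinearMap.BilinForm F V} (hB : B.IsAlt) (hn : B.Nondegenerate)
    {p : V × V} (hp : B p.1 p.2 = -1) : (B.restrict (perp B p)).Nondegenerate := by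
  have h4 : B p.2 p.1 = 1 := by rw [← hB.neg_eq, hp, neg_neg]
  have h5 : ∀ x, B x x = 0 := hB
  have key : ∀ z : perp B p, (∀ w : perp B p, B z.1 w.1 = 0) → z = 0 := by
    intro z hz
    obtain ⟨hz1, hz2⟩ := mem_perp.1 z.2
    refine Subtype.ext (hn.1 z.1 fun u => ?_)
    -- The projection of u along the hyperbolic pair; z is orthogonal to the pair, so B z does not
    -- see the correction.
    have h1 : u + B p.1 u • p.2 - B p.2 u • p.1 ∈ perp B p := by
      rw [mem_perp]
      simp [hp, h4, h5]
    have h2 := hz ⟨_, h1⟩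
    have hz1' : B z.1 p.1 = 0 := by rw [← hB.neg_eq, hz1, neg_zero]
    have hz2' : B z.1 p.2 = 0 := by rw [← hB.neg_eq, hz2, neg_zero]
    simpa [hz1', hz2'] using h2
  refine ⟨key, fun z hz => key z fun w => ?_⟩
  rw [← hB.neg_eq]
  exact neg_eq_zero.2 (hz w)

variable [FiniteDimensional F V]

theorem card_dual_fiber {f : V →ₗ[F] F} (hf : f ≠ 0) (a : F) :
    Nat.card {y // f y = a} = Nat.card F ^ (Module.finrank F V - 1) := by
  have hs : Function.Surjective f := LinearMap.surjective hf
  obtain ⟨y₀, hy₀⟩ := hs a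
  have h1 : Nat.card {y // f y = a} = Nat.card (LinearMap.ker f) := by
    refine Nat.card_congr ((Equiv.subRight y₀).subtypeEquiv fun y => ?_)
    rw [LinearMap.mem_ker, Equiv.subRight_apply, map_sub, hy₀, sub_eq_zero]
  have h2 := LinearMap.finrank_range_add_finrank_ker f
  rw [LinearMap.range_eq_top.2 hs, finrank_top, Module.finrank_self] at h2
  rw [h1, Module.natCard_eq_pow_finrank (K := F), ← h2, Nat.add_sub_cancel_left]

theorem card_pairs [Finite F] {B : LinearMap.BilinForm F V} (hn : B.Nondegenerate) :
    Nat.card {p : V × V // B p.1 p.2 = -1} =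
      (Nat.card F ^ Module.finrank F V - 1) * Nat.card F ^ (Module.finrank F V - 1) := by
  classical
  have : Finite V := Module.finite_of_finite F
  have : Fintype V := Fintype.ofFinite V
  have e : {p : V × V // B p.1 p.2 = -1} ≃ Σ x : {x : V // x ≠ 0}, {y // B x.1 y = -1} :=
    { toFun := fun p => ⟨⟨p.1.1, fun h => by simpa [h] using p.2⟩, p.1.2, p.2⟩
      invFun := fun p => ⟨(p.1.1, p.2.1), p.2.2⟩
      left_inv := fun _ => rfl
      right_inv := fun _ => rfl }
  have h0 : ∀ x : {x : V // x ≠ 0}, B x.1 ≠ 0 := fun x h => x.2 (hn.1 _ fun y => by simp [h])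
  rw [Nat.card_congr e, Nat.card_sigma]
  simp only [card_dual_fiber (h0 _), Finset.sum_const, smul_eq_mul]
  congr 1
  rw [Finset.card_univ, Fintype.card_subtype_compl, Fintype.card_subtype_eq,
    ← Nat.card_eq_fintype_card, Module.natCard_eq_pow_finrank (K := F)]

end Count

/-- The hyperbolic pair split off from dimension 2n can be chosen in (q^(2n) - 1) q^(2n-1) ways, and
the remaining vectors form such a family in its orthogonal space, which is nondegenerate of
dimension 2n - 2. -/
theorem card_fam {F : Type*} [Field F] [Finite F] (n : ℕ) : ∀ {V : Type*} [AddCommGroup V]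
    [Module F V] [FiniteDimensional F V] (B : LinearMap.BilinForm F V), B.IsAlt →
    B.Nondegenerate → Module.finrank F V = 2 * n → Nat.card (Fam B n) =
      ∏ i ∈ Finset.range n, (Nat.card F ^ (2 * (i + 1)) - 1) * Nat.card F ^ (2 * i + 1) := by
  induction n with
  | zero =>
    intro V _ _ _ B _ _ _
    rw [Finset.prod_range_zero, Nat.card_eq_one_iff_unique]
    exact ⟨⟨fun a b => Subtype.ext (funext fun i => i.elim Fin.elim0 Fin.elim0)⟩,
      ⟨⟨fun i => i.elim Fin.elim0 Fin.elim0, fun i => i.elim Fin.elim0 Fin.elim0⟩⟩⟩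
  | succ n ih =>
    intro V _ _ _ B hB hn hV
    have : Finite V := Module.finite_of_finite F
    have : Fintype {p : V × V // B p.1 p.2 = -1} := Fintype.ofFinite _
    let f : Fam B (n + 1) → {p : V × V // B p.1 p.2 = -1} := fun v =>
      ⟨(v.1 (Sum.inl 0), v.1 (Sum.inr 0)), by rw [v.2, J_inl_inr, if_pos rfl]⟩
    have hfib : ∀ p, Nat.card {v // f v = p} =
        ∏ i ∈ Finset.range n, (Nat.card F ^ (2 * (i + 1)) - 1) * Nat.card F ^ (2 * i + 1) := by
      intro p
      have h1 := finrank_perp hB p.2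
      rw [← ih (B.restrict (perp B p.1)) (fun x => hB x.1) (nondegenerate_perp hB hn p.2) (by omega)]
      refine Nat.card_congr (Equiv.trans (Equiv.subtypeEquivRight fun v => ?_)
        (famFiberEquiv hB n p))
      exact Subtype.ext_iff
    rw [← Nat.card_congr (Equiv.sigmaFiberEquiv f), Nat.card_sigma]
    simp only [hfib, Finset.sum_const, smul_eq_mul]
    rw [Finset.card_univ, ← Nat.card_eq_fintype_card, card_pairs hn, hV, Finset.prod_range_succ,
      mul_comm]
    rfl

theorem card_sp {F : Type*} [Field F] [Finite F] (n : ℕ) : Nat.card (Sp n F) =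
      ∏ i ∈ Finset.range n, (Nat.card F ^ (2 * (i + 1)) - 1) * Nat.card F ^ (2 * i + 1) := by
  have hfin : Module.finrank F (Fin n ⊕ Fin n → F) = 2 * n := by simp [two_mul]
  have hB : ∀ x y, Matrix.toBilin' (J (Fin n) F) x y = x ⬝ᵥ J (Fin n) F *ᵥ y :=
    fun x y => Matrix.toBilin'_apply' _ _ _
  rw [← card_fam n (Matrix.toBilin' (J (Fin n) F)) ?_ ?_ hfin]
  -- The equation A J ᵗA = J says that the rows of A have the standard Gram matrix.
  · refine Nat.card_congr (Equiv.subtypeEquivRight fun A => ?_)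
    rw [SymplecticGroup.mem_iff, ← Matrix.ext_iff]
    refine forall_congr' fun i => forall_congr' fun j => ?_
    rw [hB, mul_assoc, Matrix.mul_apply]
    rfl
  · intro x
    rw [hB]
    simp [J, dotProduct, fromBlocks_mulVec, Matrix.neg_mulVec, mul_comm]
  · exact LinearMap.BilinForm.nondegenerate_toBilin'_of_det_ne_zero' _
      (isUnit_det_J (Fin n) F).ne_zero

/-! ### Sylow arguments -/

/-- The hypotheses make S a Sylow subgroup of K. A divisibility bound on |K| suffices, which is all
that is proved for H. -/
theorem exists_conj_le {G : Type*} [Group G] [Finite G] {ℓ : ℕ} [Fact ℓ.Prime] {K S Q : Subgroup G}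
    (hS : IsPGroup ℓ S) (hSK : S ≤ K) {n : ℕ} (hn : ¬ ℓ ∣ n)
    (hK : Nat.card K ∣ Nat.card S * n) (hQ : IsPGroup ℓ Q) (hQK : Q ≤ K) :
    ∃ k ∈ K, Q.map (MulAut.conj k).toMonoidHom ≤ S := by
  have hcard : Nat.card (S.subgroupOf K) = Nat.card S :=
    Nat.card_congr (Subgroup.subgroupOfEquivOfLe hSK).toEquiv
  have hidx : ¬ ℓ ∣ (S.subgroupOf K).index := by
    have h1 := (S.subgroupOf K).card_mul_index
    rw [hcard] at h1
    rw [← h1] at hK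
    exact fun h => hn (h.trans (Nat.dvd_of_mul_dvd_mul_left Nat.card_pos hK))
  have hS' : IsPGroup ℓ (S.subgroupOf K) := hS.comap_subtype
  have hQ' : IsPGroup ℓ (Q.subgroupOf K) := hQ.comap_subtype
  obtain ⟨T, hT⟩ := hQ'.exists_le_sylow
  obtain ⟨k, hk⟩ := MulAction.exists_smul_eq K T (hS'.toSylow hidx)
  refine ⟨k, k.2, ?_⟩
  rintro _ ⟨x, hx, rfl⟩
  have h1 : k * ⟨x, hQK hx⟩ * k⁻¹ ∈ k • T := by
    rw [← SetLike.mem_coe, Sylow.coe_smul]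
    exact ⟨⟨x, hQK hx⟩, hT hx, rfl⟩
  rw [hk] at h1
  exact h1

theorem not_dvd_index_ellPart {ℓ : ℕ} (hℓ : ℓ.Prime) {U : Type*} [CommGroup U] [Finite U] :
    ¬ ℓ ∣ (ellPart ℓ U).index := by
  intro h
  have : Fact ℓ.Prime := ⟨hℓ⟩
  obtain ⟨x, hx⟩ := exists_prime_orderOf_dvd_card' ℓ (G := U ⧸ ellPart ℓ U) h
  obtain ⟨u, rfl⟩ := QuotientGroup.mk_surjective x
  have h1 : (QuotientGroup.mk u : U ⧸ ellPart ℓ U) ^ ℓ = 1 := by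
    have := pow_orderOf_eq_one (QuotientGroup.mk u : U ⧸ ellPart ℓ U)
    rwa [hx] at this
  rw [← QuotientGroup.mk_pow, QuotientGroup.eq_one_iff] at h1
  obtain ⟨k, hk⟩ := h1
  have h2 : (QuotientGroup.mk u : U ⧸ ellPart ℓ U) = 1 := by
    rw [QuotientGroup.eq_one_iff]
    exact ⟨k + 1, by rw [pow_succ', pow_mul, hk]⟩
  rw [h2, orderOf_one] at hx
  exact hℓ.one_lt.ne hx

theorem isPGroup_ellPart (ℓ : ℕ) (U : Type*) [CommGroup U] : IsPGroup ℓ (ellPart ℓ U) := by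
  rintro ⟨u, k, hk⟩
  exact ⟨k, Subtype.ext hk⟩

theorem exists_mem_ellPart_ne_one {ℓ : ℕ} (hℓ : ℓ.Prime) {U : Type*} [CommGroup U] [Finite U]
    (h : ℓ ∣ Nat.card U) : ∃ u ∈ ellPart ℓ U, u ≠ 1 := by
  have : Fact ℓ.Prime := ⟨hℓ⟩
  obtain ⟨x, hx⟩ := exists_prime_orderOf_dvd_card' ℓ h
  refine ⟨x, ⟨1, by rw [pow_one, ← hx, pow_orderOf_eq_one]⟩, ?_⟩
  rintro rfl
  rw [orderOf_one] at hx
  exact hℓ.one_lt.ne hx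

section Orders

variable {F : Type*} [Field F] [Finite F]

/-- With A = q² - 1 the order formulas become polynomial identities without truncated subtraction:
q⁴ - 1 = A(A + 2) and q⁶ - 1 = A(A² + 3A + 3). -/
theorem exists_card_sq_eq : ∃ A, 0 < A ∧ Nat.card F ^ 2 = A + 1 :=
  ⟨Nat.card F ^ 2 - 1, Nat.sub_pos_of_lt (Nat.one_lt_pow two_ne_zero Finite.one_lt_card),
    (Nat.sub_add_cancel (Nat.one_le_pow _ _ Nat.card_pos)).symm⟩

theorem card_sp_three {A : ℕ} (hA : Nat.card F ^ 2 = A + 1) : Nat.card (Sp 3 F) =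
    A ^ 3 * ((A + 2) * (A ^ 2 + 3 * A + 3) * Nat.card F ^ 9) := by
  have h4 : Nat.card F ^ 4 - 1 = A * (A + 2) := by
    rw [show Nat.card F ^ 4 = (Nat.card F ^ 2) ^ 2 by ring, hA]
    exact Nat.sub_eq_of_eq_add (by ring)
  have h6 : Nat.card F ^ 6 - 1 = A * (A ^ 2 + 3 * A + 3) := by
    rw [show Nat.card F ^ 6 = (Nat.card F ^ 2) ^ 3 by ring, hA]
    exact Nat.sub_eq_of_eq_add (by ring)
  rw [card_sp, Finset.prod_range_succ, Finset.prod_range_succ, Finset.prod_range_one]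
  norm_num only
  rw [h4, h6, hA, Nat.add_sub_cancel]
  ring

theorem card_sp_two {A : ℕ} (hA : Nat.card F ^ 2 = A + 1) : Nat.card (Sp 2 F) =
    A ^ 2 * ((A + 2) * Nat.card F ^ 4) := by
  have h4 : Nat.card F ^ 4 - 1 = A * (A + 2) := by
    rw [show Nat.card F ^ 4 = (Nat.card F ^ 2) ^ 2 by ring, hA]
    exact Nat.sub_eq_of_eq_add (by ring)
  rw [card_sp, Finset.prod_range_succ, Finset.prod_range_one]
  norm_num only
  rw [h4, hA, Nat.add_sub_cancel]
  ring

omit [Field F] [Finite F] in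
theorem not_dvd_of_sq_eq {ℓ A q : ℕ} (hℓ : ℓ.Prime) (hℓ2 : ℓ ≠ 2) (hA : q ^ 2 = A + 1)
    (hd : ℓ ∣ A) : ¬ ℓ ∣ A + 2 ∧ ¬ ℓ ∣ q := by
  constructor
  · rw [Nat.dvd_add_right hd]
    exact fun h => hℓ2 ((Nat.prime_dvd_prime_iff_eq hℓ Nat.prime_two).1 h)
  · intro h
    have h1 : ℓ ∣ A + 1 := hA ▸ dvd_pow h two_ne_zero
    rw [Nat.dvd_add_right hd] at h1
    exact hℓ.one_lt.ne' (Nat.dvd_one.1 h1)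

end Orders

/-! ### The stabilizer of a hyperbolic pair -/

section Stabilizer

variable {F : Type*} [Field F]

theorem mem_H_iff {g : Sp 3 F} : g ∈ H F ↔
    (∀ x, g.1 x (Sum.inl 2) = (1 : Matrix (Fin 3 ⊕ Fin 3) (Fin 3 ⊕ Fin 3) F) x (Sum.inl 2)) ∧
    ∀ x, g.1 x (Sum.inr 2) = (1 : Matrix (Fin 3 ⊕ Fin 3) (Fin 3 ⊕ Fin 3) F) x (Sum.inr 2) := by
  change (_ ∧ _) ↔ _
  rw [Matrix.mulVec_single_one, Matrix.mulVec_single_one, funext_iff, funext_iff]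
  simp only [col_apply, one_apply, Pi.single_apply]

theorem mem_H_iff_quatEmb {g : Sp 3 F} : g ∈ H F ↔
    ∀ i, quatEmb F g i 2 = (1 : Matrix (Fin 3) (Fin 3) (Quat F)) i 2 := by
  rw [mem_H_iff]
  have h1 : ∀ i k, (1 : Matrix (Fin 3) (Fin 3) (Quat F)) i k = if i = k then 1 else 0 :=
    fun i k => one_apply
  constructor
  · rintro ⟨hl, hr⟩ i
    rw [quat_ext_iff, h1]
    have l1 := hl (Sum.inl i)
    have l2 := hl (Sum.inr i)
    have r1 := hr (Sum.inl i)
    have r2 := hr (Sum.inr i)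
    simp only [← blockEquiv_quatEmb g, blockEquiv_apply, Sum.elim_inl, Sum.elim_inr, Sum.map_inl,
      Sum.map_inr, id, one_apply, Sum.inl.injEq, Sum.inr.injEq, reduceCtorEq, if_false] at l1 l2 r1 r2
    rw [l1, l2, r1, r2]
    split_ifs <;> simp
  · intro h
    rw [← blockEquiv_quatEmb g]
    constructor <;> rintro (i | i) <;>
    · rw [blockEquiv_apply]
      simp only [Sum.elim_inl, Sum.elim_inr, id, h, h1]
      by_cases hi : i = 2 <;> simp [hi, one_apply]

/-- As `rev g * g = 1`, the fixed vectors e_3 and f_3 also determine the corresponding rows: g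
preserves the orthogonal space of the pair. -/
theorem inr_of_inl {g : Sp 3 F} [CharP F 2] (hg : g ∈ H F) :
    (∀ y, g.1 (Sum.inl 2) y = (1 : Matrix (Fin 3 ⊕ Fin 3) (Fin 3 ⊕ Fin 3) F) (Sum.inl 2) y) ∧
      ∀ y, g.1 (Sum.inr 2) y = (1 : Matrix (Fin 3 ⊕ Fin 3) (Fin 3 ⊕ Fin 3) F) (Sum.inr 2) y := by
  obtain ⟨hl, hr⟩ := mem_H_iff.1 hg
  have h1 := mul_eq_one_comm.1 ((mem_symplecticGroup_iff _).1 g.2)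
  constructor <;> intro y
  · rw [← h1, Matrix.mul_apply]
    simp [rev, hr, one_apply]
  · rw [← h1, Matrix.mul_apply]
    simp [rev, hl, one_apply]

/-- The inclusion of the index set of `Sp_4` into that of `Sp_6`. -/
def idx : Fin 2 ⊕ Fin 2 → Fin 3 ⊕ Fin 3 := Sum.map Fin.castSucc Fin.castSucc

theorem sum_idx {M : Type*} [AddCommMonoid M] (f : Fin 3 ⊕ Fin 3 → M) :
    ∑ z, f z = ∑ z, f (idx z) + (f (Sum.inl 2) + f (Sum.inr 2)) := by
  rw [Fintype.sum_sum_type, Fintype.sum_sum_type, Fin.sum_univ_castSucc fun i => f (Sum.inl i),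
    Fin.sum_univ_castSucc fun i => f (Sum.inr i), add_add_add_comm]
  rfl

theorem submatrix_idx_mul {A : Matrix (Fin 3 ⊕ Fin 3) (Fin 3 ⊕ Fin 3) F}
    (B : Matrix (Fin 3 ⊕ Fin 3) (Fin 3 ⊕ Fin 3) F)
    (h1 : ∀ a, A (idx a) (Sum.inl 2) = 0) (h2 : ∀ a, A (idx a) (Sum.inr 2) = 0) :
    (A * B).submatrix idx idx = A.submatrix idx idx * B.submatrix idx idx := by
  ext a b
  rw [submatrix_apply, Matrix.mul_apply, Matrix.mul_apply, sum_idx, h1, h2, zero_mul, zero_mul,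
    add_zero, add_zero]
  rfl

theorem idx_injective : Function.Injective idx :=
  Sum.map_injective.2 ⟨Fin.castSucc_injective _, Fin.castSucc_injective _⟩

theorem idx_ne (a : Fin 2 ⊕ Fin 2) : idx a ≠ Sum.inl 2 ∧ idx a ≠ Sum.inr 2 := by
  revert a
  decide

theorem exists_idx_or (x : Fin 3 ⊕ Fin 3) : (∃ a, x = idx a) ∨ x = Sum.inl 2 ∨ x = Sum.inr 2 := by
  revert x
  decide

variable [CharP F 2]

variable (F) in
/-- The restriction of the stabilizer of `e_3, f_3` to the span of the other basis vectors. -/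
def resH : H F →* Sp 2 F where
  toFun g := ⟨g.1.1.submatrix idx idx, by
    obtain ⟨hl, hr⟩ := mem_H_iff.1 g.2
    rw [mem_symplecticGroup_iff]
    have h1 : rev (g.1.1.submatrix idx idx) = (rev g.1.1).submatrix idx idx := by
      ext (a | a) (b | b) <;> rfl
    rw [h1, ← submatrix_idx_mul, (mem_symplecticGroup_iff _).1 g.1.2,
      submatrix_one _ idx_injective]
    · intro a
      rw [hl, one_apply_ne (idx_ne a).1]
    · intro a
      rw [hr, one_apply_ne (idx_ne a).2]⟩
  map_one' := Subtype.ext (submatrix_one _ idx_injective)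
  map_mul' g h := Subtype.ext (submatrix_idx_mul _
    (fun a => by rw [(mem_H_iff.1 g.2).1, one_apply_ne (idx_ne a).1])
    (fun a => by rw [(mem_H_iff.1 g.2).2, one_apply_ne (idx_ne a).2]))

theorem resH_injective : Function.Injective (resH F) := by
  rw [injective_iff_map_eq_one]
  intro g hg
  obtain ⟨hl, hr⟩ := mem_H_iff.1 g.2
  obtain ⟨hl', hr'⟩ := inr_of_inl g.2
  have h1 : g.1.1.submatrix idx idx = 1 := congrArg Subtype.val hg
  refine Subtype.ext (Subtype.ext ?_)
  ext x y
  change g.1.1 x y = (1 : Matrix (Fin 3 ⊕ Fin 3) (Fin 3 ⊕ Fin 3) F) x y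
  rcases exists_idx_or x with ⟨a, rfl⟩ | rfl | rfl
  · rcases exists_idx_or y with ⟨b, rfl⟩ | rfl | rfl
    · have h2 := congrFun (congrFun h1 a) b
      rw [submatrix_apply] at h2
      rw [h2, ← submatrix_one idx idx_injective, submatrix_apply]
    · exact hl _
    · exact hr _
  · exact hl' _
  · exact hr' _

theorem card_H_dvd [Finite F] : Nat.card (H F) ∣ Nat.card (Sp 2 F) :=
  Subgroup.card_dvd_of_injective _ resH_injective

end Stabilizer

/-! ### Classification in the case of `ℓ` dividing `q ^ 2 - 1` -/

namespace TorusModel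

set_option linter.unusedSectionVars false

section

variable {G B U : Type*} [Group G] [Ring B] [StarRing B] [CommGroup U] (m : TorusModel G B U)

theorem blkTorus_eq {ℓ : ℕ} {b : Fin 3 → ℕ} {r₁ r₂ r₃ : ℕ} (h0 : ∀ i, b i = 0 ↔ blk r₁ r₂ r₃ i = 0)
    (h : ∀ i k, b i = b k ↔ blk r₁ r₂ r₃ i = blk r₁ r₂ r₃ k) :
    m.blockTorus ℓ b = m.blkTorus ℓ r₁ r₂ r₃ := by
  rw [blkTorus, blockTorus, blockTorus, blockSub_congr h0 h]

theorem exists_conj_blkTorus {ℓ : ℕ} {Q : Subgroup G} (hQ : RadicalIn ℓ ⊤ Q)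
    (hδ : ∀ x ∈ Q, ∃ u, m.δ u = x) (hne : Q ≠ ⊥) :
    ∃ S ∈ [m.blkTorus ℓ 1 0 0, m.blkTorus ℓ 2 0 0, m.blkTorus ℓ 3 0 0, m.blkTorus ℓ 1 1 0,
      m.blkTorus ℓ 2 1 0, m.blkTorus ℓ 1 1 1], ConjIn ⊤ Q S := by
  obtain ⟨c, -, hc, h⟩ := m.exists_conj_blockTorus hQ Finset.univ (fun _ _ => trivial)
    (fun _ _ => trivial) (fun _ _ => le_top)
    (fun x hx => by
      obtain ⟨u, hu⟩ := hδ x hx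
      exact ⟨u, fun i hi => absurd (Finset.mem_univ i) hi, hu⟩) hne
  obtain ⟨σ, r, hr, h0, h1⟩ := exists_perm_blk c hc
  have h2 := h σ fun i hi => absurd (Finset.mem_univ i) hi
  rw [m.blkTorus_eq h0 h1] at h2
  refine ⟨_, ?_, h2⟩
  simp only [List.mem_cons, List.not_mem_nil, or_false] at hr ⊢
  rcases hr with rfl | rfl | rfl | rfl | rfl | rfl <;> simp

theorem isPGroup_blockTorus (ℓ : ℕ) (b : Fin 3 → ℕ) : IsPGroup ℓ (m.blockTorus ℓ b) := by
  rintro ⟨_, u, hu, rfl⟩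
  obtain ⟨k, hk⟩ := m.exists_pow_eq_one hu.1
  exact ⟨k, Subtype.ext hk⟩

theorem isPGroup_monomial [Finite U] [Nontrivial B] : IsPGroup 3 (m.monomial 3) := by
  have : Fact (Nat.Prime 3) := ⟨Nat.prime_three⟩
  obtain ⟨n, hn⟩ := IsPGroup.iff_card.1 (isPGroup_ellPart 3 U)
  refine IsPGroup.of_card (n := 1 + n * 3) ?_
  rw [card_monomial, hn, pow_add, pow_mul, pow_one]

end

variable {F U : Type*} [Field F] [Finite F] [CharP F 2] [CommGroup U] [Finite U]
  (m : TorusModel (Sp 3 F) (Quat F) U)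

theorem card_blockTorus_two (ℓ : ℕ) : Nat.card (m.blockTorus ℓ ![1, 2, 0]) =
    Nat.card (ellPart ℓ U) ^ 2 :=
  m.card_blockTorus.trans (card_blockSub ![0, 1] ![0, 1, 0] (by decide) (by decide) (by decide)
    (by decide))

theorem card_blockTorus_three (ℓ : ℕ) : Nat.card (m.blockTorus ℓ ![1, 2, 3]) =
    Nat.card (ellPart ℓ U) ^ 3 :=
  m.card_blockTorus.trans (card_blockSub id id (by decide) (by decide) (by decide)
    (by decide))

/-- In |G| = A³ (A + 2)(A² + 3A + 3) q⁹ with ℓ ∣ A, the cofactors of A³ are congruent to 2, to 3 and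
to a unit modulo ℓ. So for ℓ ≠ 3 the ℓ-part of the diagonal torus is a Sylow subgroup. -/
theorem exists_conj_blkTorus_of_radical {ℓ u' : ℕ} (hℓ : ℓ.Prime) (hℓ2 : ℓ ≠ 2) (hℓ3 : ℓ ≠ 3)
    (hU : Nat.card U * u' = Nat.card F ^ 2 - 1) (hu' : ¬ ℓ ∣ u') (hdvd : ℓ ∣ Nat.card F ^ 2 - 1)
    {Q : Subgroup (Sp 3 F)} (hQ : RadicalIn ℓ ⊤ Q) (hne : Q ≠ ⊥) :
    ∃ S ∈ [m.blkTorus ℓ 1 0 0, m.blkTorus ℓ 2 0 0, m.blkTorus ℓ 3 0 0, m.blkTorus ℓ 1 1 0,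
      m.blkTorus ℓ 2 1 0, m.blkTorus ℓ 1 1 1], ConjIn ⊤ Q S := by
  have : Fact ℓ.Prime := ⟨hℓ⟩
  obtain ⟨A, -, hA⟩ := exists_card_sq_eq (F := F)
  rw [hA, Nat.add_sub_cancel] at hU hdvd
  obtain ⟨h1, h2⟩ := not_dvd_of_sq_eq hℓ hℓ2 hA hdvd
  have h3 : ¬ ℓ ∣ A ^ 2 + 3 * A + 3 := by
    rw [(Nat.dvd_add_right ((dvd_pow hdvd two_ne_zero).add (hdvd.mul_left 3)))]
    exact fun h => hℓ3 ((Nat.prime_dvd_prime_iff_eq hℓ Nat.prime_three).1 h)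
  obtain ⟨k, -, hk⟩ := exists_conj_le (K := ⊤) (m.isPGroup_blockTorus ℓ ![1, 2, 3]) le_top
    (n := ((ellPart ℓ U).index * u') ^ 3 * ((A + 2) * (A ^ 2 + 3 * A + 3) * Nat.card F ^ 9))
    (hℓ.not_dvd_mul (fun h => (hℓ.not_dvd_mul (not_dvd_index_ellPart hℓ) hu')
      (hℓ.dvd_of_dvd_pow h)) (hℓ.not_dvd_mul (hℓ.not_dvd_mul h1 h3)
        (fun h => h2 (hℓ.dvd_of_dvd_pow h)))) (by
      rw [Subgroup.card_top, card_sp_three hA, m.card_blockTorus_three, ← hU,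
        ← (ellPart ℓ U).card_mul_index]
      exact dvd_of_eq (by ring)) hQ.isPGroup le_top
  have hne' : Q.map (MulAut.conj k).toMonoidHom ≠ ⊥ := fun h =>
    hne ((Subgroup.map_eq_bot_iff_of_injective _ (MulAut.conj k).injective).1 h)
  obtain ⟨S, hS, h⟩ := m.exists_conj_blkTorus (hQ.conj (Subgroup.mem_top k)) (fun x hx => by
    obtain ⟨u, -, hu⟩ := hk hx
    exact ⟨u, hu⟩) hne'
  exact ⟨S, hS, conjIn_trans ⟨k, Subgroup.mem_top k, rfl⟩ h⟩

/-- With A = 3t one has A² + 3A + 3 = 3(3t² + 3t + 1), so exactly one factor 3 is missing from the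
torus; the 3-cycle supplies it. -/
theorem exists_conj_le_monomial {u' : ℕ}
    (hU : Nat.card U * u' = Nat.card F ^ 2 - 1) (hu' : ¬ 3 ∣ u') (hdvd : 3 ∣ Nat.card F ^ 2 - 1)
    {Q : Subgroup (Sp 3 F)} (hQ : IsPGroup 3 Q) :
    ∃ k, Q.map (MulAut.conj k).toMonoidHom ≤ m.monomial 3 := by
  have : Fact (Nat.Prime 3) := ⟨Nat.prime_three⟩
  obtain ⟨A, -, hA⟩ := exists_card_sq_eq (F := F)
  rw [hA, Nat.add_sub_cancel] at hU hdvd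
  obtain ⟨h1, h2⟩ := not_dvd_of_sq_eq Nat.prime_three (by norm_num) hA hdvd
  obtain ⟨t, ht⟩ := hdvd
  have h3 : ¬ 3 ∣ 3 * t ^ 2 + 3 * t + 1 := by omega
  have hp := Nat.prime_three
  obtain ⟨k, -, hk⟩ := exists_conj_le (K := ⊤) m.isPGroup_monomial le_top
    (n := ((ellPart 3 U).index * u') ^ 3 * ((A + 2) * (3 * t ^ 2 + 3 * t + 1) * Nat.card F ^ 9))
    (hp.not_dvd_mul (fun h => (hp.not_dvd_mul (not_dvd_index_ellPart hp) hu')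
      (hp.dvd_of_dvd_pow h)) (hp.not_dvd_mul (hp.not_dvd_mul h1 h3)
        (fun h => h2 (hp.dvd_of_dvd_pow h)))) (by
      rw [Subgroup.card_top, card_sp_three hA, m.card_monomial]
      nth_rw 1 [← hU]
      rw [← (ellPart 3 U).card_mul_index, ht]
      exact dvd_of_eq (by ring)) hQ le_top
  exact ⟨k, hk⟩

theorem exists_conj_three {u' : ℕ} [IsCyclic U]
    (hU : Nat.card U * u' = Nat.card F ^ 2 - 1) (hu' : ¬ 3 ∣ u') (hdvd : 3 ∣ Nat.card F ^ 2 - 1)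
    {ω : U} (hω : ω ^ 3 = 1) (hω1 : ω ≠ 1) {S P : Subgroup (Sp 3 F)} (hSl : IsPGroup 3 S)
    (hS : IsCyclic S) (hSc : ∃ x ∈ S, x ^ Nat.card (ellPart 3 U) ≠ 1)
    (hP : ConjIn ⊤ (m.monomial 3) P) {Q : Subgroup (Sp 3 F)} (hQ : RadicalIn 3 ⊤ Q) (hne : Q ≠ ⊥) :
    ∃ S' ∈ [m.blkTorus 3 1 0 0, m.blkTorus 3 2 0 0, m.blkTorus 3 3 0 0, m.blkTorus 3 1 1 0,
      m.blkTorus 3 2 1 0, m.blkTorus 3 1 1 1] ++ [S, P, m.extra ω], ConjIn ⊤ Q S' := by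
  obtain ⟨k, hk⟩ := m.exists_conj_le_monomial hU hu' hdvd hQ.isPGroup
  have hconj : ConjIn ⊤ Q (Q.map (MulAut.conj k).toMonoidHom) := ⟨k, Subgroup.mem_top k, rfl⟩
  rcases m.radical_monomial_cases hω hω1 (hQ.conj (Subgroup.mem_top k)) hk with
    ⟨Q', h1, h2⟩ | ⟨c, hc, hcg, h1⟩ | h | h
  · have h3 := conjIn_trans hconj h1
    obtain ⟨l, -, rfl⟩ := h3
    obtain ⟨S', hS', h⟩ := m.exists_conj_blkTorus (hQ.conj (Subgroup.mem_top l)) h2 fun h =>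
      hne ((Subgroup.map_eq_bot_iff_of_injective _ (MulAut.conj l).injective).1 h)
    exact ⟨S', List.mem_append_left _ hS', conjIn_trans ⟨l, Subgroup.mem_top l, rfl⟩ h⟩
  · refine ⟨S, by simp, conjIn_trans (conjIn_trans hconj h1) ?_⟩
    -- S is itself a cyclic 3-group, conjugate into the monomial group, and its exponent forces it
    -- to be conjugate to ⟨γ(c)⟩ as well.
    obtain ⟨l, hl⟩ := m.exists_conj_le_monomial hU hu' hdvd hSl
    have h2 : ConjIn ⊤ S (S.map (MulAut.conj l).toMonoidHom) := ⟨l, Subgroup.mem_top l, rfl⟩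
    refine conjIn_symm (conjIn_trans h2 (m.conjIn_zpowers_γ_of_isCyclic hω hω1 ?_ hl ?_ hc hcg))
    · exact isCyclic_of_surjective _
        (S.equivMapOfInjective _ (MulAut.conj l).injective).surjective
    · obtain ⟨x, hx, hx1⟩ := hSc
      refine ⟨_, ⟨x, hx, rfl⟩, fun h => hx1 ?_⟩
      rw [← map_pow] at h
      exact (MulAut.conj l).injective (h.trans (map_one _).symm)
  · exact ⟨m.extra ω, by simp, conjIn_trans hconj h⟩
  · exact ⟨P, by simp, conjIn_trans (h ▸ hconj) hP⟩

theorem conjIn_monomial_sylow {u' : ℕ}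
    (hU : Nat.card U * u' = Nat.card F ^ 2 - 1) (hu' : ¬ 3 ∣ u') (hdvd : 3 ∣ Nat.card F ^ 2 - 1)
    (P : Sylow 3 (Sp 3 F)) : ConjIn ⊤ (m.monomial 3) (P : Subgroup (Sp 3 F)) := by
  have : Fact (Nat.Prime 3) := ⟨Nat.prime_three⟩
  obtain ⟨k, hk⟩ := m.exists_conj_le_monomial hU hu' hdvd P.2
  obtain ⟨T, hT⟩ := m.isPGroup_monomial.exists_le_sylow
  refine conjIn_symm ⟨k, Subgroup.mem_top k, ?_⟩
  refine Subgroup.eq_of_le_of_card_ge hk ?_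
  have h1 : ConjIn ⊤ (P : Subgroup (Sp 3 F))
    ((P : Subgroup (Sp 3 F)).map (MulAut.conj k).toMonoidHom) := ⟨k, Subgroup.mem_top k, rfl⟩
  rw [← h1.card_eq, P.card_eq_multiplicity, ← T.card_eq_multiplicity]
  exact Subgroup.card_le_of_le hT

theorem mem_H (hm : m.ι = quatEmb F) {g : Sp 3 F} : g ∈ H F ↔
    ∀ i, m.ι g i 2 = (1 : Matrix (Fin 3) (Fin 3) (Quat F)) i 2 := by
  rw [hm, mem_H_iff_quatEmb]

theorem δ_mem_H (hm : m.ι = quatEmb F) {u : Fin 3 → U} : m.δ u ∈ H F ↔ u 2 = 1 := by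
  rw [m.mem_H hm, ι_δ]
  constructor
  · intro h
    have h1 := h 2
    rw [diagonal_apply_eq, one_apply_eq, ← map_one m.j] at h1
    exact m.j_injective h1
  · intro h i
    by_cases hi : i = 2
    · rw [hi, diagonal_apply_eq, one_apply_eq, h, map_one]
    · rw [diagonal_apply_ne _ hi, one_apply_ne hi]

theorem blockTorus_le_H (hm : m.ι = quatEmb F) {ℓ : ℕ} {b : Fin 3 → ℕ} (hb : b 2 = 0) :
    m.blockTorus ℓ b ≤ H F := by
  rintro _ ⟨u, hu, rfl⟩
  exact (m.δ_mem_H hm).2 (hu.2.1 2 hb)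

/-- The torus on the first two coordinates contains a Sylow ℓ-subgroup of H even for ℓ = 3. All
reflections and permutations used fix the last coordinate, so conjugation takes place in H. -/
theorem exists_conj_blkTorus_of_radical_H (hm : m.ι = quatEmb F) {ℓ u' : ℕ} (hℓ : ℓ.Prime)
    (hℓ2 : ℓ ≠ 2) (hU : Nat.card U * u' = Nat.card F ^ 2 - 1) (hu' : ¬ ℓ ∣ u')
    (hdvd : ℓ ∣ Nat.card F ^ 2 - 1) {Q : Subgroup (Sp 3 F)} (hQ : RadicalIn ℓ (H F) Q)
    (hne : Q ≠ ⊥) :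
    ∃ S ∈ [m.blkTorus ℓ 1 0 0, m.blkTorus ℓ 2 0 0, m.blkTorus ℓ 1 1 0], ConjIn (H F) Q S := by
  classical
  have : Fact ℓ.Prime := ⟨hℓ⟩
  obtain ⟨A, -, hA⟩ := exists_card_sq_eq (F := F)
  rw [hA, Nat.add_sub_cancel] at hU hdvd
  obtain ⟨h1, h2⟩ := not_dvd_of_sq_eq hℓ hℓ2 hA hdvd
  obtain ⟨k, hkH, hk⟩ := exists_conj_le (K := H F) (m.isPGroup_blockTorus ℓ ![1, 2, 0])
    (m.blockTorus_le_H hm rfl) (n := ((ellPart ℓ U).index * u') ^ 2 * ((A + 2) * Nat.card F ^ 4))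
    (hℓ.not_dvd_mul (fun h => (hℓ.not_dvd_mul (not_dvd_index_ellPart hℓ) hu')
      (hℓ.dvd_of_dvd_pow h)) (hℓ.not_dvd_mul h1 (fun h => h2 (hℓ.dvd_of_dvd_pow h)))) (by
      refine card_H_dvd.trans ?_
      rw [card_sp_two hA, m.card_blockTorus_two, ← hU, ← (ellPart ℓ U).card_mul_index]
      exact dvd_of_eq (by ring)) hQ.isPGroup hQ.le
  have hne' : Q.map (MulAut.conj k).toMonoidHom ≠ ⊥ := fun h =>
    hne ((Subgroup.map_eq_bot_iff_of_injective _ (MulAut.conj k).injective).1 h)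
  have hI : ∀ i : Fin 3, i ∉ ({0, 1} : Finset (Fin 3)) ↔ i = 2 := by decide
  obtain ⟨c, hc2, hc, h⟩ := m.exists_conj_blockTorus (hQ.conj hkH) {0, 1}
    (fun e he => by
      rw [m.mem_H hm, ι_flip]
      intro i
      by_cases hi : i = 2
      · rw [hi, diagonal_apply_eq, one_apply_eq, if_neg (he 2 ((hI 2).2 rfl))]
      · rw [diagonal_apply_ne _ hi, one_apply_ne hi])
    (fun σ hσ => by
      rw [m.mem_H hm, ι_π]
      intro i
      rw [permMat, of_apply, hσ 2 ((hI 2).2 rfl), one_apply])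
    (fun b hb => m.blockTorus_le_H hm (hb 2 ((hI 2).2 rfl)))
    (fun x hx => by
      obtain ⟨u, hu, hux⟩ := hk hx
      exact ⟨u, fun i hi => hu.2.1 i (by rw [(hI i).1 hi]; rfl), hux⟩) hne'
  obtain ⟨σ, r, hr, hσ, h0, h1⟩ := exists_perm_blk_of_apply_two c hc (hc2 2 ((hI 2).2 rfl))
  have h2 := h σ fun i hi => by rw [(hI i).1 hi, hσ]
  rw [m.blkTorus_eq h0 h1] at h2
  refine ⟨_, ?_, conjIn_trans ⟨k, hkH, rfl⟩ h2⟩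
  simp only [List.mem_cons, List.not_mem_nil, or_false] at hr ⊢
  rcases hr with rfl | rfl | rfl <;> simp

end TorusModel

/-! ### Cyclic groups with self-centralizing subgroups -/

section Cyclic

variable {G W : Type*} [Group G] [CommGroup W]

theorem OCenter_range {ℓ : ℕ} {φ : W →* G} (hφ : Function.Injective φ) :
    OCenter ℓ φ.range = (ellPart ℓ W).map φ := by
  ext x
  rw [mem_OCenter_of_comm]
  · constructor
    · rintro ⟨⟨w, rfl⟩, k, hk⟩
      rw [← map_pow, ← map_one φ] at hk
      exact ⟨w, ⟨k, hφ hk⟩, rfl⟩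
    · rintro ⟨w, ⟨k, hk⟩, rfl⟩
      exact ⟨⟨w, rfl⟩, k, by rw [← map_pow, hk, map_one]⟩
  · rintro _ ⟨a, rfl⟩ _ ⟨b, rfl⟩
    rw [← map_mul, mul_comm, map_mul]

theorem isPGroup_map_ellPart {ℓ : ℕ} (φ : W →* G) : IsPGroup ℓ ((ellPart ℓ W).map φ) :=
  (isPGroup_ellPart ℓ W).map φ

variable [Finite W]

/-- Conjugate Q into the ℓ-part of φ(W), a Sylow subgroup of K. By `hcent` any nontrivial element of
Q already has its centralizer in K commuting with φ(W), so the ℓ-part of φ(W) centralizes C_K(Q) and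
lies in Q. -/
theorem conjIn_map_ellPart [Finite G] {ℓ : ℕ} (hℓ : ℓ.Prime) {φ : W →* G} (hφ : Function.Injective φ)
    {K : Subgroup G} (hK : ∀ w, φ w ∈ K) {n : ℕ} (hn : ¬ ℓ ∣ n)
    (hcard : Nat.card K ∣ Nat.card W * n)
    (hcent : ∀ w ∈ ellPart ℓ W, w ≠ 1 → ∀ c ∈ K, Commute c (φ w) → ∀ v, Commute c (φ v))
    {Q : Subgroup G} (hQ : RadicalIn ℓ K Q) (hne : Q ≠ ⊥) :
    ConjIn K Q ((ellPart ℓ W).map φ) := by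
  have : Fact ℓ.Prime := ⟨hℓ⟩
  have hle : (ellPart ℓ W).map φ ≤ K := by
    rintro _ ⟨w, -, rfl⟩
    exact hK w
  obtain ⟨k, hkK, hk⟩ := exists_conj_le (isPGroup_map_ellPart (ℓ := ℓ) φ) hle
    (hℓ.not_dvd_mul (not_dvd_index_ellPart hℓ (U := W)) hn) (by
      refine hcard.trans (dvd_of_eq ?_)
      rw [Nat.card_congr ((ellPart ℓ W).equivMapOfInjective φ hφ).symm.toEquiv, ← mul_assoc,
        Subgroup.card_mul_index]) hQ.isPGroup hQ.le
  refine ⟨k, hkK, le_antisymm hk ?_⟩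
  have hne' : Q.map (MulAut.conj k).toMonoidHom ≠ ⊥ := fun h =>
    hne ((Subgroup.map_eq_bot_iff_of_injective _ (MulAut.conj k).injective).1 h)
  obtain ⟨⟨x, hx⟩, hx1'⟩ := Subgroup.ne_bot_iff_exists_ne_one.1 hne'
  have hx1 : x ≠ 1 := fun h => hx1' (Subtype.ext h)
  obtain ⟨w, hw, hwx⟩ := hk hx
  have hw1 : w ≠ 1 := by
    rintro rfl
    rw [map_one] at hwx
    exact hx1 hwx.symm
  rintro _ ⟨v, ⟨e, hv⟩, rfl⟩
  refine (hQ.conj hkK).mem_of_commute (hK v) ⟨e, by rw [← map_pow, hv, map_one]⟩ ?_ ?_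
  · intro y hy
    obtain ⟨v', -, rfl⟩ := hk hy
    exact (Commute.all v v').map φ
  · intro c hc hcQ
    exact (hcent w hw hw1 c hc (hwx ▸ hcQ _ hx) v).symm

/-- A generator of the 3-part of W has order at least three times that of the 3-part of U. This
exponent identifies Q^{(3)} among the 3-groups. -/
theorem exists_pow_card_ellPart_ne_one [IsCyclic W] {U : Type*} [CommGroup U] [Finite U] {φ : W →* G}
    (hφ : Function.Injective φ) (h : 3 * Nat.card U ∣ Nat.card W) :
    ∃ x ∈ (ellPart 3 W).map φ, x ^ Nat.card (ellPart 3 U) ≠ 1 := by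
  have hp := Nat.prime_three
  have : Fact (Nat.Prime 3) := ⟨hp⟩
  obtain ⟨w, hw⟩ := IsCyclic.exists_ofOrder_eq_natCard (α := ellPart 3 W)
  refine ⟨φ w, ⟨w, w.2, rfl⟩, fun h1 => ?_⟩
  rw [← map_pow, ← map_one φ] at h1
  have h2 : w ^ Nat.card (ellPart 3 U) = 1 := Subtype.ext (hφ h1)
  have h3 := orderOf_dvd_of_pow_eq_one h2
  rw [hw] at h3
  obtain ⟨n, hn⟩ := IsPGroup.iff_card.1 (isPGroup_ellPart 3 U)
  have h4 : 3 * Nat.card (ellPart 3 U) ∣ Nat.card (ellPart 3 W) := by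
    have h5 : 3 * Nat.card (ellPart 3 U) ∣ Nat.card (ellPart 3 W) * (ellPart 3 W).index := by
      rw [Subgroup.card_mul_index]
      exact (Nat.mul_dvd_mul_left 3 (Subgroup.card_subgroup_dvd_card _)).trans h
    refine Nat.Coprime.dvd_of_dvd_mul_right ?_ h5
    rw [hn, ← pow_succ']
    exact Nat.Coprime.pow_left _ ((Nat.Prime.coprime_iff_not_dvd hp).2 (not_dvd_index_ellPart hp))
  have h6 := Nat.le_of_dvd Nat.card_pos (h4.trans h3)
  have h7 : 0 < Nat.card (ellPart 3 U) := Nat.card_pos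
  omega

omit [Finite W] in
theorem pow_ne_one_of_mem_ellPart {ℓ : ℕ} (hℓ : ℓ.Prime) {w : W} (hw : w ∈ ellPart ℓ W) (hw1 : w ≠ 1)
    {m : ℕ} (hm : ¬ ℓ ∣ m) : w ^ m ≠ 1 := by
  obtain ⟨k, hk⟩ := hw
  intro h
  have h1 := Nat.dvd_gcd (orderOf_dvd_of_pow_eq_one hk) (orderOf_dvd_of_pow_eq_one h)
  rw [Nat.Coprime.gcd_eq_one (Nat.Coprime.pow_left _ ((Nat.Prime.coprime_iff_not_dvd hℓ).2 hm)),
    Nat.dvd_one, orderOf_eq_one_iff] at h1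
  exact hw1 h1

end Cyclic

/-! ### Centralizers of field multiplications -/

section Centralizer

variable {F : Type*} [Field F]

theorem commute_leftMulMatrix {K ι : Type*} [Fintype ι] [DecidableEq ι] [CommRing K]
    [Algebra F K] (β : Module.Basis ι F K) {w : K} (hw : Algebra.adjoin F {w} = ⊤)
    {c : Matrix ι ι F} (h : Commute c (Algebra.leftMulMatrix β w)) (y : K) :
    Commute c (Algebra.leftMulMatrix β y) := by
  have hy : y ∈ Algebra.adjoin F {w} := hw ▸ Algebra.mem_top
  induction hy using Algebra.adjoin_induction with
  | mem x hx =>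
    rw [Set.mem_singleton_iff] at hx
    rwa [hx]
  | algebraMap r =>
    rw [AlgHom.commutes]
    exact (Algebra.commutes r c).symm
  | add x y _ _ hx hy =>
    rw [map_add]
    exact hx.add_right hy
  | mul x y _ _ hx hy =>
    rw [map_mul]
    exact hx.mul_right hy

theorem aeval_intertwine {A : Type*} [Ring A] [Algebra F A] {x y b : A} (h : x * b = b * y)
    (p : Polynomial F) : Polynomial.aeval x p * b = b * Polynomial.aeval y p := by
  have hpow : ∀ n : ℕ, x ^ n * b = b * y ^ n := by
    intro n
    induction n with
    | zero => simp
    | succ n ih => rw [pow_succ, mul_assoc, h, ← mul_assoc, ih, mul_assoc, pow_succ]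
  induction p using Polynomial.induction_on' with
  | add p q hp hq => rw [map_add, map_add, add_mul, mul_add, hp, hq]
  | monomial n a =>
    rw [Polynomial.aeval_monomial, Polynomial.aeval_monomial, mul_assoc, hpow, ← mul_assoc,
      Algebra.commutes, mul_assoc]

theorem aeval_transpose' {ι : Type*} [Fintype ι] [DecidableEq ι] (M : Matrix ι ι F)
    (p : Polynomial F) : Polynomial.aeval Mᵀ p = (Polynomial.aeval M p)ᵀ := by
  induction p using Polynomial.induction_on' with
  | add p q hp hq => rw [map_add, map_add, hp, hq, transpose_add]
  | monomial n a =>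
    rw [Polynomial.aeval_monomial, Polynomial.aeval_monomial, ← Algebra.smul_def,
      ← Algebra.smul_def, transpose_smul, transpose_pow]

variable [Finite F] [CharP F 2]

/-- A proper subfield containing w and F has q^e elements for a proper divisor e of d, whence w^(q^e
- 1) = 1. -/
theorem adjoin_eq_top {d : ℕ} [NeZero d] {w : Ext F d} (hw0 : w ≠ 0)
    (hw : ∀ e, e ∣ d → e ≠ d → w ^ (Nat.card F ^ e - 1) ≠ 1) : Algebra.adjoin F {w} = ⊤ := by
  let K := IntermediateField.adjoin F {w}
  have hmem : w ∈ K := IntermediateField.mem_adjoin_simple_self F w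
  have hd : Module.finrank F (Ext F d) = d := FiniteField.finrank_extension F 2 d
  have h1 : Module.finrank F K ∣ d := by
    have h := Module.finrank_mul_finrank F K (Ext F d)
    rw [hd] at h
    exact Dvd.intro _ h
  have h2 : Module.finrank F K = d := by
    by_contra h
    refine hw _ h1 h ?_
    have h3 : (⟨w, hmem⟩ : K) ≠ 0 := fun h => hw0 (congrArg Subtype.val h)
    have : Fintype K := Fintype.ofFinite K
    have h4 := FiniteField.pow_card_sub_one_eq_one _ h3
    rw [← Nat.card_eq_fintype_card, Module.natCard_eq_pow_finrank (K := F)] at h4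
    exact congrArg Subtype.val h4
  have h3 : K = ⊤ := by
    refine IntermediateField.eq_of_le_of_finrank_eq le_top ?_
    rw [h2, IntermediateField.finrank_top', hd]
  rw [← IntermediateField.adjoin_simple_toSubalgebra_of_isAlgebraic (Algebra.IsAlgebraic.isAlgebraic w)]
  change K.toSubalgebra = ⊤
  rw [h3, IntermediateField.top_toSubalgebra]

/-- Otherwise some Galois automorphism exchanges w and w⁻¹; the Galois group has odd order 3, so w =
w⁻¹. -/
theorem aeval_minpoly_inv_ne_zero {w : Ext F 3} (hw : w ≠ w⁻¹) :
    Polynomial.aeval w⁻¹ (minpoly F w) ≠ 0 := by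
  intro h
  obtain ⟨σ, hσ⟩ := minpoly.exists_algEquiv_of_root' (Algebra.IsAlgebraic.isAlgebraic w) h
  have h3 : σ ^ 3 = 1 := by
    have := pow_card_eq_one' (x := σ)
    rwa [IsGalois.card_aut_eq_finrank, FiniteField.finrank_extension] at this
  have h4 : (σ ^ 3) w = w := by rw [h3]; rfl
  have h5 : (σ ^ 3) w = σ (σ (σ w)) := rfl
  rw [h5, hσ, map_inv₀, hσ, inv_inv, hσ] at h4
  exact hw h4.symm

end Centralizer

/-! ### Embeddings of field multiplications into the symplectic group -/

section Embeddings

variable (F : Type*) [Field F] [Finite F] [CharP F 2]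

/-- The basis of `F_{q³}` that underlies `gl1`. -/
def cubicBasis : Module.Basis (Fin 3) F (Ext F 3) :=
  Module.finBasisOfFinrankEq F (Ext F 3) (FiniteField.finrank_extension F 2 3)

/-- The embedding of the multiplicative group of `F_{q³}` into `Sp_6(q)`. -/
def cubicEmb : (Ext F 3)ˣ →* Sp 3 F :=
  (hyp 3 F).comp (Units.map (Algebra.leftMulMatrix (cubicBasis F)).toRingHom.toMonoidHom)

theorem range_cubicEmb : (cubicEmb F).range = embPlus (gl1 F) := by
  rw [embPlus, gl1, MonoidHom.map_range]
  rfl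

/-- The embedding of `GU_1(q^k)` into `Sp_{2k}(q)`. -/
def normOneSp (k : ℕ) [NeZero (2 * k)] : NormOne F k →* Sp k F where
  toFun u := ⟨normOneEmb F k u, normOneEmb_mem k u⟩
  map_one' := Subtype.ext (map_one _)
  map_mul' u v := Subtype.ext (map_mul _ u v)

theorem range_normOneSp (k : ℕ) [NeZero (2 * k)] :
    (normOneSp F k).range = (gu1 k F).comap (spToGL k F) := by
  ext g
  constructor
  · rintro ⟨u, rfl⟩
    exact ⟨u, u.2, Units.ext rfl⟩
  · rintro ⟨u, hu, h⟩
    exact ⟨⟨u, hu⟩, Subtype.ext (congrArg Units.val h)⟩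

/-- The bijection of index sets that underlies `extGL`. -/
def extIdx : (Fin 2 ⊕ Fin 2) ⊕ (Fin 1 ⊕ Fin 1) ≃ Fin 3 ⊕ Fin 3 :=
  (Equiv.sumSumSumComm (Fin 2) (Fin 2) (Fin 1) (Fin 1)).trans
    (Equiv.sumCongr finSumFinEquiv finSumFinEquiv)

variable {F} in
omit [Finite F] [CharP F 2] in
theorem extGL_val (A : GL (Fin 2 ⊕ Fin 2) F) :
    (extGL F A).1 = (fromBlocks A.1 0 0 (1 : Quat F)).submatrix extIdx.symm extIdx.symm := rfl

theorem extIdx_swap (x : (Fin 2 ⊕ Fin 2) ⊕ (Fin 1 ⊕ Fin 1)) :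
    extIdx.symm (Sum.swap (extIdx x)) = Sum.map Sum.swap Sum.swap x := by
  revert x
  decide

variable {F} in
omit [Finite F] [CharP F 2] in
theorem rev_extend (A : Matrix (Fin 2 ⊕ Fin 2) (Fin 2 ⊕ Fin 2) F) :
    rev ((fromBlocks A 0 0 (1 : Quat F)).submatrix extIdx.symm extIdx.symm) =
      (fromBlocks (rev A) 0 0 (1 : Quat F)).submatrix extIdx.symm extIdx.symm := by
  ext x y
  obtain ⟨x, rfl⟩ := extIdx.surjective x
  obtain ⟨y, rfl⟩ := extIdx.surjective y
  simp only [rev, submatrix_apply, transpose_apply, extIdx_swap, Equiv.symm_apply_apply]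
  rcases x with x | x <;> rcases y with y | y
  · rfl
  · rfl
  · rfl
  · simp [one_apply, eq_comm,
      show x.swap = y.swap ↔ x = y from (Equiv.sumComm (Fin 1) (Fin 1)).injective.eq_iff]

/-- The embedding of `GU_1(q²)` into `Sp_6(q)`. -/
def quarticEmb : NormOne F 2 →* Sp 3 F where
  toFun u := ⟨(fromBlocks (normOneEmb F 2 u) 0 0 (1 : Quat F)).submatrix extIdx.symm extIdx.symm, by
    rw [mem_symplecticGroup_iff, rev_extend, submatrix_mul_equiv, fromBlocks_multiply]
    have := (mem_symplecticGroup_iff _).1 (normOneEmb_mem 2 u)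
    simp [this]⟩
  map_one' := Subtype.ext (by simp)
  map_mul' u v := Subtype.ext (by
    change (fromBlocks (normOneEmb F 2 (u * v)) 0 0 (1 : Quat F)).submatrix _ _ =
      (fromBlocks (normOneEmb F 2 u) 0 0 (1 : Quat F)).submatrix _ _ *
        (fromBlocks (normOneEmb F 2 v) 0 0 (1 : Quat F)).submatrix _ _
    rw [submatrix_mul_equiv, fromBlocks_multiply]
    simp)

theorem range_quarticEmb :
    (quarticEmb F).range = ((gu1 2 F).map (extGL F)).comap (spToGL 3 F) := by
  ext g
  constructor
  · rintro ⟨u, rfl⟩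
    exact ⟨_, ⟨u, u.2, rfl⟩, Units.ext (extGL_val _)⟩
  · rintro ⟨_, ⟨u, hu, rfl⟩, h⟩
    exact ⟨⟨u, hu⟩, Subtype.ext ((extGL_val _).symm.trans (congrArg Units.val h))⟩

variable {F}

theorem cubicEmb_injective : Function.Injective (cubicEmb F) := by
  intro u v h
  have h1 := congrArg (fun g : Sp 3 F => toBlocks₁₁ g.1) h
  exact Units.ext (Algebra.leftMulMatrix_injective (cubicBasis F) h1)

theorem normOneSp_injective (k : ℕ) [NeZero (2 * k)] : Function.Injective (normOneSp F k) :=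
  fun _ _ h => normOneEmb_injective k (congrArg Subtype.val h)

theorem quarticEmb_injective : Function.Injective (quarticEmb F) := by
  intro u v h
  have h1 := (reindex extIdx extIdx).injective (congrArg Subtype.val h)
  exact normOneEmb_injective 2 (fromBlocks_inj.1 h1).1

theorem quarticEmb_mem_H (u : NormOne F 2) : quarticEmb F u ∈ H F := by
  rw [mem_H_iff]
  have hl : (Sum.inl 2 : Fin 3 ⊕ Fin 3) = extIdx (Sum.inr (Sum.inl 0)) := by decide
  have hr : (Sum.inr 2 : Fin 3 ⊕ Fin 3) = extIdx (Sum.inr (Sum.inr 0)) := by decide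
  have h1 : ∀ a b, (1 : Matrix (Fin 3 ⊕ Fin 3) (Fin 3 ⊕ Fin 3) F) (extIdx a) (extIdx b) =
      if a = b then 1 else 0 := fun a b => by simp [one_apply]
  constructor <;> intro x <;> obtain ⟨x, rfl⟩ := extIdx.surjective x
  · rw [hl, h1]
    change (fromBlocks _ _ _ _ : Matrix _ _ F) (extIdx.symm _) (extIdx.symm _) = _
    rw [Equiv.symm_apply_apply, Equiv.symm_apply_apply]
    rcases x with x | x <;> simp [one_apply]
  · rw [hr, h1]
    change (fromBlocks _ _ _ _ : Matrix _ _ F) (extIdx.symm _) (extIdx.symm _) = _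
    rw [Equiv.symm_apply_apply, Equiv.symm_apply_apply]
    rcases x with x | x <;> simp [one_apply]

theorem commute_normOneSp {k : ℕ} [NeZero (2 * k)] {w : NormOne F k}
    (hw : Algebra.adjoin F {((w : (Ext F (2 * k))ˣ) : Ext F (2 * k))} = ⊤) {c : Sp k F}
    (h : Commute c (normOneSp F k w)) (v : NormOne F k) : Commute c (normOneSp F k v) :=
  Subtype.ext (commute_leftMulMatrix (frame F k) hw (congrArg Subtype.val h) _)

/-- The off-diagonal blocks of c intertwine multiplication by w with the identity and vanish since w
- 1 is invertible. The 4×4 block commutes with w, hence with the field w generates. -/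
theorem commute_quarticEmb {w : NormOne F 2}
    (hw : Algebra.adjoin F {((w : (Ext F (2 * 2))ˣ) : Ext F (2 * 2))} = ⊤) (hw1 : w ≠ 1)
    {c : Sp 3 F} (h : Commute c (quarticEmb F w)) (v : NormOne F 2) :
    Commute c (quarticEmb F v) := by
  let N := c.1.submatrix extIdx extIdx
  have hN : c.1 = N.submatrix extIdx.symm extIdx.symm := by
    ext x y
    simp [N]
  have key : ∀ u, c.1 * (quarticEmb F u).1 = (quarticEmb F u).1 * c.1 ↔
      N * fromBlocks (normOneEmb F 2 u) 0 0 1 = fromBlocks (normOneEmb F 2 u) 0 0 1 * N := by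
    intro u
    change c.1 * (submatrix _ _ _) = (submatrix _ _ _) * c.1 ↔ _
    rw [hN, submatrix_mul_equiv, submatrix_mul_equiv]
    exact ⟨fun h => (reindex extIdx extIdx).injective h, fun h => by rw [h]⟩
  have h1 := (key w).1 (congrArg Subtype.val h)
  refine Subtype.ext ((key v).2 ?_)
  rw [← fromBlocks_toBlocks N, fromBlocks_multiply, fromBlocks_multiply, fromBlocks_inj] at h1 ⊢
  simp only [Matrix.mul_zero, Matrix.zero_mul, add_zero, zero_add, Matrix.mul_one,
    Matrix.one_mul, and_true] at h1 ⊢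
  obtain ⟨h11, h12, h21⟩ := h1
  have hne : ((w : (Ext F (2 * 2))ˣ) : Ext F (2 * 2)) - 1 ≠ 0 := fun h =>
    hw1 (Subtype.ext (Units.ext (sub_eq_zero.1 h)))
  set z := ((w : (Ext F (2 * 2))ˣ) : Ext F (2 * 2)) - 1
  have hz : normOneEmb F 2 w = Algebra.leftMulMatrix (frame F 2) z + 1 := by
    rw [← map_one (Algebra.leftMulMatrix (frame F 2)), ← map_add]
    change Algebra.leftMulMatrix (frame F 2) _ = _
    congr 1
    exact (sub_add_cancel _ _).symm
  have hi : Algebra.leftMulMatrix (frame F 2) z⁻¹ * Algebra.leftMulMatrix (frame F 2) z = 1 := by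
    rw [← map_mul, inv_mul_cancel₀ hne, map_one]
  have hi' : Algebra.leftMulMatrix (frame F 2) z * Algebra.leftMulMatrix (frame F 2) z⁻¹ = 1 := by
    rw [← map_mul, mul_inv_cancel₀ hne, map_one]
  have e12 : N.toBlocks₁₂ = 0 := by
    rw [hz, Matrix.add_mul, Matrix.one_mul, right_eq_add] at h12
    rw [← Matrix.one_mul N.toBlocks₁₂, ← hi, Matrix.mul_assoc, h12, Matrix.mul_zero]
  have e21 : N.toBlocks₂₁ = 0 := by
    rw [hz, Matrix.mul_add, Matrix.mul_one, add_eq_right] at h21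
    rw [← Matrix.mul_one N.toBlocks₂₁, ← hi', ← Matrix.mul_assoc, h21, Matrix.zero_mul]
  rw [e12, e21, Matrix.mul_zero, Matrix.zero_mul]
  exact ⟨(commute_leftMulMatrix (frame F 2) hw h11 _).eq, rfl, rfl⟩

/-- The off-diagonal blocks of c intertwine w with the transpose of w⁻¹. The minimal polynomial of w
annihilates the one and is invertible at the other, so these blocks vanish. -/
theorem commute_cubicEmb {w : (Ext F 3)ˣ} (hw : Algebra.adjoin F {(w : Ext F 3)} = ⊤)
    (hw' : Algebra.adjoin F {((w⁻¹ : (Ext F 3)ˣ) : Ext F 3)} = ⊤)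
    (hne : (w : Ext F 3) ≠ (w : Ext F 3)⁻¹) {c : Sp 3 F}
    (h : Commute c (cubicEmb F w)) (v : (Ext F 3)ˣ) : Commute c (cubicEmb F v) := by
  let L := Algebra.leftMulMatrix (cubicBasis F)
  have hφ : ∀ u : (Ext F 3)ˣ, (cubicEmb F u).1 =
      fromBlocks (L u) 0 0 (L ((u⁻¹ : (Ext F 3)ˣ) : Ext F 3))ᵀ := fun u => rfl
  have key : ∀ u, c.1 * (cubicEmb F u).1 = (cubicEmb F u).1 * c.1 ↔
      c.1.toBlocks₁₁ * L u = L u * c.1.toBlocks₁₁ ∧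
      c.1.toBlocks₁₂ * (L ((u⁻¹ : (Ext F 3)ˣ) : Ext F 3))ᵀ = L u * c.1.toBlocks₁₂ ∧
      c.1.toBlocks₂₁ * L u = (L ((u⁻¹ : (Ext F 3)ˣ) : Ext F 3))ᵀ * c.1.toBlocks₂₁ ∧
      c.1.toBlocks₂₂ * (L ((u⁻¹ : (Ext F 3)ˣ) : Ext F 3))ᵀ =
        (L ((u⁻¹ : (Ext F 3)ˣ) : Ext F 3))ᵀ * c.1.toBlocks₂₂ := by
    intro u
    rw [hφ, ← fromBlocks_toBlocks c.1, fromBlocks_multiply, fromBlocks_multiply, fromBlocks_inj]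
    simp
  obtain ⟨h11, h12, h21, h22⟩ := (key w).1 (congrArg Subtype.val h)
  have hp0 := aeval_minpoly_inv_ne_zero hne
  rw [← Units.val_inv_eq_inv_val] at hp0
  set x := ((w⁻¹ : (Ext F 3)ˣ) : Ext F 3)
  set p := minpoly F (w : Ext F 3)
  set y := Polynomial.aeval x p
  have hpw : Polynomial.aeval (L w) p = 0 := by
    rw [Polynomial.aeval_algHom_apply, minpoly.aeval, map_zero]
  have hpx : Polynomial.aeval (L x)ᵀ p = (L y)ᵀ := by
    rw [aeval_transpose', Polynomial.aeval_algHom_apply]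
  have hi : (L y)ᵀ * (L y⁻¹)ᵀ = 1 := by
    rw [← transpose_mul, ← map_mul, inv_mul_cancel₀ hp0, map_one, transpose_one]
  have hi' : (L y⁻¹)ᵀ * (L y)ᵀ = 1 := by
    rw [← transpose_mul, ← map_mul, mul_inv_cancel₀ hp0, map_one, transpose_one]
  have e12 : c.1.toBlocks₁₂ = 0 := by
    have h1 := aeval_intertwine h12.symm p
    rw [hpw, zero_mul, hpx] at h1
    rw [← mul_one c.1.toBlocks₁₂, ← hi, ← mul_assoc, ← h1, zero_mul]
  have e21 : c.1.toBlocks₂₁ = 0 := by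
    have h1 := aeval_intertwine h21.symm p
    rw [hpw, mul_zero, hpx] at h1
    rw [← one_mul c.1.toBlocks₂₁, ← hi', mul_assoc, h1, mul_zero]
  have h22' : Commute c.1.toBlocks₂₂ᵀ (L x) := by
    have h1 := congrArg transpose h22
    rw [transpose_mul, transpose_mul, transpose_transpose] at h1
    exact h1.symm
  refine Subtype.ext ((key v).2 ⟨(commute_leftMulMatrix _ hw h11 _).eq, ?_, ?_, ?_⟩)
  · rw [e12, zero_mul, mul_zero]
  · rw [e21, zero_mul, mul_zero]
  · have h1 := congrArg transpose (commute_leftMulMatrix (cubicBasis F) hw' h22'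
      ((v⁻¹ : (Ext F 3)ˣ) : Ext F 3)).eq
    rw [transpose_mul, transpose_mul, transpose_transpose] at h1
    exact h1.symm

end Embeddings

/-! ### The classification -/

section Classification

variable {F : Type*} [Field F] [Finite F] [CharP F 2]

/-! ### The cases with ℓ dividing q - ε -/

section Model

variable {U : Type*} [CommGroup U] [Finite U] (m : TorusModel (Sp 3 F) (Quat F) U) {ℓ u' : ℕ} {ε : ℤˣ}

omit [Finite U] in
theorem listG_eq (hQr : ∀ r₁ r₂ r₃, Qr F ℓ ε r₁ r₂ r₃ = m.blkTorus ℓ r₁ r₂ r₃) :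
    listG F ℓ ε = [m.blkTorus ℓ 1 0 0, m.blkTorus ℓ 2 0 0, m.blkTorus ℓ 3 0 0,
      m.blkTorus ℓ 1 1 0, m.blkTorus ℓ 2 1 0, m.blkTorus ℓ 1 1 1] := by
  simp only [listG, hQr]

omit [Finite U] in
theorem listH_eq (hQr : ∀ r₁ r₂ r₃, Qr F ℓ ε r₁ r₂ r₃ = m.blkTorus ℓ r₁ r₂ r₃) :
    listH F ℓ ε = [m.blkTorus ℓ 1 0 0, m.blkTorus ℓ 2 0 0, m.blkTorus ℓ 1 1 0] := by
  simp only [listH, hQr]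

theorem classification_of_ne_three (hQr : ∀ r₁ r₂ r₃, Qr F ℓ ε r₁ r₂ r₃ = m.blkTorus ℓ r₁ r₂ r₃)
    (hℓ : ℓ.Prime) (hℓ2 : ℓ ≠ 2) (hU : Nat.card U * u' = Nat.card F ^ 2 - 1) (hu' : ¬ ℓ ∣ u')
    (hdU : ℓ ∣ Nat.card U) (hℓ3 : ℓ ≠ 3) :
    (∀ Q : Subgroup (Sp 3 F), Q ≠ ⊥ → IsRadical ℓ Q → ∃ S ∈ listG F ℓ ε, ConjIn ⊤ Q S) ∧
      (listG F ℓ ε).Pairwise fun A B => ¬ ConjIn ⊤ A B := by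
  rw [listG_eq m hQr]
  exact ⟨fun Q hne hQ => m.exists_conj_blkTorus_of_radical hℓ hℓ2 hℓ3 hU hu'
    (hU ▸ hdU.mul_right _) hQ.radicalIn_top hne,
    m.pairwise_not_conj (exists_mem_ellPart_ne_one hℓ hdU)⟩

theorem classification_stabilizer (hm : m.ι = quatEmb F)
    (hQr : ∀ r₁ r₂ r₃, Qr F ℓ ε r₁ r₂ r₃ = m.blkTorus ℓ r₁ r₂ r₃)
    (hℓ : ℓ.Prime) (hℓ2 : ℓ ≠ 2) (hU : Nat.card U * u' = Nat.card F ^ 2 - 1) (hu' : ¬ ℓ ∣ u')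
    (hdU : ℓ ∣ Nat.card U) :
    (∀ Q : Subgroup (H F), Q ≠ ⊥ → IsRadical ℓ Q →
        ∃ S ∈ listH F ℓ ε, ConjIn (H F) (Q.map (H F).subtype) S) ∧
      (listH F ℓ ε).Pairwise fun A B => ¬ ConjIn ⊤ A B := by
  rw [listH_eq m hQr]
  refine ⟨fun Q hne hQ => m.exists_conj_blkTorus_of_radical_H hm hℓ hℓ2 hU hu'
    (hU ▸ hdU.mul_right _) hQ.radicalIn_top.map_subtype fun h =>
      hne ((Subgroup.map_eq_bot_iff_of_injective _ (H F).subtype_injective).1 h), ?_⟩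
  refine (m.pairwise_not_conj (exists_mem_ellPart_ne_one hℓ hdU)).sublist ?_
  -- Keeps Q_1, Q_2 and Q_{1,1} from the list for G.
  exact .cons_cons _ (.cons_cons _ (.cons _ (.cons_cons _ (.cons _ (.cons _ .slnil)))))

theorem classification_three [IsCyclic U]
    (hQr : ∀ r₁ r₂ r₃, Qr F 3 ε r₁ r₂ r₃ = m.blkTorus 3 r₁ r₂ r₃)
    (hU : Nat.card U * u' = Nat.card F ^ 2 - 1) (hu' : ¬ 3 ∣ u') (hdU : 3 ∣ Nat.card U)
    (hR : ∀ ω : U, ω ^ 3 = 1 → ω ≠ 1 → R F ε = m.extra ω)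
    {W : Type*} [CommGroup W] [Finite W] [IsCyclic W] {φ : W →* Sp 3 F}
    (hφ : Function.Injective φ) (hQ3 : Q3 F 3 ε = (ellPart 3 W).map φ)
    (hW : 3 * Nat.card U ∣ Nat.card W) (P : Sylow 3 (Sp 3 F)) :
    (∀ Q : Subgroup (Sp 3 F), Q ≠ ⊥ → IsRadical 3 Q →
        ∃ S ∈ listG F 3 ε ++ [Q3 F 3 ε, (P : Subgroup (Sp 3 F)), R F ε], ConjIn ⊤ Q S) ∧
      (listG F 3 ε ++ [Q3 F 3 ε, (P : Subgroup (Sp 3 F)), R F ε]).Pairwise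
        fun A B => ¬ ConjIn ⊤ A B := by
  have : Fact (Nat.Prime 3) := ⟨Nat.prime_three⟩
  obtain ⟨ω, hω3⟩ := exists_prime_orderOf_dvd_card' 3 hdU
  have hω : ω ^ 3 = 1 := by rw [← hω3, pow_orderOf_eq_one]
  have hω1 : ω ≠ 1 := by
    rintro rfl
    rw [orderOf_one] at hω3
    omega
  have hdvd : 3 ∣ Nat.card F ^ 2 - 1 := hU ▸ hdU.mul_right _
  have hP := m.conjIn_monomial_sylow hU hu' hdvd P
  have hc := exists_pow_card_ellPart_ne_one hφ hW
  rw [listG_eq m hQr, hQ3, hR ω hω hω1]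
  refine ⟨fun Q hne hQ => m.exists_conj_three hU hu' hdvd hω hω1 (isPGroup_map_ellPart φ)
    (isCyclic_of_surjective _ ((ellPart 3 W).equivMapOfInjective φ hφ).surjective) hc hP
      hQ.radicalIn_top hne, m.pairwise_not_conj_three hω hω1 ?_ hc hP⟩
  rintro _ ⟨a, -, rfl⟩ _ ⟨b, -, rfl⟩
  rw [← map_mul, mul_comm, map_mul]

end Model

section Arithmetic

variable {ℓ : ℕ}

omit [CharP F 2] in
theorem dvd_card_sub_one (hε : (ℓ : ℤ) ∣ (Nat.card F : ℤ) - ((1 : ℤˣ) : ℤ)) :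
    ℓ ∣ Nat.card F - 1 := by
  have h1 : 1 ≤ Nat.card F := Nat.card_pos
  rw [← Int.natCast_dvd_natCast]
  push_cast [h1]
  simpa using hε

omit [Field F] [Finite F] [CharP F 2] in
theorem dvd_card_add_one (hε : (ℓ : ℤ) ∣ (Nat.card F : ℤ) - ((-1 : ℤˣ) : ℤ)) :
    ℓ ∣ Nat.card F + 1 := by
  rw [← Int.natCast_dvd_natCast]
  push_cast
  simpa using hε

omit [CharP F 2] in
theorem exists_card_cube_eq : ∃ C, Nat.card F ^ 3 = C + 1 :=
  ⟨Nat.card F ^ 3 - 1, (Nat.sub_add_cancel (Nat.one_le_pow _ _ Nat.card_pos)).symm⟩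

omit [Field F] [Finite F] [CharP F 2] in
theorem card_sub_one_dvd (k : ℕ) : Nat.card F ^ 1 - 1 ∣ Nat.card F ^ k - 1 :=
  Nat.pow_sub_one_dvd_pow_sub_one _ (one_dvd k)

end Arithmetic

section Torus

variable {ℓ : ℕ}

theorem exists_ne_one_of_dvd (hℓ : ℓ.Prime) {U : Type*} [CommGroup U] [Finite U]
    (h : ℓ ∣ Nat.card U) : ∃ u : U, u ≠ 1 :=
  (exists_mem_ellPart_ne_one hℓ h).imp fun _ h => h.2

omit [Finite F] [CharP F 2] in
theorem card_units_mul : Nat.card Fˣ * (Nat.card F + 1) = Nat.card F ^ 2 - 1 := by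
  rw [Nat.card_units, mul_comm, ← Nat.sq_sub_sq, one_pow]

theorem card_normOne_mul :
    Nat.card (NormOne F 1) * (Nat.card F - 1) = Nat.card F ^ 2 - 1 := by
  rw [card_normOne, pow_one, ← Nat.sq_sub_sq, one_pow]

omit [Finite F] [CharP F 2] [Field F] in
theorem not_dvd_of_dvd_add_two (hℓ : ℓ.Prime) (hℓ2 : ℓ ≠ 2) {n : ℕ} (h : ℓ ∣ n) : ¬ ℓ ∣ n + 2 := by
  rw [Nat.dvd_add_right h]
  exact fun h => hℓ2 ((Nat.prime_dvd_prime_iff_eq hℓ Nat.prime_two).1 h)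

end Torus

/-- `Q^{(3)}` for `ε = 1`. -/
theorem Q3_one (ℓ : ℕ) : Q3 F ℓ 1 = (ellPart ℓ (Ext F 3)ˣ).map (cubicEmb F) := by
  rw [Q3, if_pos rfl, ← range_cubicEmb, OCenter_range cubicEmb_injective]

/-- `Q^{(3)}` for `ε = -1`. -/
theorem Q3_neg_one (ℓ : ℕ) : Q3 F ℓ (-1) = (ellPart ℓ (NormOne F 3)).map (normOneSp F 3) := by
  rw [Q3, if_neg (by decide), ← range_normOneSp, OCenter_range (normOneSp_injective 3)]

theorem Q2_eq (ℓ : ℕ) : Q2 F ℓ = (ellPart ℓ (NormOne F 2)).map (quarticEmb F) := by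
  rw [Q2, ← range_quarticEmb, OCenter_range quarticEmb_injective]

theorem card_units_ext : Nat.card (Ext F 3)ˣ = Nat.card F ^ 3 - 1 := by
  rw [Nat.card_units, FiniteField.natCard_extension]

/-- The quotient q² + q + 1 is divisible by 3 when q ≡ 1 mod 3; this is the extra factor in the
exponent of Q^{(3)}. -/
theorem three_mul_dvd_cubic {q : ℕ} (h : 3 ∣ q - 1) (hq : 1 < q) : 3 * (q - 1) ∣ q ^ 3 - 1 := by
  obtain ⟨t, ht⟩ := h
  obtain rfl : q = 3 * t + 1 := by omega
  refine ⟨3 * t ^ 2 + 3 * t + 1, ?_⟩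
  rw [Nat.add_sub_cancel]
  exact Nat.sub_eq_of_eq_add (by ring)

theorem three_mul_dvd_cubic_add {q : ℕ} (h : 3 ∣ q + 1) : 3 * (q + 1) ∣ q ^ 3 + 1 := by
  obtain ⟨t, ht⟩ := h
  obtain ⟨s, rfl⟩ : ∃ s, t = s + 1 := ⟨t - 1, by omega⟩
  obtain rfl : q = 3 * s + 2 := by omega
  exact ⟨3 * s ^ 2 + 3 * s + 1, by ring⟩

/-! ### The cases with a Sylow subgroup inside a field torus -/

section Large

variable {ℓ : ℕ} {A C : ℕ}

/-- As ℓ is odd it does not divide q² - 1, so no nontrivial ℓ-element lies in a proper subfield of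
F_{q⁴} containing F_q. K will be G or H. -/
theorem conjIn_Q2 (hℓ : ℓ.Prime) (hℓ2 : ℓ ≠ 2) (hd : ℓ ∣ Nat.card F ^ 2 + 1) {K : Subgroup (Sp 3 F)}
    (hK : H F ≤ K) {n : ℕ} (hn : ¬ ℓ ∣ n) (hcard : Nat.card K ∣ (Nat.card F ^ 2 + 1) * n)
    {Q : Subgroup (Sp 3 F)} (hQ : RadicalIn ℓ K Q) (hne : Q ≠ ⊥) : ConjIn K Q (Q2 F ℓ) := by
  rw [Q2_eq]
  refine conjIn_map_ellPart hℓ quarticEmb_injective (fun w => hK (quarticEmb_mem_H w)) hn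
    (by rwa [card_normOne]) ?_ hQ hne
  intro w hw hw1 c _ hc v
  refine commute_quarticEmb (adjoin_eq_top (Units.ne_zero _) fun e he hne h => ?_) hw1 hc v
  have h2 : ¬ ℓ ∣ Nat.card F ^ 2 - 1 := by
    intro h
    refine not_dvd_of_dvd_add_two hℓ hℓ2 h ?_
    have : 1 ≤ Nat.card F ^ 2 := Nat.one_le_pow _ _ Nat.card_pos
    rwa [show Nat.card F ^ 2 - 1 + 2 = Nat.card F ^ 2 + 1 by omega]
  have he' : e = 1 ∨ e = 2 := by
    have := Nat.le_of_dvd (by norm_num) he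
    interval_cases e <;> omega
  refine pow_ne_one_of_mem_ellPart hℓ hw hw1 (m := Nat.card F ^ e - 1) ?_
    (Subtype.ext (Units.ext h))
  rcases he' with rfl | rfl
  · exact fun h => h2 (h.trans (card_sub_one_dvd 2))
  · exact h2

omit [Field F] [Finite F] [CharP F 2] in
theorem not_dvd_of_dvd_cubic (hℓ : ℓ.Prime) (hℓ3 : ℓ ≠ 3) (hA : Nat.card F ^ 2 = A + 1)
    (hd : ℓ ∣ Nat.card F ^ 4 + Nat.card F ^ 2 + 1) : ¬ ℓ ∣ A ∧ ¬ ℓ ∣ A + 2 ∧ ¬ ℓ ∣ Nat.card F := by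
  have h4 : Nat.card F ^ 4 = (A + 1) ^ 2 := by rw [← hA]; ring
  refine ⟨fun h => ?_, fun h => ?_, fun h => ?_⟩
  · rw [h4, hA, show (A + 1) ^ 2 + (A + 1) + 1 = A * (A + 3) + 3 by ring,
      Nat.dvd_add_right (h.mul_right _)] at hd
    exact hℓ3 ((Nat.prime_dvd_prime_iff_eq hℓ Nat.prime_three).1 hd)
  · rw [h4, hA, show (A + 1) ^ 2 + (A + 1) + 1 = (A + 2) * (A + 1) + 1 by ring,
      Nat.dvd_add_right (h.mul_right _)] at hd
    exact hℓ.one_lt.ne' (Nat.dvd_one.1 hd)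
  · rw [Nat.dvd_add_right ((dvd_pow h (by norm_num)).add (dvd_pow h two_ne_zero))] at hd
    exact hℓ.one_lt.ne' (Nat.dvd_one.1 hd)

omit [CharP F 2] in
theorem card_sp_three' (hA : Nat.card F ^ 2 = A + 1) (hC : Nat.card F ^ 3 = C + 1) :
    Nat.card (Sp 3 F) = C * (C + 2) * (A ^ 2 * (A + 2) * Nat.card F ^ 9) := by
  have h : C * (C + 2) = A * (A ^ 2 + 3 * A + 3) := by
    have h1 : (C + 1) ^ 2 = (A + 1) ^ 3 := by rw [← hA, ← hC]; ring
    have h2 : C * (C + 2) + 1 = A * (A ^ 2 + 3 * A + 3) + 1 := by linear_combination h1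
    exact Nat.add_right_cancel h2
  rw [card_sp_three hA, h]
  ring

/-- Here ℓ divides C = q³ - 1, and the rest of |G| is prime to ℓ, so F_{q³}^× contains a Sylow
subgroup. For the opposite sign ℓ divides C + 2 = q³ + 1, and the norm one group of F_{q⁶} takes
this role. -/
theorem conjIn_Q3_one (hℓ : ℓ.Prime) (hℓ2 : ℓ ≠ 2) (hℓ3 : ℓ ≠ 3)
    (hd : ℓ ∣ Nat.card F ^ 4 + Nat.card F ^ 2 + 1)
    (hε : (ℓ : ℤ) ∣ (Nat.card F : ℤ) ^ 2 + ((1 : ℤˣ) : ℤ) * (Nat.card F : ℤ) + 1)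
    {Q : Subgroup (Sp 3 F)} (hQ : RadicalIn ℓ ⊤ Q) (hne : Q ≠ ⊥) : ConjIn ⊤ Q (Q3 F ℓ 1) := by
  obtain ⟨A, -, hA⟩ := exists_card_sq_eq (F := F)
  obtain ⟨C, hC⟩ := exists_card_cube_eq (F := F)
  obtain ⟨h1, h2, h3⟩ := not_dvd_of_dvd_cubic hℓ hℓ3 hA hd
  have hCd : ℓ ∣ C := by
    have hC' : (Nat.card F : ℤ) ^ 3 = C + 1 := by exact_mod_cast hC
    rw [← Int.natCast_dvd_natCast]
    have h4 : (C : ℤ) = ((Nat.card F : ℤ) ^ 2 + ((1 : ℤˣ) : ℤ) * (Nat.card F : ℤ) + 1) *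
        (Nat.card F - 1) := by
      rw [Units.val_one]
      linear_combination -hC'
    exact h4 ▸ hε.mul_right _
  have hsub : ¬ ℓ ∣ Nat.card F ^ 1 - 1 := fun h =>
    h1 (by simpa [hA] using h.trans (card_sub_one_dvd 2))
  rw [Q3_one]
  refine conjIn_map_ellPart hℓ cubicEmb_injective (fun _ => Subgroup.mem_top _)
    (n := (C + 2) * (A ^ 2 * (A + 2) * Nat.card F ^ 9)) ?_ ?_ ?_ hQ hne
  · exact hℓ.not_dvd_mul (not_dvd_of_dvd_add_two hℓ hℓ2 hCd) (hℓ.not_dvd_mul (hℓ.not_dvd_mul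
      (fun h => h1 (hℓ.dvd_of_dvd_pow h)) h2) (fun h => h3 (hℓ.dvd_of_dvd_pow h)))
  · rw [Subgroup.card_top, card_sp_three' hA hC, card_units_ext, hC, Nat.add_sub_cancel, mul_assoc]
  · intro w hw hw1 c _ hc v
    have hadj : ∀ w ∈ ellPart ℓ (Ext F 3)ˣ, w ≠ 1 → Algebra.adjoin F {(w : Ext F 3)} = ⊤ := by
      intro w hw hw1
      refine adjoin_eq_top (Units.ne_zero _) fun e he hne h => ?_
      obtain rfl : e = 1 := ((Nat.dvd_prime Nat.prime_three).1 he).resolve_right hne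
      exact pow_ne_one_of_mem_ellPart hℓ hw hw1 hsub (Units.ext h)
    refine commute_cubicEmb (hadj w hw hw1) (hadj _ (inv_mem hw) (inv_ne_one.2 hw1)) ?_ hc v
    intro h
    refine pow_ne_one_of_mem_ellPart hℓ hw hw1 (m := 2)
      (fun h => hℓ2 ((Nat.prime_dvd_prime_iff_eq hℓ Nat.prime_two).1 h)) ?_
    refine Units.ext ?_
    rw [Units.val_pow_eq_pow_val, pow_two]
    nth_rw 2 [h]
    exact mul_inv_cancel₀ (Units.ne_zero w)

theorem conjIn_Q3_neg_one (hℓ : ℓ.Prime) (hℓ2 : ℓ ≠ 2) (hℓ3 : ℓ ≠ 3)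
    (hd : ℓ ∣ Nat.card F ^ 4 + Nat.card F ^ 2 + 1)
    (hε : (ℓ : ℤ) ∣ (Nat.card F : ℤ) ^ 2 + ((-1 : ℤˣ) : ℤ) * (Nat.card F : ℤ) + 1)
    {Q : Subgroup (Sp 3 F)} (hQ : RadicalIn ℓ ⊤ Q) (hne : Q ≠ ⊥) : ConjIn ⊤ Q (Q3 F ℓ (-1)) := by
  obtain ⟨A, -, hA⟩ := exists_card_sq_eq (F := F)
  obtain ⟨C, hC⟩ := exists_card_cube_eq (F := F)
  obtain ⟨h1, h2, h3⟩ := not_dvd_of_dvd_cubic hℓ hℓ3 hA hd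
  have hCd : ℓ ∣ C + 2 := by
    have hC' : (Nat.card F : ℤ) ^ 3 = C + 1 := by exact_mod_cast hC
    rw [← Int.natCast_dvd_natCast]
    have h4 : ((C + 2 : ℕ) : ℤ) = ((Nat.card F : ℤ) ^ 2 + ((-1 : ℤˣ) : ℤ) * (Nat.card F : ℤ) + 1) *
        (Nat.card F + 1) := by
      rw [Units.val_neg, Units.val_one]
      push_cast
      linear_combination -hC'
    exact h4 ▸ hε.mul_right _
  have hCn : ¬ ℓ ∣ C := fun h => not_dvd_of_dvd_add_two hℓ hℓ2 h hCd
  rw [Q3_neg_one]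
  refine conjIn_map_ellPart hℓ (normOneSp_injective 3) (fun _ => Subgroup.mem_top _)
    (n := C * (A ^ 2 * (A + 2) * Nat.card F ^ 9)) ?_ ?_ ?_ hQ hne
  · exact hℓ.not_dvd_mul hCn (hℓ.not_dvd_mul (hℓ.not_dvd_mul
      (fun h => h1 (hℓ.dvd_of_dvd_pow h)) h2) (fun h => h3 (hℓ.dvd_of_dvd_pow h)))
  · rw [Subgroup.card_top, card_sp_three' hA hC, card_normOne, hC]
    exact dvd_of_eq (by ring)
  · intro w hw hw1 c _ hc v
    refine commute_normOneSp (adjoin_eq_top (Units.ne_zero _) fun e he hne h => ?_) hc v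
    have he' : e = 1 ∨ e = 2 ∨ e = 3 := by
      have := Nat.le_of_dvd (by norm_num) he
      interval_cases e <;> omega
    refine pow_ne_one_of_mem_ellPart hℓ hw hw1 (m := Nat.card F ^ e - 1) ?_
      (Subtype.ext (Units.ext h))
    rcases he' with rfl | rfl | rfl
    · exact fun h => h1 (by simpa [hA] using h.trans (card_sub_one_dvd 2))
    · simpa [hA] using h1
    · simpa [hC] using hCn

theorem conjIn_Q2_top (hℓ : ℓ.Prime) (hℓ2 : ℓ ≠ 2) (hd : ℓ ∣ Nat.card F ^ 2 + 1)
    {Q : Subgroup (Sp 3 F)} (hQ : RadicalIn ℓ ⊤ Q) (hne : Q ≠ ⊥) : ConjIn ⊤ Q (Q2 F ℓ) := by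
  obtain ⟨A, -, hA⟩ := exists_card_sq_eq (F := F)
  have hd' : ℓ ∣ A + 2 := by rwa [hA] at hd
  have h1 : ¬ ℓ ∣ A := fun h => not_dvd_of_dvd_add_two hℓ hℓ2 h hd'
  have h2 : ¬ ℓ ∣ A ^ 2 + 3 * A + 3 := by
    rw [show A ^ 2 + 3 * A + 3 = (A + 2) * (A + 1) + 1 by ring,
      Nat.dvd_add_right (hd'.mul_right _)]
    exact fun h => hℓ.one_lt.ne' (Nat.dvd_one.1 h)
  have h3 : ¬ ℓ ∣ Nat.card F := fun h => by
    rw [Nat.dvd_add_right (dvd_pow h two_ne_zero)] at hd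
    exact hℓ.one_lt.ne' (Nat.dvd_one.1 hd)
  refine conjIn_Q2 hℓ hℓ2 hd le_top (n := A ^ 3 * ((A ^ 2 + 3 * A + 3) * Nat.card F ^ 9)) ?_ ?_
    hQ hne
  · exact hℓ.not_dvd_mul (fun h => h1 (hℓ.dvd_of_dvd_pow h)) (hℓ.not_dvd_mul h2
      (fun h => h3 (hℓ.dvd_of_dvd_pow h)))
  · rw [Subgroup.card_top, card_sp_three hA, hA]
    exact dvd_of_eq (by ring)

theorem conjIn_Q2_H (hℓ : ℓ.Prime) (hℓ2 : ℓ ≠ 2) (hd : ℓ ∣ Nat.card F ^ 2 + 1)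
    {Q : Subgroup (Sp 3 F)} (hQ : RadicalIn ℓ (H F) Q) (hne : Q ≠ ⊥) : ConjIn (H F) Q (Q2 F ℓ) := by
  obtain ⟨A, -, hA⟩ := exists_card_sq_eq (F := F)
  have hd' : ℓ ∣ A + 2 := by rwa [hA] at hd
  have h1 : ¬ ℓ ∣ A := fun h => not_dvd_of_dvd_add_two hℓ hℓ2 h hd'
  have h3 : ¬ ℓ ∣ Nat.card F := fun h => by
    rw [Nat.dvd_add_right (dvd_pow h two_ne_zero)] at hd
    exact hℓ.one_lt.ne' (Nat.dvd_one.1 hd)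
  refine conjIn_Q2 hℓ hℓ2 hd le_rfl (n := A ^ 2 * Nat.card F ^ 4) ?_ ?_ hQ hne
  · exact hℓ.not_dvd_mul (fun h => h1 (hℓ.dvd_of_dvd_pow h)) (fun h => h3 (hℓ.dvd_of_dvd_pow h))
  · refine card_H_dvd.trans ?_
    rw [card_sp_two hA, hA]
    exact dvd_of_eq (by ring)

end Large

end Classification

end RadSub

end

/-! ### The theorem -/

open RadSub in
theorem proposition3p1 (F : Type*) [Field F] [Finite F] [CharP F 2]
    (ℓ : ℕ) (hℓ : ℓ.Prime) (hℓ2 : ℓ ≠ 2) :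
    -- `G = Sp_6(q)`, `3 ≠ ℓ ∣ q² - 1`
    (ℓ ≠ 3 → ℓ ∣ Nat.card F ^ 2 - 1 → ∀ ε : ℤˣ, (ℓ : ℤ) ∣ (Nat.card F : ℤ) - ε →
      (∀ Q : Subgroup (Sp 3 F), Q ≠ ⊥ → IsRadical ℓ Q → ∃ S ∈ listG F ℓ ε, ConjIn ⊤ Q S) ∧
        (listG F ℓ ε).Pairwise fun A B => ¬ ConjIn ⊤ A B) ∧
    -- `G = Sp_6(q)`, `3 = ℓ ∣ q² - 1`
    (ℓ = 3 → ℓ ∣ Nat.card F ^ 2 - 1 → ∀ ε : ℤˣ, (ℓ : ℤ) ∣ (Nat.card F : ℤ) - ε →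
      ∀ P : Sylow ℓ (Sp 3 F),
      (∀ Q : Subgroup (Sp 3 F), Q ≠ ⊥ → IsRadical ℓ Q →
        ∃ S ∈ listG F ℓ ε ++ [Q3 F ℓ ε, (P : Subgroup (Sp 3 F)), R F ε], ConjIn ⊤ Q S) ∧
        (listG F ℓ ε ++ [Q3 F ℓ ε, (P : Subgroup (Sp 3 F)), R F ε]).Pairwise
          fun A B => ¬ ConjIn ⊤ A B) ∧
    -- `G = Sp_6(q)`, `3 ≠ ℓ ∣ q⁴ + q² + 1`
    (ℓ ≠ 3 → ℓ ∣ Nat.card F ^ 4 + Nat.card F ^ 2 + 1 →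
      ∀ ε : ℤˣ, (ℓ : ℤ) ∣ (Nat.card F : ℤ) ^ 2 + ε * (Nat.card F : ℤ) + 1 →
      ∀ Q : Subgroup (Sp 3 F), Q ≠ ⊥ → IsRadical ℓ Q → ConjIn ⊤ Q (Q3 F ℓ ε)) ∧
    -- `G = Sp_6(q)`, `ℓ ∣ q² + 1`
    (ℓ ∣ Nat.card F ^ 2 + 1 →
      ∀ Q : Subgroup (Sp 3 F), Q ≠ ⊥ → IsRadical ℓ Q → ConjIn ⊤ Q (Q2 F ℓ)) ∧
    -- `H = Sp_4(q)`, `ℓ ∣ q² - 1`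
    (ℓ ∣ Nat.card F ^ 2 - 1 → ∀ ε : ℤˣ, (ℓ : ℤ) ∣ (Nat.card F : ℤ) - ε →
      (∀ Q : Subgroup (H F), Q ≠ ⊥ → IsRadical ℓ Q →
        ∃ S ∈ listH F ℓ ε, ConjIn (H F) (Q.map (H F).subtype) S) ∧
        (listH F ℓ ε).Pairwise fun A B => ¬ ConjIn ⊤ A B) ∧
    -- `H = Sp_4(q)`, `ℓ ∣ q² + 1`
    (ℓ ∣ Nat.card F ^ 2 + 1 →
      ∀ Q : Subgroup (H F), Q ≠ ⊥ → IsRadical ℓ Q →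
        ConjIn (H F) (Q.map (H F).subtype) (Q2 F ℓ)) := by
  -- The order of U is q - ε and its cofactor in q² - 1 is q + ε. These differ by 2, so the odd
  -- prime ℓ divides only the former.
  have hone : (ℓ : ℤ) ∣ (Nat.card F : ℤ) - ((1 : ℤˣ) : ℤ) →
      ℓ ∣ Nat.card Fˣ ∧ ¬ ℓ ∣ Nat.card F + 1 := fun h => by
    have h1 := dvd_card_sub_one h
    refine ⟨by rwa [Nat.card_units], ?_⟩
    have h2 := not_dvd_of_dvd_add_two hℓ hℓ2 h1
    have : 1 ≤ Nat.card F := Nat.card_pos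
    rwa [show Nat.card F - 1 + 2 = Nat.card F + 1 by omega] at h2
  have hneg : (ℓ : ℤ) ∣ (Nat.card F : ℤ) - ((-1 : ℤˣ) : ℤ) →
      ℓ ∣ Nat.card (NormOne F 1) ∧ ¬ ℓ ∣ Nat.card F - 1 := fun h => by
    have h1 := dvd_card_add_one h
    refine ⟨by rwa [card_normOne, pow_one], fun h2 => not_dvd_of_dvd_add_two hℓ hℓ2 h2 ?_⟩
    have : 1 ≤ Nat.card F := Nat.card_pos
    rwa [show Nat.card F - 1 + 2 = Nat.card F + 1 by omega]
  refine ⟨fun hℓ3 _ ε hε => ?_, fun hℓ3 _ ε hε P => ?_, fun hℓ3 hd ε hε Q hne hQ => ?_,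
    fun hd Q hne hQ => conjIn_Q2_top hℓ hℓ2 hd hQ.radicalIn_top hne, fun _ ε hε => ?_,
    fun hd Q hne hQ => conjIn_Q2_H hℓ hℓ2 hd hQ.radicalIn_top.map_subtype fun h =>
      hne ((Subgroup.map_eq_bot_iff_of_injective _ (H F).subtype_injective).1 h)⟩
  · rcases Int.units_eq_one_or ε with rfl | rfl
    · obtain ⟨hd, hu⟩ := hone hε
      exact classification_of_ne_three _ (Qr_one (exists_ne_one_of_dvd hℓ hd) ℓ) hℓ hℓ2
        card_units_mul hu hd hℓ3
    · obtain ⟨hd, hu⟩ := hneg hε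
      exact classification_of_ne_three _ (Qr_neg_one (exists_ne_one_of_dvd hℓ hd) ℓ) hℓ hℓ2
        card_normOne_mul hu hd hℓ3
  · subst hℓ3
    rcases Int.units_eq_one_or ε with rfl | rfl
    · obtain ⟨hd, hu⟩ := hone hε
      refine classification_three _ (Qr_one (exists_ne_one_of_dvd hℓ hd) 3) card_units_mul hu hd
        (fun ω => R_one _) cubicEmb_injective (Q3_one 3) ?_ P
      rw [card_units_ext, Nat.card_units]
      exact three_mul_dvd_cubic (dvd_card_sub_one hε) Finite.one_lt_card
    · obtain ⟨hd, hu⟩ := hneg hε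
      refine classification_three _ (Qr_neg_one (exists_ne_one_of_dvd hℓ hd) 3) card_normOne_mul hu
        hd (fun ω => R_neg_one _) (normOneSp_injective 3) (Q3_neg_one 3) ?_ P
      rw [card_normOne, card_normOne, pow_one]
      exact three_mul_dvd_cubic_add (dvd_card_add_one hε)
  · rcases Int.units_eq_one_or ε with rfl | rfl
    · exact conjIn_Q3_one hℓ hℓ2 hℓ3 hd hε hQ.radicalIn_top hne
    · exact conjIn_Q3_neg_one hℓ hℓ2 hℓ3 hd hε hQ.radicalIn_top hne
  · rcases Int.units_eq_one_or ε with rfl | rfl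
    · obtain ⟨hd, hu⟩ := hone hε
      exact classification_stabilizer _ rfl (Qr_one (exists_ne_one_of_dvd hℓ hd) ℓ) hℓ hℓ2
        card_units_mul hu hd
    · obtain ⟨hd, hu⟩ := hneg hε
      exact classification_stabilizer _ rfl (Qr_neg_one (exists_ne_one_of_dvd hℓ hd) ℓ) hℓ hℓ2
        card_normOne_mul hu hd
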